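/- **Setting.** Let $d\ge 2$, $m\ge 1$, let $Z_1,\dots,Z_m\in\mathbb R^d$ be orthonormal and let $F(u)=\sum_{i=1}^m g_i(\langle u,Z_i\rangle)$ on the closed unit ball, where each $g_i\in C^2([-1,1])$ satisfies: $g_i$ is even or odd; $\frac{d^2}{dx^2}g_i(\sqrt x)>0$ on $(0,1]$ or $-\frac{d^2}{dx^2}g_i(\sqrt x)>0$ on $(0,1]$; the right derivative of $g_i(\sqrt x)$ at $0$ is $0$; $g_i(0)=0$. Put $h_i(x)=g_i(\operatorname{sign}(x)\sqrt{|x|})$. $F$ is *$(\alpha,\beta,\gamma,\delta)$-robust* if $\alpha,\beta,\gamma,\delta>0$ and $\beta x^{\delta-1}\le |h_i''(x)|\le\alpha x^{\gamma-1}$ for all $x\in(0,1]$ and all $i$. A map $\widehat{\nabla F}$ is an *$\epsilon$-approximation* of $\nabla F$ ($\epsilon>0$) if $\|\widehat{\nabla F}(u)-\nabla F(u)\|\le\epsilon$ for all $\|u\|\le 1$. Let $\hat G(u)=\widehat{\nabla F}(u)/\|\widehat{\nabla F}(u)\|$ if $\widehat{\nabla F}(u)\ne 0$, and $\hat G(u)=u$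 otherwise. **Algorithm.** FindBasisElement$(\{\mu_1,\dots,\mu_k\},\sigma)$: choose orthonormal $x_1,\dots,x_{d-k}\in\operatorname{span}(\mu_1,\dots,\mu_k)^\perp$; let $j$ maximize $\|\widehat{\nabla F}(x_j)\|$; set $u\leftarrow\hat G^{N_1}(\hat G(x_j))$; then repeat $I$ times: draw $x$ uniformly at random from $\sigma S^{d-1}\cap u^\perp$ (given the past), set $w\leftarrow u\cos\|x\|+\frac{x}{\|x\|}\sin\|x\|$ and $u\leftarrow\hat G^{N_2}(w)$; return $u$. RobustGI-Recovery$(\hat m,\sigma)$: for $i=1,\dots,\hat m$ set $\mu_i\leftarrow$ FindBasisElement$(\{\mu_1,\dots,\mu_{i-1}\},\sigma)$; return $\mu_1,\dots,\mu_{\hat m}$. **Quantities.** Let $$\tau=\Big[\tfrac{\beta\gamma}{16\alpha\delta}m^{-\delta}\Big]^{\frac1{2\gamma}},\qquad \eta_0=\tfrac{\sigma}{\sqrt d}\Big(\tfrac{\beta\gamma}{\alpha\delta m^\delta}\Big)^{\frac1\gamma}\tau^2,$$ $$E(\eta)=\tfrac{9}{256}\tfrac\beta\delta\Big(\tfrac{\beta\gamma}{\alpha\delta}\Big)^{\frac{2\delta+1}{2\gamma}}m^{-\frac\delta\gamma(\frac12+\delta-\gamma)-\delta}\,\tau^{2+2\delta}\,\eta,$$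 $$N_{\mathrm{sc}}=\Big\lceil\log_{1+2\gamma}\Big(\log_2\big(\tfrac{\beta\gamma}{8\alpha\delta}\big)+2\gamma\log_2\big(\tfrac{\beta}{4\delta\epsilon}\big)\Big)\Big\rceil,$$ $$N_{\mathrm{spread}}(\eta)=\Big\lceil\tfrac{3}{2\eta}\Big(\tfrac{\alpha\delta}{\beta\gamma}\Big)^{\frac\delta\gamma}m^{\frac\delta\gamma(\delta-\gamma)}\Big[\tfrac1\gamma\ln\tfrac{4\alpha\delta}{\beta\gamma}+\tfrac\delta\gamma\ln m\Big]\Big\rceil+2N_{\mathrm{sc}}.$$ **Theorem.** There are universal constants $C_0,C_1,C_2>0$ such that the following holds. Let $F$ be $(\alpha,\beta,\gamma,\delta)$-robust and let $\widehat{\nabla F}$ be a (Borel measurable) $\epsilon$-approximation of $\nabla F$. Suppose that - $0<\sigma\le\frac{1}{6\sqrt{2d(1+2\delta)}}\,\tau^2$, - $\epsilon\le C_0\,E(\eta_0)\,d^{-\delta}$, - $N_1\ge 2N_{\mathrm{sc}}$ and $N_2\ge 2N_{\mathrm{sc}}+C_1N_{\mathrm{spread}}(\eta_0)$, - $p\in(0,1)$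 and $I\ge C_2\,m\lceil\ln(m/p)\rceil$, - $\hat m$ is an integer with $m\le\hat m\le d$. Execute $\mu_1,\dots,\mu_{\hat m}\leftarrow$ RobustGI-Recovery$(\hat m,\sigma)$. Then with probability at least $1-p$ there are a permutation $\pi$ of $[m]$ and signs $s_1,\dots,s_m\in\{+1,-1\}$ such that $$\|s_i\mu_i-Z_{\pi(i)}\|\le 4\sqrt2\,\delta\epsilon/\beta\qquad\text{for all } i\in[m].$$ -/

import Mathlib

open MeasureTheory Set Metric

noncomputable section

namespace HiddenBasis

/-- `ℝ^d` with the Euclidean norm. -/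
abbrev E (d : ℕ) : Type := EuclideanSpace ℝ (Fin d)

/-- The data of a basis encoding function: orthonormal hidden basis vectors `Z 0, …, Z (m - 1)`
in `ℝ^d` and contrast functions `g i ∈ C²([-1, 1])` (only the values on `[-1, 1]` matter)
satisfying the four structural assumptions. -/
structure BEF (d m : ℕ) where
  /-- the hidden basis -/
  Z : Fin m → E d
  /-- the contrast functions -/
  g : Fin m → ℝ → ℝ
  orthonormal : Orthonormal ℝ Z
  contDiffOn : ∀ i, ContDiffOn ℝ 2 (g i) (Icc (-1) 1)
  even_or_odd : ∀ i,
    (∀ x ∈ Icc (-1 : ℝ) 1, g i (-x) = g i x) ∨ (∀ x ∈ Icc (-1 : ℝ) 1, g i (-x) = -g i x)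
  /-- one of `± g i (√x)` has positive second derivative on `(0, 1]` -/
  strict_convex : ∀ i,
    (∀ x ∈ Ioc (0 : ℝ) 1, 0 < iteratedDerivWithin 2 (fun t => g i (√t)) (Ioc 0 1) x) ∨
    (∀ x ∈ Ioc (0 : ℝ) 1, 0 < -iteratedDerivWithin 2 (fun t => g i (√t)) (Ioc 0 1) x)
  /-- the right derivative of `g i (√x)` at the origin vanishes -/
  deriv_zero : ∀ i, HasDerivWithinAt (fun t => g i (√t)) 0 (Icc 0 1) 0
  map_zero : ∀ i, g i 0 = 0

namespace BEF

variable {d m : ℕ} (B : BEF d m)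

/-- The basis encoding function `F(u) = ∑ᵢ gᵢ(⟨u, Zᵢ⟩)`, meaningful on the closed unit ball. -/
def F (u : E d) : ℝ := ∑ i, B.g i (inner ℝ u (B.Z i))

/-- The gradient of `F` on the closed unit ball (one-sided at boundary points). -/
def gradF (u : E d) : E d := gradientWithin B.F (closedBall 0 1) u

/-- `hᵢ(x) = gᵢ(sign(x) √|x|)`. -/
def h (i : Fin m) (x : ℝ) : ℝ := B.g i (SignType.sign x * √|x|)

/-- `(α, β, γ, δ)`-robustness: `β x^(δ-1) ≤ |hᵢ''(x)| ≤ α x^(γ-1)` on `(0, 1]`,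
for strictly positive constants. -/
def Robust (α β γ δ : ℝ) : Prop :=
  0 < α ∧ 0 < β ∧ 0 < γ ∧ 0 < δ ∧
    ∀ i, ∀ x ∈ Ioc (0 : ℝ) 1,
      β * x ^ (δ - 1) ≤ |iteratedDerivWithin 2 (B.h i) (Ioc 0 1) x| ∧
      |iteratedDerivWithin 2 (B.h i) (Ioc 0 1) x| ≤ α * x ^ (γ - 1)

/-- `gradHat` is an `ε`-approximation of `∇F`. -/
def IsApprox (gradHat : E d → E d) (ε : ℝ) : Prop :=
  0 < ε ∧ ∀ u ∈ closedBall (0 : E d) 1, ‖gradHat u - B.gradF u‖ ≤ ε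

end BEF

/-! ### The algorithms -/

variable {d : ℕ}

open Classical in
/-- The estimated gradient iteration map `Ĝ`. -/
def GHat (gradHat : E d → E d) (u : E d) : E d :=
  if gradHat u = 0 then u else ‖gradHat u‖⁻¹ • gradHat u

/-- `N` steps of the gradient iteration. -/
def giLoop (gradHat : E d → E d) (u : E d) (N : ℕ) : E d := (GHat gradHat)^[N] u

/-- The random jump `u cos ‖x‖ + (x / ‖x‖) sin ‖x‖` (the exponential map of the sphere). -/
def jumpMap (u x : E d) : E d := Real.cos ‖x‖ • u + (Real.sin ‖x‖ * ‖x‖⁻¹) • x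

/-- The uniform probability measure on the unit sphere of a finite-dimensional inner product
space (normalized surface measure). -/
def uniformSphere (V : Type*) [NormedAddCommGroup V] [InnerProductSpace ℝ V]
    [FiniteDimensional ℝ V] [MeasurableSpace V] [BorelSpace V] :
    Measure (sphere (0 : V) 1) :=
  ((Measure.addHaar : Measure V).toSphere univ)⁻¹ • (Measure.addHaar : Measure V).toSphere

/-- The uniform distribution on `σ S^{d-1} ∩ u^⊥`, as a measure on `ℝ^d`. -/
def uniformTangent (σ : ℝ) (u : E d) : Measure (E d) :=
  (uniformSphere ((ℝ ∙ u)ᗮ : Submodule ℝ (E d))).map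
    (fun v : sphere (0 : ((ℝ ∙ u)ᗮ : Submodule ℝ (E d))) 1 => σ • (v.1 : E d))

/-- One (random) execution of `FindBasisElement({μ₁, …, μ_k}, σ)` returning `out`, on a probability
space `(Ω, P)`. `ℱ t` is the information available just before the `t`-th random draw
(`t = 0, 1, …`). The orthonormal vectors `x` and the tie-breaking in the argmax may be chosen in an
arbitrary (measurable) way on the basis of what is known when the call starts. -/
structure FindBasisElementRun {Ω : Type*} [MeasurableSpace Ω] (P : Measure Ω)
    (gradHat : E d → E d) (σ : ℝ) (N₁ N₂ I : ℕ) {k : ℕ} (μ : Fin k → Ω → E d)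
    (ℱ : ℕ → MeasurableSpace Ω) (out : Ω → E d) where
  /-- orthonormal vectors `x_1, …, x_{d-k}` orthogonal to `μ_1, …, μ_k` -/
  x : Ω → Fin (d - k) → E d
  measurable_x : ∀ i, Measurable[ℱ 0] (fun ω => x ω i)
  x_orthonormal : ∀ ω, Orthonormal ℝ (x ω)
  x_perp : ∀ ω i l, inner ℝ (μ l ω) (x ω i) = 0
  /-- the index maximizing `‖∇̂F(x_i)‖` -/
  j : Ω → Fin (d - k)
  measurable_j : Measurable[ℱ 0] j
  j_max : ∀ ω i, ‖gradHat (x ω i)‖ ≤ ‖gradHat (x ω (j ω))‖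
  /-- `u t` is the current vector after `t` iterations of the main loop -/
  u : ℕ → Ω → E d
  /-- `jump t` is the random vector drawn in iteration `t` of the main loop -/
  jump : ℕ → Ω → E d
  u_zero : ∀ ω, u 0 ω = giLoop gradHat (GHat gradHat (x ω (j ω))) N₁
  measurable_jump : ∀ t < I, Measurable[ℱ (t + 1)] (jump t)
  /-- given the past, `jump t` is uniformly distributed on `σ S^{d-1} ∩ (u t)^⊥` -/
  jump_law : ∀ t < I, ∀ A, MeasurableSet[ℱ t] A → ∀ S, MeasurableSet S →
    P (A ∩ jump t ⁻¹' S) = ∫⁻ ω in A, uniformTangent σ (u t ω) S ∂P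
  u_succ : ∀ t < I, ∀ ω, u (t + 1) ω = giLoop gradHat (jumpMap (u t ω) (jump t ω)) N₂
  out_eq : ∀ ω, out ω = u I ω

/-- One (random) execution of `RobustGI-Recovery(m̂, σ)`. The outputs are `μ 0, …, μ (m̂ - 1)`
(the other values of `μ` are irrelevant); `ℱ k t` is the information available just before the
`t`-th random draw in the `k`-th call of `FindBasisElement`. -/
structure RobustGIRecoveryRun {Ω : Type*} [mΩ : MeasurableSpace Ω] (P : Measure Ω)
    (gradHat : E d → E d) (σ : ℝ) (N₁ N₂ I mhat : ℕ) where
  ℱ : ℕ → ℕ → MeasurableSpace Ω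
  ℱ_le : ∀ k t, ℱ k t ≤ mΩ
  ℱ_mono : ∀ k t, ℱ k t ≤ ℱ k (t + 1)
  ℱ_next : ∀ k, ℱ k I ≤ ℱ (k + 1) 0
  μ : ℕ → Ω → E d
  call : ∀ k < mhat, FindBasisElementRun P gradHat σ N₁ N₂ I (fun l : Fin k => μ l) (ℱ k) (μ k)

/-! ### The parameter bounds -/

/-- The threshold `τ = [βγ / (16αδ) · m^{-δ}]^{1/(2γ)}`. -/
def tau (α β γ δ : ℝ) (m : ℕ) : ℝ :=
  (β * γ / (16 * α * δ) * (m : ℝ) ^ (-δ)) ^ (1 / (2 * γ))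

/-- `N_sc = ⌈log_{1+2γ}(log₂(βγ/(8αδ)) + 2γ log₂(β/(4δε)))⌉`. -/
def Nsc (α β γ δ ε : ℝ) : ℤ :=
  ⌈Real.logb (1 + 2 * γ)
    (Real.logb 2 (β * γ / (8 * α * δ)) + 2 * γ * Real.logb 2 (β / (4 * δ * ε)))⌉

/-- `E(η) = (9/256)(β/δ)(βγ/(αδ))^{(2δ+1)/(2γ)} m^{-(δ/γ)(1/2+δ-γ)-δ} τ^{2+2δ} η`. -/
def epsDiverge (α β γ δ : ℝ) (m : ℕ) (η : ℝ) : ℝ :=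
  9 / 256 * (β / δ) * (β * γ / (α * δ)) ^ ((2 * δ + 1) / (2 * γ)) *
    (m : ℝ) ^ (-(δ / γ) * (1 / 2 + δ - γ) - δ) * tau α β γ δ m ^ (2 + 2 * δ) * η

/-- `N_spread(η) = ⌈(3/(2η)) (αδ/(βγ))^{δ/γ} m^{(δ/γ)(δ-γ)}
[(1/γ) ln(4αδ/(βγ)) + (δ/γ) ln m]⌉ + 2 N_sc`. -/
def Nspread (α β γ δ : ℝ) (m : ℕ) (ε η : ℝ) : ℤ :=
  ⌈3 / (2 * η) * (α * δ / (β * γ)) ^ (δ / γ) * (m : ℝ) ^ (δ / γ * (δ - γ)) *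
    (1 / γ * Real.log (4 * α * δ / (β * γ)) + δ / γ * Real.log m)⌉ + 2 * Nsc α β γ δ ε

/-- `η₀ = (σ/√d) (βγ/(αδ m^δ))^{1/γ} τ²`. -/
def eta (α β γ δ : ℝ) (d m : ℕ) (σ : ℝ) : ℝ :=
  σ / √d * (β * γ / (α * δ * (m : ℝ) ^ δ)) ^ (1 / γ) * tau α β γ δ m ^ 2

end HiddenBasis

end

/-! Write `u_k` for the hidden coordinates of `u`. The chain rule gives `∇F(u)` the coordinates `± 2
u_k f_k(u_k²)` with `f_k = |h_k'|`, and integrating robustness gives two-sided power bounds on the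
increments of `f_k`. Multiplying the estimate by `δ/(2β)` changes neither `Ĝ` nor the argmax. The
rescaled map is within `e/2`, `e = δε/β`, of a vector with coordinates `± u_k φ_k(u_k²)`. Here `φ_k`
is increasing, with increments at least those of `t^δ` and at most those of `t^γ/r`, `r = βγ/(αδ)`.
One iteration multiplies each coordinate by its ratio `φ_k(u_k²)` and normalizes, so coordinates
with large ratios win.

Small coordinates die. A coordinate at most `τ` has ratio at most `m^(-δ)/16`, while near the hidden
span the gradient norm is at least about `m^(-δ)` by the power mean inequality. Such coordinates
decay superexponentially to the noise floor `θ = στ/10` and stay there (`giLoop_small`,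
`giLoop_tiny`, `giLoop_stay`). A jump adds at most `σ`, and `θ + σ < τ`, so the set `L` of
coordinates above `θ` never gains a member (`tame_next`).

Several big coordinates are unstable. On the simplex over `L` there is a balanced point `t` where
all `φ_i(t_i)` equal one value `c` (`exists_balanced`). If some ratio exceeds `c`, then some other
coordinate of `L` lies at or below its balanced value, so the gradient norm is strictly below the
largest ratio and the coordinate carrying that ratio grows (`growth`). The logarithmic excess over
`c` grows geometrically up to `1` and linearly afterwards. Ratios are at most `1/r`, so some
coordinate of `L` must fall to `τ` (`escape`).

The excess comes from the jump. Second and fourth moments on the sphere show that a jump moves a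
chosen coordinate outwards by `σν/(2√d)` with probability at least `1/24`
(`sphereMeasure_coord_ge`). A coordinate too close to `±1` to be moved already exceeds its balanced
value by more than a jump can undo (`exceed_of_large`). Hence the potential `2^|L|`, set to zero
once `|L| ≤ 1`, contracts in mean by `47/48` per round, and Markov's inequality bounds the failure
probability of a call by `p/m`.

With one big coordinate left, the off-axis part converges superexponentially to at most `4e`, which
is the error `√2 · 4e` of the theorem (`offAxis_giLoop`). A call starts orthogonally to the vectors
already found, so its first iterate has the old coordinates below `θ`, and they cannot return
(`tame_init`). Induction over the first `m` calls and a union bound finish the proof. -/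

noncomputable section

namespace HiddenBasis

variable {d m : ℕ}

/-! ### Radial profiles and the gradient of `F` -/

section

open Filter Topology

/-- Integrating two-sided power bounds on the second derivative of a function with vanishing
derivative at the origin. -/
lemma exists_increment_bounds {φ : ℝ → ℝ} {α β γ δ s : ℝ} (hγ : 0 < γ) (hδ : 0 < δ)
    (hs : s = 1 ∨ s = -1)
    (hφ : ContDiffOn ℝ 2 φ (Ioc 0 1)) (hc : ContinuousOn φ (Icc 0 1))
    (hd : HasDerivWithinAt φ 0 (Icc 0 1) 0)
    (hpos : ∀ x ∈ Ioc (0 : ℝ) 1, 0 < s * iteratedDerivWithin 2 φ (Ioc 0 1) x)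
    (hb : ∀ x ∈ Ioc (0 : ℝ) 1, β * x ^ (δ - 1) ≤ |iteratedDerivWithin 2 φ (Ioc 0 1) x| ∧
      |iteratedDerivWithin 2 φ (Ioc 0 1) x| ≤ α * x ^ (γ - 1)) :
    ∃ f : ℝ → ℝ, f 0 = 0 ∧ (∀ t ∈ Ioc (0 : ℝ) 1, f t = s * derivWithin φ (Ioc 0 1) t) ∧
      ∀ a b, 0 ≤ a → a ≤ b → b ≤ 1 →
        β / δ * (b ^ δ - a ^ δ) ≤ f b - f a ∧ f b - f a ≤ α / γ * (b ^ γ - a ^ γ) := by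
  have hu : UniqueDiffOn ℝ (Ioc (0 : ℝ) 1) := uniqueDiffOn_Ioc 0 1
  set D1 := derivWithin φ (Ioc 0 1) with hD1
  set D2 := iteratedDerivWithin 2 φ (Ioc 0 1) with hD2
  have hD2' : ∀ x, D2 x = derivWithin D1 (Ioc 0 1) x := by
    intro x
    rw [hD2, iteratedDerivWithin_succ]
    congr 1
    rw [iteratedDerivWithin_one]
  have hD1c : ContDiffOn ℝ 1 D1 (Ioc 0 1) := hφ.derivWithin hu (by norm_num)
  have hder : ∀ x ∈ Ioo (0 : ℝ) 1, HasDerivAt D1 (D2 x) x := by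
    intro x hx
    rw [hD2']
    exact ((hD1c.differentiableOn one_ne_zero x (Ioo_subset_Ioc_self hx)).hasDerivWithinAt).hasDerivAt
      (mem_of_superset (Ioo_mem_nhds hx.1 hx.2) Ioo_subset_Ioc_self)
  have habs : ∀ x ∈ Ioc (0 : ℝ) 1, |D2 x| = s * D2 x := by
    intro x hx
    have h := hpos x hx
    rw [← abs_of_pos h, abs_mul]
    rcases hs with rfl | rfl <;> simp
  have hpow : ∀ {p : ℝ}, 0 < p → ∀ x ∈ Ioo (0 : ℝ) 1, ∀ c : ℝ,
      HasDerivAt (fun y : ℝ => c / p * y ^ p) (c * x ^ (p - 1)) x := by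
    intro p hp x hx c
    have := (Real.hasDerivAt_rpow_const (x := x) (p := p) (Or.inl hx.1.ne')).const_mul (c / p)
    rwa [show c / p * (p * x ^ (p - 1)) = c * x ^ (p - 1) by field_simp] at this
  have hpowc : ∀ {p : ℝ}, 0 < p → ∀ c : ℝ, Continuous (fun y : ℝ => c / p * y ^ p) := by
    intro p hp c
    exact continuous_const.mul (Real.continuous_rpow_const hp.le)
  -- The derivative of this difference is `|φ''| - β x^(δ-1) ≥ 0`, because `s` is the sign of `φ''`;
  -- `hup` is the mirror image.
  have hlow : MonotoneOn (fun x => s * D1 x - β / δ * x ^ δ) (Ioc 0 1) := by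
    have hdd : ∀ x ∈ Ioo (0 : ℝ) 1,
        HasDerivAt (fun x => s * D1 x - β / δ * x ^ δ) (s * D2 x - β * x ^ (δ - 1)) x :=
      fun x hx => ((hder x hx).const_mul s).sub (hpow hδ x hx β)
    refine monotoneOn_of_deriv_nonneg (convex_Ioc 0 1)
      ((hD1c.continuousOn.const_mul s).sub (hpowc hδ β).continuousOn) ?_ ?_
    · rw [interior_Ioc]
      exact fun x hx => (hdd x hx).differentiableAt.differentiableWithinAt
    · rw [interior_Ioc]
      intro x hx
      rw [(hdd x hx).deriv, ← habs x (Ioo_subset_Ioc_self hx)]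
      linarith [(hb x (Ioo_subset_Ioc_self hx)).1]
  have hup : MonotoneOn (fun x => α / γ * x ^ γ - s * D1 x) (Ioc 0 1) := by
    have hdd : ∀ x ∈ Ioo (0 : ℝ) 1,
        HasDerivAt (fun x => α / γ * x ^ γ - s * D1 x) (α * x ^ (γ - 1) - s * D2 x) x :=
      fun x hx => (hpow hγ x hx α).sub ((hder x hx).const_mul s)
    refine monotoneOn_of_deriv_nonneg (convex_Ioc 0 1)
      ((hpowc hγ α).continuousOn.sub (hD1c.continuousOn.const_mul s)) ?_ ?_
    · rw [interior_Ioc]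
      exact fun x hx => (hdd x hx).differentiableAt.differentiableWithinAt
    · rw [interior_Ioc]
      intro x hx
      rw [(hdd x hx).deriv, ← habs x (Ioo_subset_Ioc_self hx)]
      linarith [(hb x (Ioo_subset_Ioc_self hx)).2]
  -- the derivative tends to zero along a sequence
  have hsmall : ∀ ε : ℝ, 0 < ε → ∃ t, 0 < t ∧ t < ε ∧ t ≤ 1 ∧ |D1 t| < ε := by
    intro ε hε
    have h1 : Tendsto (slope φ 0) (𝓝[Icc 0 1 \ {0}] 0) (𝓝 0) :=
      hasDerivWithinAt_iff_tendsto_slope.1 hd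
    have h2 : ∀ᶠ x in 𝓝[Icc 0 1 \ {0}] (0 : ℝ), |slope φ 0 x| < ε := by
      have := h1.abs
      rw [abs_zero] at this
      exact this.eventually (gt_mem_nhds hε)
    have h3 : (Icc (0 : ℝ) 1 \ {0}) = Ioc 0 1 := Icc_sdiff_left
    rw [h3, nhdsWithin_Ioc_eq_nhdsGT zero_lt_one] at h2
    have h4 : ∀ᶠ x in 𝓝[>] (0 : ℝ), x < min ε 1 :=
      mem_nhdsWithin_of_mem_nhds (Iio_mem_nhds (lt_min hε one_pos))
    obtain ⟨x, ⟨hx1, hx2⟩, hx3⟩ := ((h2.and h4).and self_mem_nhdsWithin).exists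
    have hx0 : (0 : ℝ) < x := hx3
    have hxε := lt_of_lt_of_le hx2 (min_le_left _ _)
    have hx1' := lt_of_lt_of_le hx2 (min_le_right _ _)
    -- Nothing says that `φ'` is continuous at `0`; the hypothesis controls only difference
    -- quotients. The mean value theorem turns a small quotient into a point with small derivative,
    -- and monotonicity makes one such sequence enough.
    obtain ⟨c, hc1, hc2⟩ := exists_hasDerivAt_eq_slope φ D1 hx0
      (hc.mono (Icc_subset_Icc_right hx1'.le)) (by
        intro y hy
        have hy' : y ∈ Ioo (0 : ℝ) 1 := ⟨hy.1, hy.2.trans hx1'⟩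
        exact ((hφ.differentiableOn two_ne_zero y
          (Ioo_subset_Ioc_self hy')).hasDerivWithinAt).hasDerivAt
          (mem_of_superset (Ioo_mem_nhds hy'.1 hy'.2) Ioo_subset_Ioc_self))
    refine ⟨c, hc1.1, hc1.2.trans hxε, (hc1.2.trans hx1').le, ?_⟩
    rw [hc2, ← slope_def_field]
    exact hx1
  choose! t ht0 htε ht1 htD using hsmall
  set v : ℕ → ℝ := fun n => 1 / ((n : ℝ) + 1) with hv
  have hvpos : ∀ n, 0 < v n := fun n => Nat.one_div_pos_of_nat
  have hvlim : Tendsto v atTop (𝓝 0) := tendsto_one_div_add_atTop_nhds_zero_nat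
  have htlim : Tendsto (fun n => t (v n)) atTop (𝓝 0) :=
    squeeze_zero (fun n => (ht0 _ (hvpos n)).le) (fun n => (htε _ (hvpos n)).le) hvlim
  have hDlim : Tendsto (fun n => s * D1 (t (v n))) atTop (𝓝 0) := by
    have : Tendsto (fun n => D1 (t (v n))) atTop (𝓝 0) :=
      squeeze_zero_norm (fun n => (htD _ (hvpos n)).le) hvlim
    simpa using this.const_mul s
  have hplim : ∀ {p : ℝ}, 0 < p → ∀ c : ℝ,
      Tendsto (fun n => c / p * (t (v n)) ^ p) atTop (𝓝 0) := by
    intro p hp c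
    have := ((hpowc hp c).tendsto 0).comp htlim
    simp only [Real.zero_rpow hp.ne', mul_zero] at this
    exact this
  refine ⟨fun x => if x ≤ 0 then 0 else s * D1 x, by simp, fun x hx => by
    simp [not_le.2 hx.1], ?_⟩
  have hzero : ∀ b ∈ Ioc (0 : ℝ) 1, β / δ * b ^ δ ≤ s * D1 b ∧ s * D1 b ≤ α / γ * b ^ γ := by
    intro b hb'
    have hev : ∀ᶠ n in atTop, t (v n) ≤ b := htlim.eventually (ge_mem_nhds hb'.1)
    constructor
    · have hl : Tendsto (fun n => s * D1 (t (v n)) - β / δ * (t (v n)) ^ δ) atTop (𝓝 0) := by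
        simpa using hDlim.sub (hplim hδ β)
      have := le_of_tendsto hl (hev.mono fun n hn =>
        hlow ⟨ht0 _ (hvpos n), ht1 _ (hvpos n)⟩ hb' hn)
      linarith
    · have hl : Tendsto (fun n => α / γ * (t (v n)) ^ γ - s * D1 (t (v n))) atTop (𝓝 0) := by
        simpa using (hplim hγ α).sub hDlim
      have := le_of_tendsto hl (hev.mono fun n hn =>
        hup ⟨ht0 _ (hvpos n), ht1 _ (hvpos n)⟩ hb' hn)
      linarith
  intro a b ha hab hb1
  rcases ha.eq_or_lt with rfl | ha0
  · rcases hab.eq_or_lt with rfl | hb0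
    · simp
    · have := hzero b ⟨hb0, hb1⟩
      simp only [le_refl, if_true, not_le.2 hb0, if_false, sub_zero,
        Real.zero_rpow hδ.ne', Real.zero_rpow hγ.ne']
      exact this
  · have hb0 := ha0.trans_le hab
    simp only [not_le.2 ha0, not_le.2 hb0, if_false]
    have h1 := hlow ⟨ha0, hab.trans hb1⟩ ⟨hb0, hb1⟩ hab
    have h2 := hup ⟨ha0, hab.trans hb1⟩ ⟨hb0, hb1⟩ hab
    simp only at h1 h2
    constructor <;> linarith

namespace BEF

variable {d m : ℕ} (B : BEF d m)

/-- The radial profiles `f i = |hᵢ'|` on `[0, 1]`, with the bounds integrated from robustness. -/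
lemma exists_profile {α β γ δ : ℝ} (hR : B.Robust α β γ δ) (i : Fin m) :
    ∃ f : ℝ → ℝ, f 0 = 0 ∧
      (∀ a b, 0 ≤ a → a ≤ b → b ≤ 1 →
        β / δ * (b ^ δ - a ^ δ) ≤ f b - f a ∧ f b - f a ≤ α / γ * (b ^ γ - a ^ γ)) ∧
      ∀ y ∈ Icc (-1 : ℝ) 1, |derivWithin (B.g i) (Icc (-1) 1) y| = 2 * |y| * f (y ^ 2) := by
  obtain ⟨hα, hβ, hγ, hδ, hb⟩ := hR
  set φ : ℝ → ℝ := fun t => B.g i (√t) with hφdef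
  have hmaps : MapsTo Real.sqrt (Icc 0 1) (Icc (-1) 1) := fun x hx =>
    ⟨by linarith [Real.sqrt_nonneg x], Real.sqrt_le_one.2 hx.2⟩
  have hφ : ContDiffOn ℝ 2 φ (Ioc 0 1) := by
    refine (B.contDiffOn i).comp (fun x hx => ?_) (hmaps.mono_left Ioc_subset_Icc_self)
    exact (Real.contDiffAt_sqrt hx.1.ne').contDiffWithinAt
  have hcont : ContinuousOn φ (Icc 0 1) :=
    (B.contDiffOn i).continuousOn.comp Real.continuous_sqrt.continuousOn hmaps
  have heq : EqOn (B.h i) φ (Ioc 0 1) := by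
    intro x hx
    simp [BEF.h, hφdef, sign_pos hx.1, abs_of_pos hx.1]
  have hb' : ∀ x ∈ Ioc (0 : ℝ) 1, β * x ^ (δ - 1) ≤ |iteratedDerivWithin 2 φ (Ioc 0 1) x| ∧
      |iteratedDerivWithin 2 φ (Ioc 0 1) x| ≤ α * x ^ (γ - 1) := by
    intro x hx
    have := hb i x hx
    rwa [iteratedDerivWithin_congr heq hx] at this
  obtain ⟨s, hs, hpos⟩ : ∃ s : ℝ, (s = 1 ∨ s = -1) ∧
      ∀ x ∈ Ioc (0 : ℝ) 1, 0 < s * iteratedDerivWithin 2 φ (Ioc 0 1) x := by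
    rcases B.strict_convex i with h | h
    · exact ⟨1, Or.inl rfl, fun x hx => by rw [one_mul]; exact h x hx⟩
    · exact ⟨-1, Or.inr rfl, fun x hx => by rw [neg_one_mul]; exact h x hx⟩
  obtain ⟨f, hf0, hf1, hf2⟩ := exists_increment_bounds hγ hδ hs hφ hcont (B.deriv_zero i)
    hpos hb'
  refine ⟨f, hf0, hf2, ?_⟩
  have hnn : ∀ t ∈ Ioc (0 : ℝ) 1, 0 ≤ f t := by
    intro t ht
    have := (hf2 0 t le_rfl ht.1.le ht.2).1
    rw [hf0, Real.zero_rpow hδ.ne', sub_zero, sub_zero] at this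
    exact le_trans (mul_nonneg (div_nonneg hβ.le hδ.le) (Real.rpow_nonneg ht.1.le _)) this
  have hgd : ∀ y ∈ Icc (-1 : ℝ) 1,
      HasDerivWithinAt (B.g i) (derivWithin (B.g i) (Icc (-1) 1) y) (Icc (-1) 1) y := fun y hy =>
    ((B.contDiffOn i).differentiableOn two_ne_zero y hy).hasDerivWithinAt
  -- positive arguments
  have hposarg : ∀ y ∈ Ioc (0 : ℝ) 1,
      |derivWithin (B.g i) (Icc (-1) 1) y| = 2 * |y| * f (y ^ 2) := by
    intro y hy
    have hy2 : y ^ 2 ∈ Ioc (0 : ℝ) 1 := ⟨by have := hy.1; positivity, by nlinarith [hy.1, hy.2]⟩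
    -- On `(0, 1]` one has `g(y) = φ(y²)`, whence `g'(y) = 2y φ'(y²)`. Parity of `g` covers negative
    -- arguments.
    have h1 : HasDerivWithinAt φ (derivWithin φ (Ioc 0 1) (y ^ 2)) (Ioc 0 1) (y ^ 2) :=
      (hφ.differentiableOn two_ne_zero _ hy2).hasDerivWithinAt
    have h2 : HasDerivWithinAt (fun z : ℝ => z ^ 2) (2 * y) (Ioc 0 1) y := by
      simpa using (hasDerivAt_pow 2 y).hasDerivWithinAt
    have h3 := HasDerivWithinAt.comp (h := fun z : ℝ => z ^ 2) y h1 h2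
      (fun z hz => ⟨by have := hz.1; positivity, by nlinarith [hz.1, hz.2]⟩)
    have h4 : HasDerivWithinAt (B.g i) (derivWithin φ (Ioc 0 1) (y ^ 2) * (2 * y)) (Ioc 0 1) y := by
      refine h3.congr (fun z hz => ?_) ?_
      · simp [hφdef, Real.sqrt_sq hz.1.le]
      · simp [hφdef, Real.sqrt_sq hy.1.le]
    have h5 := (hgd y ⟨by linarith [hy.1], hy.2⟩).mono
      (show Ioc (0 : ℝ) 1 ⊆ Icc (-1) 1 from fun z hz => ⟨by linarith [hz.1], hz.2⟩)
    have h6 := (uniqueDiffOn_Ioc (0 : ℝ) 1 y hy).eq_deriv _ h5 h4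
    have hd1 : |derivWithin φ (Ioc 0 1) (y ^ 2)| = f (y ^ 2) := by
      rw [← abs_of_nonneg (hnn _ hy2), hf1 _ hy2, abs_mul]
      rcases hs with rfl | rfl <;> simp
    rw [h6, abs_mul, hd1, abs_mul, abs_two]
    ring
  -- the derivative of `g (-y)`
  have hneg : ∀ y ∈ Icc (-1 : ℝ) 1,
      |derivWithin (B.g i) (Icc (-1) 1) (-y)| = |derivWithin (B.g i) (Icc (-1) 1) y| := by
    intro y hy
    have hy' : -y ∈ Icc (-1 : ℝ) 1 := ⟨by linarith [hy.2], by linarith [hy.1]⟩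
    have h1 : HasDerivWithinAt (fun z => B.g i (-z))
        (derivWithin (B.g i) (Icc (-1) 1) (-y) * (-1)) (Icc (-1) 1) y :=
      (hgd (-y) hy').comp y (hasDerivAt_neg y).hasDerivWithinAt
        (fun z hz => ⟨by linarith [hz.2], by linarith [hz.1]⟩)
    have hun := uniqueDiffOn_Icc (show (-1 : ℝ) < 1 by norm_num) y hy
    rcases B.even_or_odd i with he | ho
    · have h2 := h1.congr (fun z hz => (he z hz).symm) (he y hy).symm
      rw [← hun.eq_deriv _ h2 (hgd y hy)]
      simp
    · have h2 := h1.congr (f₁ := fun z => - B.g i z) (fun z hz => (ho z hz).symm) (ho y hy).symm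
      have h3 := hun.eq_deriv _ h2 (hgd y hy).neg
      have h4 : derivWithin (B.g i) (Icc (-1) 1) (-y) = derivWithin (B.g i) (Icc (-1) 1) y := by
        linarith
      rw [h4]
  -- the origin
  have hzero : derivWithin (B.g i) (Icc (-1) 1) 0 = 0 := by
    have h1 : HasDerivWithinAt (B.g i) 0 (Icc 0 1) 0 := by
      have h2 : HasDerivWithinAt (fun z : ℝ => z ^ 2) 0 (Icc 0 1) 0 := by
        simpa using (hasDerivAt_pow 2 (0 : ℝ)).hasDerivWithinAt
      have h3 : HasDerivWithinAt φ 0 (Icc 0 1) ((fun z : ℝ => z ^ 2) 0) := by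
        simpa using B.deriv_zero i
      have h4 := HasDerivWithinAt.comp (h := fun z : ℝ => z ^ 2) (0 : ℝ) h3 h2
        (fun z hz => ⟨sq_nonneg z, by nlinarith [hz.1, hz.2]⟩)
      have h5 := h4.congr (f₁ := B.g i) (fun z hz => by simp [hφdef, Real.sqrt_sq hz.1])
        (by simp [hφdef])
      simpa using h5
    exact (uniqueDiffOn_Icc (zero_lt_one' ℝ) 0 (by simp)).eq_deriv _
      ((hgd 0 (by simp)).mono (Icc_subset_Icc_left (by norm_num))) h1
  intro y hy
  rcases lt_trichotomy y 0 with h | h | h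
  · have h1 := hneg y hy
    rw [hposarg (-y) ⟨by linarith, by linarith [hy.1]⟩] at h1
    rw [← h1]
    simp
  · subst h
    rw [hzero]
    simp
  · exact hposarg y ⟨h, hy.2⟩

lemma abs_inner_le_one {u : E d} (hu : ‖u‖ ≤ 1) (k : Fin m) : |inner ℝ u (B.Z k)| ≤ 1 := by
  have := abs_real_inner_le_norm u (B.Z k)
  rw [B.orthonormal.1 k, mul_one] at this
  exact this.trans hu

/-- The gradient of `F` on the closed unit ball. -/
lemma gradF_eq {u : E d} (hu : ‖u‖ ≤ 1) :
    B.gradF u = ∑ i, derivWithin (B.g i) (Icc (-1) 1) (inner ℝ u (B.Z i)) • B.Z i := by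
  have hmem : u ∈ closedBall (0 : E d) 1 := by simpa using hu
  -- Convexity and nonempty interior make derivatives unique even at boundary points, where the
  -- one-sided gradient is meant.
  have hun : UniqueDiffWithinAt ℝ (closedBall (0 : E d) 1) u :=
    uniqueDiffOn_convex (convex_closedBall 0 1)
      ⟨0, by rw [interior_closedBall _ one_ne_zero]; simp⟩ u hmem
  have hF : HasGradientWithinAt B.F
      (∑ i, derivWithin (B.g i) (Icc (-1) 1) (inner ℝ u (B.Z i)) • B.Z i) (closedBall 0 1) u := by
    rw [hasGradientWithinAt_iff_hasFDerivWithinAt]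
    have h1 : ∀ i, HasFDerivWithinAt (fun u : E d => B.g i (inner ℝ u (B.Z i)))
        (derivWithin (B.g i) (Icc (-1) 1) (inner ℝ u (B.Z i)) •
          (innerSL ℝ (B.Z i))) (closedBall 0 1) u := by
      intro i
      have hg := ((B.contDiffOn i).differentiableOn two_ne_zero _
        (abs_le.1 (B.abs_inner_le_one hu i))).hasDerivWithinAt
      have hin : HasFDerivWithinAt (fun u : E d => (inner ℝ u (B.Z i) : ℝ))
          (innerSL ℝ (B.Z i)) (closedBall 0 1) u := by
        have := (innerSL ℝ (B.Z i)).hasFDerivWithinAt (s := closedBall (0 : E d) 1) (x := u)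
        refine this.congr_of_eventuallyEq ?_ ?_
        · exact Eventually.of_forall fun x => by simp [real_inner_comm]
        · simp [real_inner_comm]
      exact hg.comp_hasFDerivWithinAt u hin
        (fun x hx => abs_le.1 (B.abs_inner_le_one (by simpa using hx) i))
    have h2 := HasFDerivWithinAt.fun_sum (u := Finset.univ) (fun i _ => h1 i)
    have h3 : (InnerProductSpace.toDual ℝ (E d))
        (∑ i, derivWithin (B.g i) (Icc (-1) 1) (inner ℝ u (B.Z i)) • B.Z i) =
        ∑ i, derivWithin (B.g i) (Icc (-1) 1) (inner ℝ u (B.Z i)) • innerSL ℝ (B.Z i) := by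
      ext w
      simp
    rw [h3]
    exact h2
  have hF' := hF.differentiableWithinAt.hasGradientWithinAt
  rw [hasGradientWithinAt_iff_hasFDerivWithinAt] at hF hF'
  have := hun.eq hF' hF
  exact (InnerProductSpace.toDual ℝ (E d)).injective this

end BEF

end

/-! ### Splitting off the part orthogonal to the hidden basis -/

/-- The component of `u` orthogonal to the hidden basis. -/
def resid (Z : Fin m → E d) (u : E d) : E d := u - ∑ k, inner ℝ u (Z k) • Z k

lemma resid_add (Z : Fin m → E d) (u v : E d) : resid Z (u + v) = resid Z u + resid Z v := by
  simp only [resid, inner_add_left, add_smul, Finset.sum_add_distrib]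
  abel

lemma resid_smul (Z : Fin m → E d) (a : ℝ) (u : E d) : resid Z (a • u) = a • resid Z u := by
  simp only [resid, real_inner_smul_left, mul_smul, smul_sub, Finset.smul_sum]

lemma norm_sq_eq_sum_add_resid {Z : Fin m → E d} (hZ : Orthonormal ℝ Z) (u : E d) :
    ‖u‖ ^ 2 = ∑ k, inner ℝ u (Z k) ^ 2 + ‖resid Z u‖ ^ 2 := by
  have h1 : inner ℝ u (∑ k, inner ℝ u (Z k) • Z k) = ∑ k, inner ℝ u (Z k) ^ 2 := by
    rw [inner_sum]
    exact Finset.sum_congr rfl fun k _ => by rw [real_inner_smul_right]; ring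
  have h2 : ‖∑ k, inner ℝ u (Z k) • Z k‖ ^ 2 = ∑ k, inner ℝ u (Z k) ^ 2 := by
    rw [← real_inner_self_eq_norm_sq, hZ.inner_sum]
    exact Finset.sum_congr rfl fun k _ => by simp [sq]
  have h3 := norm_sub_sq_real u (∑ k, inner ℝ u (Z k) • Z k)
  rw [resid, h3, h1, h2]
  ring

lemma norm_resid_le {Z : Fin m → E d} (hZ : Orthonormal ℝ Z) (u : E d) : ‖resid Z u‖ ≤ ‖u‖ := by
  have h := norm_sq_eq_sum_add_resid hZ u
  have h2 : 0 ≤ ∑ k, inner ℝ u (Z k) ^ 2 := Finset.sum_nonneg fun k _ => sq_nonneg _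
  exact abs_le_of_sq_le_sq' (by linarith) (norm_nonneg _) |>.2

lemma abs_inner_le_norm {Z : Fin m → E d} (hZ : Orthonormal ℝ Z) (u : E d) (k : Fin m) :
    |inner ℝ u (Z k)| ≤ ‖u‖ := by
  have := abs_real_inner_le_norm u (Z k)
  rwa [hZ.1 k, mul_one] at this

/-- The residual of `w` is orthogonal to every `Z k`, so the hypothesis makes it orthogonal to `w`,
hence to itself. This certifies that the exact gradient lies in the hidden span. -/
lemma resid_self {Z : Fin m → E d} (hZ : Orthonormal ℝ Z) (w : E d)
    (hw : ∀ v : E d, (∀ k, inner ℝ v (Z k) = 0) → inner ℝ w v = 0) : resid Z w = 0 := by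
  have h1 : ∀ k, inner ℝ (resid Z w) (Z k) = 0 := by
    intro k
    rw [resid, inner_sub_left, sum_inner]
    simp only [real_inner_smul_left]
    rw [Finset.sum_eq_single k]
    · rw [real_inner_self_eq_norm_sq, hZ.1 k]; ring
    · intro j _ hj
      rw [hZ.2 hj, mul_zero]
    · simp
  have h2 := hw _ h1
  have h3 : inner ℝ (resid Z w) (resid Z w) = 0 := by
    conv_lhs => enter [2]; rw [resid]
    rw [inner_sub_left, h2, sum_inner, zero_sub, neg_eq_zero]
    refine Finset.sum_eq_zero fun k _ => ?_
    have := h1 k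
    rw [real_inner_comm] at this
    rw [real_inner_smul_left, this, mul_zero]
  exact inner_self_eq_zero.1 h3

/-! ### Normalized profiles and their elasticity -/

/-- A normalized radial profile: increments at least those of `t ^ δ`, size at most
`t ^ γ / r`. -/
structure IsProfile (r γ δ : ℝ) (φ : ℝ → ℝ) : Prop where
  zero : φ 0 = 0
  lower : ∀ a b, 0 ≤ a → a ≤ b → b ≤ 1 → b ^ δ - a ^ δ ≤ φ b - φ a
  upper : ∀ a b, 0 ≤ a → a ≤ b → b ≤ 1 → φ b - φ a ≤ (b ^ γ - a ^ γ) / r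

namespace IsProfile

variable {r γ δ : ℝ} {φ : ℝ → ℝ}

lemma mono (h : IsProfile r γ δ φ) (hδ : 0 < δ) {a b : ℝ} (ha : 0 ≤ a) (hab : a ≤ b) (hb : b ≤ 1) :
    φ a ≤ φ b := by
  have := h.lower a b ha hab hb
  have := Real.rpow_le_rpow ha hab hδ.le
  linarith

lemma strict (h : IsProfile r γ δ φ) (hδ : 0 < δ) {a b : ℝ} (ha : 0 ≤ a) (hab : a < b)
    (hb : b ≤ 1) : φ a < φ b := by
  have := h.lower a b ha hab.le hb
  have := Real.rpow_lt_rpow ha hab hδ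
  linarith

lemma rpow_le (h : IsProfile r γ δ φ) (hδ : 0 < δ) {t : ℝ} (ht : 0 ≤ t) (ht1 : t ≤ 1) :
    t ^ δ ≤ φ t := by
  have := h.lower 0 t le_rfl ht ht1
  rwa [h.zero, Real.zero_rpow hδ.ne', sub_zero, sub_zero] at this

lemma le_rpow (h : IsProfile r γ δ φ) (hγ : 0 < γ) {t : ℝ} (ht : 0 ≤ t) (ht1 : t ≤ 1) :
    φ t ≤ t ^ γ / r := by
  have := h.upper 0 t le_rfl ht ht1
  rwa [h.zero, Real.zero_rpow hγ.ne', sub_zero, sub_zero] at this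

lemma nonneg (h : IsProfile r γ δ φ) (hδ : 0 < δ) {t : ℝ} (ht : 0 ≤ t) (ht1 : t ≤ 1) : 0 ≤ φ t :=
  (Real.rpow_nonneg ht _).trans (h.rpow_le hδ ht ht1)

lemma continuousOn (h : IsProfile r γ δ φ) (hγ : 0 < γ) (hδ : 0 < δ) :
    ContinuousOn φ (Icc 0 1) := by
  have key : ∀ x ∈ Icc (0 : ℝ) 1, ∀ y ∈ Icc (0 : ℝ) 1, |φ y - φ x| ≤ |y ^ γ - x ^ γ| / r := by
    intro x hx y hy
    rcases le_total x y with hxy | hxy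
    · rw [abs_of_nonneg (sub_nonneg.2 (h.mono hδ hx.1 hxy hy.2)),
        abs_of_nonneg (sub_nonneg.2 (Real.rpow_le_rpow hx.1 hxy hγ.le))]
      exact h.upper x y hx.1 hxy hy.2
    · rw [abs_sub_comm, abs_sub_comm (y ^ γ),
        abs_of_nonneg (sub_nonneg.2 (h.mono hδ hy.1 hxy hx.2)),
        abs_of_nonneg (sub_nonneg.2 (Real.rpow_le_rpow hy.1 hxy hγ.le))]
      exact h.upper y x hy.1 hxy hx.2
  intro x hx
  have hc : Filter.Tendsto (fun y : ℝ => |y ^ γ - x ^ γ| / r) (nhdsWithin x (Icc 0 1)) (nhds 0) := by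
    have : Continuous (fun y : ℝ => |y ^ γ - x ^ γ| / r) :=
      (((Real.continuous_rpow_const hγ.le).sub continuous_const).abs).div_const _
    have h2 := this.tendsto x
    simp only [sub_self, abs_zero, zero_div] at h2
    exact h2.mono_left nhdsWithin_le_nhds
  rw [ContinuousWithinAt, tendsto_iff_norm_sub_tendsto_zero]
  refine squeeze_zero' (Filter.Eventually.of_forall fun y => norm_nonneg _) ?_ hc
  filter_upwards [self_mem_nhdsWithin] with y hy
  exact key x hx y hy

/-- Elasticity of a profile away from the origin. -/
lemma mul_rpow_le (h : IsProfile r γ δ φ) (hγ : 0 < γ) (hγδ : γ ≤ δ) (hr : 0 < r)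
    {ν κ t c : ℝ}
    (hν : 0 < ν) (hκ : κ = r * ν ^ (2 * (δ - γ))) (hκ1 : κ ≤ 1) (ht : ν ^ 2 ≤ t) (hc : 1 ≤ c)
    (hct : c * t ≤ 1) : φ t * c ^ (δ * κ) ≤ φ (c * t) := by
  have hδ : 0 < δ := hγ.trans_le hγδ
  have ht0 : 0 < t := (by positivity : (0 : ℝ) < ν ^ 2).trans_le ht
  have hκ0 : 0 < κ := by rw [hκ]; positivity
  have htc : t ≤ c * t := le_mul_of_one_le_left ht0.le hc
  have ht1 : t ≤ 1 := htc.trans hct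
  have h1 := h.lower t (c * t) ht0.le htc hct
  rw [Real.mul_rpow (by linarith) ht0.le] at h1
  -- For `t ≥ ν²` the upper bound `t^γ/r` is at most `t^δ/κ`; this is what `κ` is designed for.
  have h2 : φ t * κ ≤ t ^ δ := by
    have h3 := h.le_rpow hγ ht0.le ht1
    have h4 : ν ^ (2 * (δ - γ)) ≤ t ^ (δ - γ) := by
      have := Real.rpow_le_rpow (by positivity) ht (sub_nonneg.2 hγδ)
      rwa [← Real.rpow_natCast ν 2, ← Real.rpow_mul hν.le] at this
    calc φ t * κ ≤ t ^ γ / r * (r * t ^ (δ - γ)) := by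
          rw [hκ]
          exact mul_le_mul h3 (mul_le_mul_of_nonneg_left h4 hr.le) (by positivity)
            (by positivity)
      _ = t ^ γ * t ^ (δ - γ) := by field_simp
      _ = t ^ δ := by rw [← Real.rpow_add ht0]; congr 1; ring
  have hcδ : 1 ≤ c ^ δ := Real.one_le_rpow hc hδ.le
  -- Bernoulli for the concave power `κ ≤ 1` of `c^δ`. It converts the additive lower bound on
  -- increments into a multiplicative one.
  have h5 : c ^ (δ * κ) ≤ 1 + κ * (c ^ δ - 1) := by
    rw [Real.rpow_mul (by linarith)]
    have := rpow_one_add_le_one_add_mul_self (s := c ^ δ - 1) (by linarith) hκ0.le hκ1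
    simpa using this
  have h6 := h.nonneg hδ ht0.le ht1
  calc φ t * c ^ (δ * κ) ≤ φ t * (1 + κ * (c ^ δ - 1)) := by gcongr
    _ = φ t + φ t * κ * (c ^ δ - 1) := by ring
    _ ≤ φ t + t ^ δ * (c ^ δ - 1) := by
        gcongr
    _ ≤ φ (c * t) := by linarith

end IsProfile

/-! ### Parameter inequalities -/

/-- The numerical regime in which the gradient iteration is analysed. -/
structure Regime (d m : ℕ) (r γ δ ν τ κ σ e : ℝ) : Prop where
  one_le_d : 1 ≤ d
  one_le_m : 1 ≤ m
  r_pos : 0 < r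
  r_le : r ≤ 1
  γ_pos : 0 < γ
  γ_le : γ ≤ δ
  ν_pos : 0 < ν
  ν_le : ν ≤ 1
  -- No profile can reach the value `m^(-δ)` before `t = ν²`. At `t = τ²` a profile is still at most
  -- `m^(-δ)/16`.
  ν_pow : ν ^ (2 * γ) = r * (m : ℝ) ^ (-δ)
  τ_pos : 0 < τ
  τ_le : τ ≤ ν
  τ_pow : τ ^ (2 * γ) = r * (m : ℝ) ^ (-δ) / 16
  m_mul_τ : m * τ ^ 2 ≤ 1
  τ_le_δ : τ ≤ δ
  κ_eq : κ = r * ν ^ (2 * (δ - γ))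
  σ_pos : 0 < σ
  σ_le : σ ≤ τ ^ 2 / 12
  σ_sq_le : 72 * d * (1 + 2 * δ) * σ ^ 2 ≤ 1
  σ_sqrt_le : σ * √d ≤ τ ^ 2 / 8
  e_pos : 0 < e
  -- Three error budgets: staying below the noise floor `στ/10` after normalization, staying below
  -- the gap opened by a jump, and surviving the weak gradient of order `d^(-1/2-δ)` at the start of
  -- a call.
  e_le : e ≤ σ * τ / 20 * (m : ℝ) ^ (-δ)
  e_le_gap : e ≤ 1 / 100 * (m : ℝ) ^ (-δ) * τ ^ 4 * κ * (σ * ν / √d)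
  e_le_dim : e * (√d * (d : ℝ) ^ δ) ≤ σ * τ / 80

namespace Regime

variable {r γ δ ν τ κ σ e : ℝ}

lemma δ_pos (h : Regime d m r γ δ ν τ κ σ e) : 0 < δ := h.γ_pos.trans_le h.γ_le

lemma τ_le_one (h : Regime d m r γ δ ν τ κ σ e) : τ ≤ 1 := h.τ_le.trans h.ν_le

lemma κ_pos (h : Regime d m r γ δ ν τ κ σ e) : 0 < κ := by
  rw [h.κ_eq]
  exact mul_pos h.r_pos (Real.rpow_pos_of_pos h.ν_pos _)

lemma κ_le_one (h : Regime d m r γ δ ν τ κ σ e) : κ ≤ 1 := by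
  rw [h.κ_eq]
  exact mul_le_one₀ h.r_le (Real.rpow_nonneg h.ν_pos.le _)
    (Real.rpow_le_one h.ν_pos.le h.ν_le (by linarith [h.γ_le]))

lemma m_pos (h : Regime d m r γ δ ν τ κ σ e) : (0 : ℝ) < m := by
  exact_mod_cast h.one_le_m

lemma base_pos (h : Regime d m r γ δ ν τ κ σ e) : 0 < (m : ℝ) ^ (-δ) :=
  Real.rpow_pos_of_pos h.m_pos _

lemma base_le_one (h : Regime d m r γ δ ν τ κ σ e) : (m : ℝ) ^ (-δ) ≤ 1 :=
  Real.rpow_le_one_of_one_le_of_nonpos (by exact_mod_cast h.one_le_m) (by linarith [h.δ_pos])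

lemma σ_le_twelfth (h : Regime d m r γ δ ν τ κ σ e) : σ ≤ 1 / 12 := by
  have := h.σ_le
  have := h.τ_le_one
  have := h.τ_pos
  nlinarith

lemma σ_le_τ (h : Regime d m r γ δ ν τ κ σ e) : σ ≤ τ / 12 := by
  have := h.σ_le
  have := h.τ_le_one
  have := h.τ_pos
  nlinarith

lemma σ_sq_le' (h : Regime d m r γ δ ν τ κ σ e) : 72 * (1 + 2 * δ) * σ ^ 2 ≤ 1 := by
  have h1 := h.σ_sq_le
  have h2 : (1 : ℝ) ≤ d := by exact_mod_cast h.one_le_d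
  have h3 : 0 ≤ (1 + 2 * δ) * σ ^ 2 := mul_nonneg (by linarith [h.δ_pos]) (sq_nonneg _)
  nlinarith

lemma θ_pos (h : Regime d m r γ δ ν τ κ σ e) : 0 < σ * τ / 10 := by
  have := h.σ_pos
  have := h.τ_pos
  positivity

lemma θ_le_τ (h : Regime d m r γ δ ν τ κ σ e) : σ * τ / 10 ≤ τ / 100 := by
  have := h.σ_le_twelfth
  have := h.τ_pos
  nlinarith

lemma θ_le_σ (h : Regime d m r γ δ ν τ κ σ e) : σ * τ / 10 ≤ σ / 10 := by
  have := h.τ_le_one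
  have := h.σ_pos
  nlinarith

end Regime

/-! ### Gradient models and the decay of small coordinates -/

/-- A map `q` whose values are, up to an error `e / 2`, vectors in the span of the hidden basis
with coordinates `± uₖ φₖ(uₖ²)`. -/
structure IsGradientModel (Z : Fin m → E d) (φ : Fin m → ℝ → ℝ) (r γ δ e : ℝ) (q : E d → E d) :
    Prop where
  orthonormal : Orthonormal ℝ Z
  profile : ∀ k, IsProfile r γ δ (φ k)
  approx : ∀ u, ‖u‖ ≤ 1 → ∃ p, resid Z p = 0 ∧
    (∀ k, |inner ℝ p (Z k)| = |inner ℝ u (Z k)| * φ k (inner ℝ u (Z k) ^ 2)) ∧ ‖q u - p‖ ≤ e / 2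

lemma norm_GHat {q : E d → E d} {u : E d} (hu : ‖u‖ = 1) : ‖GHat q u‖ = 1 := by
  unfold GHat
  split_ifs with h
  · exact hu
  · rw [norm_smul, norm_inv, norm_norm, inv_mul_cancel₀ (norm_ne_zero_iff.2 h)]

lemma norm_giLoop {q : E d → E d} {u : E d} (hu : ‖u‖ = 1) (n : ℕ) : ‖giLoop q u n‖ = 1 := by
  induction n with
  | zero => simpa [giLoop] using hu
  | succ n ih =>
    rw [giLoop, Function.iterate_succ_apply']
    exact norm_GHat ih

lemma giLoop_succ (q : E d → E d) (u : E d) (n : ℕ) : giLoop q u (n + 1) = GHat q (giLoop q u n) :=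
  Function.iterate_succ_apply' _ _ _

lemma giLoop_add (q : E d → E d) (u : E d) (n k : ℕ) :
    giLoop q u (n + k) = giLoop q (giLoop q u k) n :=
  Function.iterate_add_apply _ _ _ _

namespace IsGradientModel

variable {r γ δ ν τ κ σ e : ℝ} {Z : Fin m → E d} {φ : Fin m → ℝ → ℝ} {q : E d → E d}

lemma sq_mem (M : IsGradientModel Z φ r γ δ e q) {u : E d} (hu : ‖u‖ ≤ 1) (k : Fin m) :
    inner ℝ u (Z k) ^ 2 ∈ Icc (0 : ℝ) 1 :=
  ⟨sq_nonneg _, (sq_le_one_iff_abs_le_one _).2 ((abs_inner_le_norm M.orthonormal u k).trans hu)⟩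

/-- Bounds on the output of one iteration, given a lower bound `B` for the unnormalized image. -/
lemma GHat_bounds (M : IsGradientModel Z φ r γ δ e q) {u p : E d} {B : ℝ} (hB : 0 < B)
    (hp0 : resid Z p = 0)
    (hpk : ∀ k, |inner ℝ p (Z k)| = |inner ℝ u (Z k)| * φ k (inner ℝ u (Z k) ^ 2))
    (hpq : ‖q u - p‖ ≤ e / 2) (hq : B ≤ ‖q u‖) :
    ‖resid Z (GHat q u)‖ ≤ e / 2 / B ∧
      ∀ k, |inner ℝ (GHat q u) (Z k)| ≤
        (|inner ℝ u (Z k)| * φ k (inner ℝ u (Z k) ^ 2) + e / 2) / B := by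
  have hq0 : q u ≠ 0 := by
    intro h0
    rw [h0, norm_zero] at hq
    linarith
  have hG : GHat q u = ‖q u‖⁻¹ • q u := by rw [GHat, if_neg hq0]
  have hqn : 0 < ‖q u‖ := norm_pos_iff.2 hq0
  have hsplit : q u = p + (q u - p) := by abel
  constructor
  · rw [hG, resid_smul, norm_smul, norm_inv, norm_norm, inv_mul_eq_div]
    have : ‖resid Z (q u)‖ ≤ e / 2 := by
      rw [hsplit, resid_add, hp0, zero_add]
      exact (norm_resid_le M.orthonormal _).trans hpq
    have he : 0 ≤ e / 2 := (norm_nonneg _).trans this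
    gcongr
  · intro k
    rw [hG, real_inner_smul_left, abs_mul, abs_inv, abs_norm, inv_mul_eq_div]
    have : |inner ℝ (q u) (Z k)| ≤ |inner ℝ u (Z k)| * φ k (inner ℝ u (Z k) ^ 2) + e / 2 := by
      rw [← hpk k]
      conv_lhs => rw [hsplit, inner_add_left]
      exact (abs_add_le _ _).trans
        (add_le_add le_rfl ((abs_inner_le_norm M.orthonormal _ k).trans hpq))
    have he : 0 ≤ |inner ℝ u (Z k)| * φ k (inner ℝ u (Z k) ^ 2) + e / 2 :=
      (abs_nonneg _).trans this
    gcongr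

/-- The gradient is bounded below on unit vectors close to the span of the hidden basis. -/
lemma norm_lower (M : IsGradientModel Z φ r γ δ e q) (R : Regime d m r γ δ ν τ κ σ e) {u p : E d}
    (hu : ‖u‖ = 1) (hres : ‖resid Z u‖ ≤ 2 * σ) (hp0 : resid Z p = 0)
    (hpk : ∀ k, |inner ℝ p (Z k)| = |inner ℝ u (Z k)| * φ k (inner ℝ u (Z k) ^ 2)) :
    97 / 100 * (m : ℝ) ^ (-δ) ≤ ‖p‖ := by
  have hδ := R.δ_pos
  set S := ∑ k, inner ℝ u (Z k) ^ 2 with hS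
  have hS1 : S = 1 - ‖resid Z u‖ ^ 2 := by
    have := norm_sq_eq_sum_add_resid M.orthonormal u
    rw [hu] at this
    linarith
  have hS0 : 0 ≤ S := Finset.sum_nonneg fun k _ => sq_nonneg _
  have hres2 : ‖resid Z u‖ ^ 2 ≤ 4 * σ ^ 2 := by nlinarith [norm_nonneg (resid Z u)]
  -- Bernoulli with `S ≥ 1 - 4σ²` and `72(1+2δ)σ² ≤ 1`. The final constant works since `(97/100)² <
  -- 17/18`.
  have hpow : 17 / 18 ≤ S ^ (1 + 2 * δ) := by
    have hb := one_add_mul_self_le_rpow_one_add (s := S - 1) (by linarith) (p := 1 + 2 * δ)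
      (by linarith)
    rw [add_sub_cancel] at hb
    have := R.σ_sq_le'
    nlinarith [mul_le_mul_of_nonneg_left hres2 (by linarith : 0 ≤ 1 + 2 * δ)]
  -- The power mean inequality with exponent `1 + 2δ` costs `m^(2δ)`, which is where the base value
  -- `m^(-δ)` of the gradient norm comes from.
  have hmean := Real.rpow_sum_le_const_mul_sum_rpow_of_nonneg Finset.univ (p := 1 + 2 * δ)
    (f := fun k => inner ℝ u (Z k) ^ 2) (by linarith) (fun k _ => sq_nonneg _)
  rw [← hS, Finset.card_univ, Fintype.card_fin] at hmean
  have hp2 : ∑ k, (inner ℝ u (Z k) ^ 2) ^ (1 + 2 * δ) ≤ ‖p‖ ^ 2 := by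
    rw [norm_sq_eq_sum_add_resid M.orthonormal p, hp0, norm_zero]
    simp only [ne_eq, OfNat.ofNat_ne_zero, not_false_eq_true, zero_pow, add_zero]
    refine Finset.sum_le_sum fun k _ => ?_
    have hk := M.sq_mem hu.le k
    rw [← sq_abs (inner ℝ p (Z k)), hpk k, mul_pow, sq_abs, add_comm,
      Real.rpow_add_one' hk.1 (by linarith), mul_comm]
    refine mul_le_mul_of_nonneg_left ?_ hk.1
    have := (M.profile k).rpow_le hδ hk.1 hk.2
    rw [mul_comm 2 δ, Real.rpow_mul hk.1, Real.rpow_two]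
    exact pow_le_pow_left₀ (Real.rpow_nonneg hk.1 δ) this 2
  have hm := R.m_pos
  have hb : ((m : ℝ) ^ (-δ)) ^ 2 * (m : ℝ) ^ (1 + 2 * δ - 1) = 1 := by
    rw [← Real.rpow_natCast, ← Real.rpow_mul hm.le, ← Real.rpow_add hm]
    norm_num
    ring_nf
    simp
  have hbp := R.base_pos
  have h3 : ((m : ℝ) ^ (-δ)) ^ 2 * (17 / 18) ≤ ‖p‖ ^ 2 := by
    calc ((m : ℝ) ^ (-δ)) ^ 2 * (17 / 18) ≤ ((m : ℝ) ^ (-δ)) ^ 2 *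
          ((m : ℝ) ^ (1 + 2 * δ - 1) * ∑ k, (inner ℝ u (Z k) ^ 2) ^ (1 + 2 * δ)) := by
          gcongr
          exact hpow.trans hmean
      _ = ∑ k, (inner ℝ u (Z k) ^ 2) ^ (1 + 2 * δ) := by rw [← mul_assoc, hb, one_mul]
      _ ≤ _ := hp2
  refine abs_le_of_sq_le_sq' ?_ (norm_nonneg _) |>.2
  nlinarith

lemma norm_lower' (M : IsGradientModel Z φ r γ δ e q) (R : Regime d m r γ δ ν τ κ σ e) {u p : E d}
    (hu : ‖u‖ = 1) (hres : ‖resid Z u‖ ≤ 2 * σ) (hp0 : resid Z p = 0)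
    (hpk : ∀ k, |inner ℝ p (Z k)| = |inner ℝ u (Z k)| * φ k (inner ℝ u (Z k) ^ 2))
    (hpq : ‖q u - p‖ ≤ e / 2) : 9 / 10 * (m : ℝ) ^ (-δ) ≤ ‖q u‖ := by
  have h1 := M.norm_lower R hu hres hp0 hpk
  have h2 := norm_sub_norm_le p (q u)
  rw [norm_sub_rev] at h2
  have h3 := R.e_le
  have h4 : σ * τ / 20 * (m : ℝ) ^ (-δ) ≤ 1 / 100 * (m : ℝ) ^ (-δ) := by
    have := R.θ_le_τ
    have := R.τ_le_one
    have := R.base_pos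
    refine mul_le_mul_of_nonneg_right ?_ this.le
    linarith
  linarith [R.base_pos]

/-- One gradient iteration: the residual becomes tiny and small coordinates shrink. -/
lemma GHat_small (M : IsGradientModel Z φ r γ δ e q) (R : Regime d m r γ δ ν τ κ σ e) {u : E d}
    (hu : ‖u‖ = 1) (hres : ‖resid Z u‖ ≤ 2 * σ) :
    ‖resid Z (GHat q u)‖ ≤ σ * τ / 10 ∧
    ∀ k, |inner ℝ u (Z k)| ≤ τ → |inner ℝ (GHat q u) (Z k)| ≤
      max (σ * τ / 10) (|inner ℝ u (Z k)| / 4 * (|inner ℝ u (Z k)| / τ) ^ (2 * γ)) := by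
  obtain ⟨p, hp0, hpk, hpq⟩ := M.approx u hu.le
  have hb := R.base_pos
  have hBpos : 0 < 9 / 10 * (m : ℝ) ^ (-δ) := by positivity
  obtain ⟨h1, h2⟩ := M.GHat_bounds hBpos hp0 hpk hpq (M.norm_lower' R hu hres hp0 hpk hpq)
  have heb : e / 2 / (9 / 10 * (m : ℝ) ^ (-δ)) ≤ 5 / 18 * (σ * τ / 10) := by
    rw [div_le_iff₀ hBpos]
    linarith [R.e_le]
  have hθ := R.θ_pos
  refine ⟨h1.trans (heb.trans (by linarith)), fun k hk => (h2 k).trans ?_⟩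
  set y := |inner ℝ u (Z k)| with hy
  have hy0 : 0 ≤ y := abs_nonneg _
  have hτ := R.τ_pos
  have hsq := M.sq_mem hu.le k
  have hφ := (M.profile k).le_rpow R.γ_pos hsq.1 hsq.2
  have hyγ : (inner ℝ u (Z k) ^ 2) ^ γ = y ^ (2 * γ) := by
    rw [← sq_abs, ← hy, ← Real.rpow_natCast, ← Real.rpow_mul hy0]
    norm_num
  rw [hyγ] at hφ
  have hrat : y ^ (2 * γ) = (y / τ) ^ (2 * γ) * (r * (m : ℝ) ^ (-δ) / 16) := by
    rw [← R.τ_pow, ← Real.mul_rpow (by positivity) hτ.le, div_mul_cancel₀ _ hτ.ne']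
  have hr := R.r_pos
  have hX : 0 ≤ (y / τ) ^ (2 * γ) := Real.rpow_nonneg (by positivity) _
  set X := (y / τ) ^ (2 * γ)
  -- Measured against `τ`, the ratio is at most `(y/τ)^(2γ) m^(-δ)/16`. Dividing by `9/10 · m^(-δ)`
  -- leaves two terms, each at most `5/18` of the claimed maximum.
  have hmain : (y * φ k (inner ℝ u (Z k) ^ 2) + e / 2) / (9 / 10 * (m : ℝ) ^ (-δ)) ≤
      5 / 18 * (y / 4 * X) + 5 / 18 * (σ * τ / 10) := by
    rw [add_div]
    refine add_le_add ?_ heb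
    rw [div_le_iff₀ hBpos]
    calc y * φ k (inner ℝ u (Z k) ^ 2) ≤ y * (X * (r * (m : ℝ) ^ (-δ) / 16) / r) := by
          rw [← hrat]; gcongr
      _ = y / 4 * X * (m : ℝ) ^ (-δ) * (1 / 4) := by field_simp; ring
      _ = 5 / 18 * (y / 4 * X) * (9 / 10 * (m : ℝ) ^ (-δ)) := by ring
      _ ≤ _ := le_rfl
  refine hmain.trans ?_
  have := le_max_left (σ * τ / 10) (y / 4 * X)
  have := le_max_right (σ * τ / 10) (y / 4 * X)
  linarith

/-- Small coordinates decay superexponentially to the threshold `σ τ / 10`. -/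
lemma giLoop_small (M : IsGradientModel Z φ r γ δ e q) (R : Regime d m r γ δ ν τ κ σ e) {u : E d}
    (hu : ‖u‖ = 1) (hres : ‖resid Z u‖ ≤ 2 * σ) (n : ℕ) :
    ‖resid Z (giLoop q u n)‖ ≤ 2 * σ ∧
    ∀ k, |inner ℝ u (Z k)| ≤ τ → |inner ℝ (giLoop q u n) (Z k)| ≤
      max (σ * τ / 10) (τ * 4 ^ (-(n + γ * n * (n - 1) : ℝ))) := by
  have hτ := R.τ_pos
  have hγ := R.γ_pos
  induction n with
  | zero =>
    refine ⟨by simpa [giLoop] using hres, fun k hk => le_max_of_le_right ?_⟩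
    simpa [giLoop] using hk
  | succ n ih =>
    obtain ⟨ih1, ih2⟩ := ih
    have hun := norm_giLoop (q := q) hu n
    obtain ⟨h1, h2⟩ := M.GHat_small R hun ih1
    rw [giLoop_succ]
    refine ⟨h1.trans (R.θ_le_σ.trans (by linarith [R.σ_pos])), fun k hk => ?_⟩
    have hθτ := R.θ_le_τ
    have hθ := R.θ_pos
    have hexp0 : (0 : ℝ) ≤ n + γ * n * (n - 1) := by
      rcases Nat.eq_zero_or_pos n with rfl | hn
      · simp
      · have : (1 : ℝ) ≤ n := by exact_mod_cast hn
        have : 0 ≤ γ * n * (n - 1) := mul_nonneg (by positivity) (by linarith)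
        linarith
    have h41 : (4 : ℝ) ^ (-(n + γ * n * (n - 1) : ℝ)) ≤ 1 :=
      Real.rpow_le_one_of_one_le_of_nonpos (by norm_num) (by linarith)
    have hy := ih2 k hk
    set y := |inner ℝ (giLoop q u n) (Z k)| with hydef
    have hy0 : 0 ≤ y := abs_nonneg _
    have hyτ : y ≤ τ := hy.trans (max_le (by linarith) (by nlinarith))
    have hyτ1 : y / τ ≤ 1 := (div_le_one hτ).2 hyτ
    refine (h2 k hyτ).trans (max_le (le_max_left _ _) ?_)
    have hX1 : (y / τ) ^ (2 * γ) ≤ 1 := Real.rpow_le_one (by positivity) hyτ1 (by linarith)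
    rcases le_total y (σ * τ / 10) with hc | hc
    · refine le_max_of_le_left ?_
      have : 0 ≤ (y / τ) ^ (2 * γ) := Real.rpow_nonneg (by positivity) _
      nlinarith
    · rcases le_max_iff.1 hy with hy' | hy'
      · refine le_max_of_le_left ?_
        have : 0 ≤ (y / τ) ^ (2 * γ) := Real.rpow_nonneg (by positivity) _
        nlinarith
      · refine le_max_of_le_right ?_
        -- One iteration turns the exponent `a` into `1 + a + 2γa`. Of this growth only the
        -- quadratic bound `n + γn(n-1)` is retained.
        set a : ℝ := n + γ * n * (n - 1) with ha
        have hya : y / τ ≤ 4 ^ (-a) := by rw [div_le_iff₀ hτ]; linarith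
        have hX : (y / τ) ^ (2 * γ) ≤ (4 : ℝ) ^ (-(2 * γ * a)) := by
          refine (Real.rpow_le_rpow (by positivity) hya (by linarith)).trans (le_of_eq ?_)
          rw [← Real.rpow_mul (by norm_num)]
          congr 1; ring
        calc y / 4 * (y / τ) ^ (2 * γ) ≤ (τ * 4 ^ (-a)) / 4 * 4 ^ (-(2 * γ * a)) := by gcongr
          _ = τ * 4 ^ (-(1 + a + 2 * γ * a)) := by
              rw [show -(1 + a + 2 * γ * a) = -1 + -a + -(2 * γ * a) by ring,
                Real.rpow_add (by norm_num), Real.rpow_add (by norm_num), Real.rpow_neg_one]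
              ring
          _ ≤ _ := by
              refine mul_le_mul_of_nonneg_left
                (Real.rpow_le_rpow_of_exponent_le (by norm_num) (neg_le_neg ?_)) hτ.le
              · push_cast
                rw [ha]
                have : 0 ≤ γ * (γ * n * (n - 1)) := by
                  rcases Nat.eq_zero_or_pos n with rfl | hn
                  · simp
                  · have : (1 : ℝ) ≤ n := by exact_mod_cast hn
                    exact mul_nonneg hγ.le (mul_nonneg (by positivity) (by linarith))
                nlinarith

/-- After enough iterations, coordinates that start at most `τ` are at most `σ τ / 10`. -/
lemma giLoop_tiny (M : IsGradientModel Z φ r γ δ e q) (R : Regime d m r γ δ ν τ κ σ e) {u : E d}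
    (hu : ‖u‖ = 1) (hres : ‖resid Z u‖ ≤ 2 * σ) {n : ℕ} (hn : 2 ≤ n) (hn' : 10 / σ ≤ γ * n)
    {k : Fin m} (hk : |inner ℝ u (Z k)| ≤ τ) :
    |inner ℝ (giLoop q u n) (Z k)| ≤ σ * τ / 10 := by
  refine ((M.giLoop_small R hu hres n).2 k hk).trans (max_le le_rfl ?_)
  have hσ := R.σ_pos
  have hτ := R.τ_pos
  have hγ := R.γ_pos
  have hn2 : (2 : ℝ) ≤ n := by exact_mod_cast hn
  -- Here `n ≥ 2` is used as `n - 1 ≥ 1`. Then `4^(-10/σ) ≤ σ/10` by Bernoulli, which carries `τ`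
  -- down to the noise floor.
  have h1 : 10 / σ ≤ n + γ * n * (n - 1) := by
    have : γ * n * 1 ≤ γ * n * (n - 1) := by gcongr; linarith
    linarith
  have h2 : (4 : ℝ) ^ (-(n + γ * n * (n - 1) : ℝ)) ≤ σ / 10 := by
    rw [Real.rpow_neg (by norm_num), inv_le_comm₀ (by positivity) (by positivity), inv_div]
    have h3 : 1 + 10 / σ * 1 ≤ (4 : ℝ) ^ (10 / σ) := by
      have := one_add_mul_self_le_rpow_one_add (s := 3) (by norm_num) (p := 10 / σ) (by
        rw [le_div_iff₀ hσ]; linarith [R.σ_le_twelfth])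
      norm_num at this
      have h4 : 0 < 10 / σ := by positivity
      linarith
    have h5 : (4 : ℝ) ^ (10 / σ) ≤ 4 ^ (n + γ * n * (n - 1) : ℝ) := by gcongr; norm_num
    linarith
  nlinarith

/-- Coordinates at most `σ τ / 10` stay so. -/
lemma giLoop_stay (M : IsGradientModel Z φ r γ δ e q) (R : Regime d m r γ δ ν τ κ σ e) {u : E d}
    (hu : ‖u‖ = 1) (hres : ‖resid Z u‖ ≤ σ * τ / 10) (n : ℕ) :
    ‖resid Z (giLoop q u n)‖ ≤ σ * τ / 10 ∧
    ∀ k, |inner ℝ u (Z k)| ≤ σ * τ / 10 → |inner ℝ (giLoop q u n) (Z k)| ≤ σ * τ / 10 := by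
  induction n with
  | zero => exact ⟨by simpa [giLoop] using hres, fun k hk => by simpa [giLoop] using hk⟩
  | succ n ih =>
    have hθ := R.θ_pos
    obtain ⟨h1, h2⟩ := M.GHat_small R (norm_giLoop (q := q) hu n)
      (ih.1.trans (R.θ_le_σ.trans (by linarith [R.σ_pos])))
    rw [giLoop_succ]
    refine ⟨h1, fun k hk => ?_⟩
    have hk' := ih.2 k hk
    have hτ := R.τ_pos
    have hkτ := hk'.trans (R.θ_le_τ.trans (show τ / 100 ≤ τ by linarith))
    refine (h2 k hkτ).trans (max_le le_rfl ?_)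
    have h3 : (|inner ℝ (giLoop q u n) (Z k)| / τ) ^ (2 * γ) ≤ 1 :=
      Real.rpow_le_one (by positivity) ((div_le_one hτ).2 hkτ) (by linarith [R.γ_pos])
    have h4 : 0 ≤ (|inner ℝ (giLoop q u n) (Z k)| / τ) ^ (2 * γ) :=
      Real.rpow_nonneg (by positivity) _
    nlinarith [abs_nonneg (inner ℝ (giLoop q u n) (Z k) : ℝ)]

end IsGradientModel

/-! ### Balanced points and their instability -/

/-- Strictly increasing continuous functions vanishing at `0` can be balanced on the simplex. -/
lemma exists_balanced {ι : Type*} [Fintype ι] [Nonempty ι] {φ : ι → ℝ → ℝ}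
    (hc : ∀ i, ContinuousOn (φ i) (Icc 0 1)) (h0 : ∀ i, φ i 0 = 0)
    (hmono : ∀ i a b, 0 ≤ a → a < b → b ≤ 1 → φ i a < φ i b) :
    ∃ t ∈ stdSimplex ℝ ι, ∃ c, ∀ i, φ i (t i) = c := by
  classical
  -- Maximize the smallest of the values `φ i (t i)` over the simplex; at a maximizer all values
  -- agree.
  set g : (ι → ℝ) → ℝ := fun t => Finset.univ.inf' Finset.univ_nonempty fun i => φ i (t i)
  have hle : ∀ t ∈ stdSimplex ℝ ι, ∀ i, t i ∈ Icc (0 : ℝ) 1 := by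
    intro t ht i
    refine ⟨ht.1 i, ?_⟩
    rw [← ht.2]
    exact Finset.single_le_sum (fun j _ => ht.1 j) (Finset.mem_univ i)
  have hg : ContinuousOn g (stdSimplex ℝ ι) := by
    refine ContinuousOn.finset_inf'_apply _ fun i _ => ?_
    exact (hc i).comp (continuous_apply i).continuousOn fun t ht => hle t ht i
  have hne : (stdSimplex ℝ ι).Nonempty :=
    ⟨_, single_mem_stdSimplex ℝ (Classical.arbitrary ι)⟩
  obtain ⟨t, ht, hmax⟩ := (isCompact_stdSimplex ℝ ι).exists_isMaxOn hne hg
  refine ⟨t, ht, g t, fun j => ?_⟩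
  have hgle : ∀ i, g t ≤ φ i (t i) := fun i => Finset.inf'_le _ (Finset.mem_univ i)
  refine le_antisymm (not_lt.1 fun hlt => ?_) (hgle j)
  have hg0 : 0 ≤ g t := by
    refine Finset.le_inf' _ _ fun i _ => ?_
    rcases (ht.1 i).eq_or_lt with h | h
    · rw [← h, h0]
    · rw [← h0 i]
      exact (hmono i 0 _ le_rfl h (hle t ht i).2).le
  have htj : 0 < t j := by
    refine (ht.1 j).lt_of_ne fun h => ?_
    rw [← h, h0] at hlt
    linarith
  obtain ⟨s, hs0, hst, hsφ⟩ : ∃ s, 0 < s ∧ s < t j ∧ g t < φ j s := by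
    have h1 := (hc j (t j) (hle t ht j)).eventually (lt_mem_nhds hlt)
    have h2 : ∀ᶠ s in nhdsWithin (t j) (Ioo 0 (t j)), g t < φ j s :=
      h1.filter_mono (nhdsWithin_mono _ (show Ioo 0 (t j) ⊆ Icc 0 1 from
        fun x hx => ⟨hx.1.le, hx.2.le.trans (hle t ht j).2⟩))
    have : (nhdsWithin (t j) (Ioo 0 (t j))).NeBot := by
      rw [nhdsWithin_Ioo_eq_nhdsLT htj]
      infer_instance
    obtain ⟨s, hs, hs'⟩ := (h2.and self_mem_nhdsWithin).exists
    exact ⟨s, hs'.1, hs'.2, hs⟩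
  set n : ℝ := (Fintype.card ι : ℝ)
  have hn : 0 < n := Nat.cast_pos.2 Fintype.card_pos
  -- If value `j` exceeds the minimum, `t j` can be lowered to `s` with `φ j s` still above it.
  -- Sharing the freed mass equally raises every argument strictly, so the minimum increases, a
  -- contradiction.
  set t' : ι → ℝ := fun i => Function.update t j s i + (t j - s) / n
  have hpos : 0 < (t j - s) / n := div_pos (by linarith) hn
  have hup : ∀ i, 0 ≤ Function.update t j s i := by
    intro i
    rcases eq_or_ne i j with rfl | h
    · simpa using hs0.le
    · simpa [h] using ht.1 i
  have ht' : t' ∈ stdSimplex ℝ ι := by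
    refine ⟨fun i => add_nonneg (hup i) hpos.le, ?_⟩
    rw [Finset.sum_add_distrib, Finset.sum_const, Finset.card_univ, nsmul_eq_mul,
      mul_div_cancel₀ _ hn.ne', Finset.sum_update_of_mem (Finset.mem_univ j)]
    have := ht.2
    rw [← Finset.add_sum_erase _ _ (Finset.mem_univ j), ← Finset.sdiff_singleton_eq_erase] at this
    linarith
  have hgt : g t < g t' := by
    refine (Finset.lt_inf'_iff _).2 fun i _ => ?_
    have hi1 := (hle t' ht' i).2
    have hlt' : Function.update t j s i < t' i := by simp only [t']; linarith
    refine lt_of_le_of_lt ?_ (hmono i _ _ (hup i) hlt' hi1)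
    rcases eq_or_ne i j with rfl | h
    · simpa using hsφ.le
    · simpa [h] using hgle i
  exact absurd (hmax ht') (not_le.2 hgt)

/-- `t` gives the squared coordinates on `L` of a fixed point of the gradient iteration, with
common gradient ratio `c`. -/
structure IsBalanced (φ : Fin m → ℝ → ℝ) (L : Finset (Fin m)) (t : Fin m → ℝ) (c : ℝ) : Prop where
  nonneg : ∀ i ∈ L, 0 ≤ t i
  sum_eq : ∑ i ∈ L, t i = 1
  eq : ∀ i ∈ L, φ i (t i) = c

namespace IsBalanced

variable {φ : Fin m → ℝ → ℝ} {L : Finset (Fin m)} {t : Fin m → ℝ} {c : ℝ}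

lemma le_one (h : IsBalanced φ L t c) {i : Fin m} (hi : i ∈ L) : t i ≤ 1 := by
  rw [← h.sum_eq]
  exact Finset.single_le_sum h.nonneg hi

end IsBalanced

/-- If `φ t` is at least the base value `m ^ (-δ)` then `t` is at least `ν ^ 2`. -/
lemma IsProfile.sq_le_of_le {r γ δ ν τ κ σ e : ℝ} {φ : ℝ → ℝ} (h : IsProfile r γ δ φ)
    (R : Regime d m r γ δ ν τ κ σ e) {t : ℝ} (ht : 0 ≤ t) (ht1 : t ≤ 1)
    (hb : (m : ℝ) ^ (-δ) ≤ φ t) : ν ^ 2 ≤ t := by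
  have h1 := hb.trans (h.le_rpow R.γ_pos ht ht1)
  rw [le_div_iff₀ R.r_pos, mul_comm, ← R.ν_pow, Real.rpow_mul R.ν_pos.le, Real.rpow_two] at h1
  exact (Real.rpow_le_rpow_iff (by positivity) ht R.γ_pos).1 h1

namespace IsGradientModel

variable {r γ δ ν τ κ σ e : ℝ} {Z : Fin m → E d} {φ : Fin m → ℝ → ℝ} {q : E d → E d}

lemma exists_isBalanced (M : IsGradientModel Z φ r γ δ e q) (hγ : 0 < γ) (hδ : 0 < δ)
    {L : Finset (Fin m)} (hL : L.Nonempty) : ∃ t c, IsBalanced φ L t c := by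
  classical
  have : Nonempty L := hL.to_subtype
  obtain ⟨t, ht, c, hc⟩ := exists_balanced (ι := L) (φ := fun i => φ i)
    (fun i => (M.profile i).continuousOn hγ hδ) (fun i => (M.profile i).zero)
    (fun i a b => (M.profile i).strict hδ)
  refine ⟨fun i => if h : i ∈ L then t ⟨i, h⟩ else 0, c, fun i hi => ?_, ?_, fun i hi => ?_⟩
  · simp only [hi, dif_pos]
    exact ht.1 _
  · rw [← ht.2, ← Finset.sum_coe_sort L]
    exact Finset.sum_congr rfl fun i _ => by simp
  · simp only [hi, dif_pos]
    exact hc ⟨i, hi⟩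

/-- By pigeonhole some balanced coordinate is at least `1/m`, and `φ t ≥ t^δ`. Since all ratios
agree, every balanced coordinate is then at least `ν²`. -/
lemma base_le (M : IsGradientModel Z φ r γ δ e q) (R : Regime d m r γ δ ν τ κ σ e)
    {L : Finset (Fin m)} {t : Fin m → ℝ} {c : ℝ} (hb : IsBalanced φ L t c) :
    (m : ℝ) ^ (-δ) ≤ c := by
  have hm := R.m_pos
  obtain ⟨i, hi, hti⟩ : ∃ i ∈ L, (m : ℝ)⁻¹ ≤ t i := by
    by_contra! hcon
    have hne : L.Nonempty := by
      rw [Finset.nonempty_iff_ne_empty]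
      rintro rfl
      simpa using hb.sum_eq
    have h1 := Finset.sum_lt_sum_of_nonempty hne hcon
    rw [hb.sum_eq, Finset.sum_const, nsmul_eq_mul] at h1
    have h2 : (L.card : ℝ) ≤ m := by exact_mod_cast (card_finset_fin_le L)
    have h3 : (L.card : ℝ) * (m : ℝ)⁻¹ ≤ 1 := by
      rw [← div_eq_mul_inv, div_le_one hm]
      exact h2
    linarith
  rw [← hb.eq i hi]
  refine le_trans ?_ ((M.profile i).rpow_le R.δ_pos (hb.nonneg i hi) (hb.le_one hi))
  rw [Real.rpow_neg hm.le, ← Real.inv_rpow hm.le]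
  exact Real.rpow_le_rpow (by positivity) hti R.δ_pos.le

lemma sq_le_balanced (M : IsGradientModel Z φ r γ δ e q) (R : Regime d m r γ δ ν τ κ σ e)
    {L : Finset (Fin m)} {t : Fin m → ℝ} {c : ℝ} (hb : IsBalanced φ L t c) {i : Fin m}
    (hi : i ∈ L) : ν ^ 2 ≤ t i :=
  (M.profile i).sq_le_of_le R (hb.nonneg i hi) (hb.le_one hi)
    ((M.base_le R hb).trans (hb.eq i hi).ge)

lemma half_min_le {z : ℝ} (hz : 0 ≤ z) : min z 1 / 2 ≤ 1 - Real.exp (-z) := by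
  have h1 : Real.exp (-z) ≤ 1 / (1 + z) := by
    rw [Real.exp_neg, ← one_div]
    exact one_div_le_one_div_of_le (by linarith) (by linarith [Real.add_one_le_exp z])
  have h2 : 1 - 1 / (1 + z) = z / (1 + z) := by field_simp; ring
  have h3 : min z 1 / 2 ≤ z / (1 + z) := by
    rw [le_div_iff₀ (by linarith)]
    rcases min_cases z 1 with ⟨h, h'⟩ | ⟨h, h'⟩ <;> rw [h] <;> nlinarith
  linarith

/-- From `c ≤ Λ(1-s)` follows `c² ≤ Λ²(1-s)`, so `n² ≤ Λ²(1 - τ²s)`, which is at most the square of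
the right-hand side. Used in `growth` to bound the gradient norm below the largest ratio. -/
lemma le_mul_one_sub_of_sq_le {n c Λ s τ : ℝ} (hc : 0 ≤ c) (hΛ : 0 ≤ Λ)
    (hs0 : 0 ≤ s) (hs1 : s ≤ 1) (hcs : c ≤ Λ * (1 - s)) (hy1 : τ ^ 2 * s ≤ 1)
    (hn : n ^ 2 ≤ Λ ^ 2 - τ ^ 2 * (Λ ^ 2 - c ^ 2)) : n ≤ Λ * (1 - τ ^ 2 * s / 2) := by
  refine abs_le_of_sq_le_sq' ?_ (mul_nonneg hΛ (by linarith)) |>.2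
  have h1 : c ^ 2 ≤ Λ ^ 2 * (1 - s) := by
    have h2 : c ^ 2 ≤ (Λ * (1 - s)) ^ 2 := pow_le_pow_left₀ hc hcs 2
    have h3 := mul_nonneg (mul_nonneg (sq_nonneg Λ) hs0) (by linarith : 0 ≤ 1 - s)
    linarith
  have h4 := mul_le_mul_of_nonneg_left h1 (sq_nonneg τ)
  have h5 := mul_nonneg (sq_nonneg Λ) (sq_nonneg (τ ^ 2 * s))
  linarith

/-- The gradient norm is below the largest ratio `Λ` if some non-negligible coordinate has a
smaller ratio. -/
lemma norm_sq_le (M : IsGradientModel Z φ r γ δ e q) {u p : E d} (hu : ‖u‖ ≤ 1) (hδ : 0 < δ)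
    (hp0 : resid Z p = 0)
    (hpk : ∀ k, |inner ℝ p (Z k)| = |inner ℝ u (Z k)| * φ k (inner ℝ u (Z k) ^ 2)) {Λ c : ℝ}
    (hmax : ∀ k, φ k (inner ℝ u (Z k) ^ 2) ≤ Λ) (hsum1 : ∑ k, inner ℝ u (Z k) ^ 2 ≤ 1)
    (hc0 : 0 ≤ c) (hcΛ : c ≤ Λ) {b : Fin m} (hφb : φ b (inner ℝ u (Z b) ^ 2) ≤ c)
    (hub : τ ^ 2 ≤ inner ℝ u (Z b) ^ 2) : ‖p‖ ^ 2 ≤ Λ ^ 2 - τ ^ 2 * (Λ ^ 2 - c ^ 2) := by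
  classical
  rw [norm_sq_eq_sum_add_resid M.orthonormal p, hp0, norm_zero]
  have h1 : ∀ k, inner ℝ p (Z k) ^ 2 ≤ inner ℝ u (Z k) ^ 2 * Λ ^ 2 -
      if k = b then inner ℝ u (Z b) ^ 2 * (Λ ^ 2 - c ^ 2) else 0 := by
    intro k
    have hφ0 := (M.profile k).nonneg hδ (M.sq_mem hu k).1 (M.sq_mem hu k).2
    rw [← sq_abs, hpk k, mul_pow, sq_abs]
    split_ifs with h
    · subst h
      have h2 : φ k (inner ℝ u (Z k) ^ 2) ^ 2 ≤ c ^ 2 := pow_le_pow_left₀ hφ0 hφb 2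
      have := mul_le_mul_of_nonneg_left h2 (sq_nonneg (inner ℝ u (Z k) : ℝ))
      linarith
    · have h2 : φ k (inner ℝ u (Z k) ^ 2) ^ 2 ≤ Λ ^ 2 := pow_le_pow_left₀ hφ0 (hmax k) 2
      have := mul_le_mul_of_nonneg_left h2 (sq_nonneg (inner ℝ u (Z k) : ℝ))
      linarith
  have h2 := Finset.sum_le_sum fun k (_ : k ∈ Finset.univ) => h1 k
  rw [Finset.sum_sub_distrib, ← Finset.sum_mul, Finset.sum_ite_eq' Finset.univ b,
    if_pos (Finset.mem_univ b)] at h2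
  have h3 : 0 ≤ Λ ^ 2 - c ^ 2 := sub_nonneg.2 (pow_le_pow_left₀ hc0 hcΛ 2)
  have h4 := mul_le_mul_of_nonneg_right hub h3
  have h5 := mul_le_mul_of_nonneg_right hsum1 (sq_nonneg Λ)
  linarith

set_option maxHeartbeats 800000 in
/-- Away from the small coordinates, the largest gradient ratio grows. -/
lemma growth (M : IsGradientModel Z φ r γ δ e q) (R : Regime d m r γ δ ν τ κ σ e)
    {L : Finset (Fin m)} {t : Fin m → ℝ} {c : ℝ} (hb : IsBalanced φ L t c) {u : E d}
    (hu : ‖u‖ = 1) (hres : ‖resid Z u‖ ≤ 2 * σ)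
    (hbig : ∀ i ∈ L, τ < |inner ℝ u (Z i)|) (hsmall : ∀ k ∉ L, |inner ℝ u (Z k)| ≤ τ)
    {z z₀ : ℝ} (hz₀ : 0 < z₀) (hz : z₀ ≤ z)
    (he : e ≤ (m : ℝ) ^ (-δ) * τ ^ 3 * min z₀ 1 / 16)
    (ha : ∃ a ∈ L, c * Real.exp z ≤ φ a (inner ℝ u (Z a) ^ 2)) :
    ∃ a ∈ L, c * Real.exp (z + δ * κ * τ ^ 2 / 8 * min z 1) ≤
      φ a (inner ℝ (GHat q u) (Z a) ^ 2) := by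
  classical
  obtain ⟨a₀, ha₀, ha₀'⟩ := ha
  have hτ := R.τ_pos
  have hτ1 := R.τ_le_one
  have hδ := R.δ_pos
  have hr := R.r_pos
  have hbase := R.base_pos
  have hc := M.base_le R hb
  have hc0 : 0 < c := hbase.trans_le hc
  have hz0 : 0 < z := hz₀.trans_le hz
  -- The witness is the coordinate of largest ratio among all `m`. It lies in `L` because a
  -- coordinate at most `τ` has ratio at most `m^(-δ)/16`, which is below `c`.
  obtain ⟨a, -, hamax⟩ := Finset.exists_max_image Finset.univ
    (fun k => φ k (inner ℝ u (Z k) ^ 2)) ⟨a₀, Finset.mem_univ _⟩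
  set Λ := φ a (inner ℝ u (Z a) ^ 2) with hΛ
  have hΛz : c * Real.exp z ≤ Λ := ha₀'.trans (hamax a₀ (Finset.mem_univ _))
  have hexp : 1 < Real.exp z := Real.one_lt_exp_iff.2 hz0
  have hcΛ : c < Λ := by nlinarith
  have hΛ0 : 0 < Λ := hc0.trans hcΛ
  have haL : a ∈ L := by
    by_contra hn
    have hk := hsmall a hn
    have hsq := M.sq_mem hu.le a
    have h1 := (M.profile a).le_rpow R.γ_pos hsq.1 hsq.2
    have h2 : (inner ℝ u (Z a) ^ 2) ^ γ ≤ τ ^ (2 * γ) := by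
      rw [Real.rpow_mul hτ.le, Real.rpow_two]
      refine Real.rpow_le_rpow hsq.1 ?_ R.γ_pos.le
      rw [← sq_abs]
      gcongr
    rw [R.τ_pow] at h2
    have h3 : (inner ℝ u (Z a) ^ 2) ^ γ / r ≤ (m : ℝ) ^ (-δ) / 16 := by
      rw [div_le_iff₀ hr]
      linarith
    linarith
  have hua := hbig a haL
  set ua := |inner ℝ u (Z a)| with hua'
  have hua1 : ua ≤ 1 := by
    have := abs_inner_le_norm M.orthonormal u a
    rwa [hu] at this
  have hua0 : 0 < ua := hτ.trans hua
  have hsum1 : ∑ k, inner ℝ u (Z k) ^ 2 ≤ 1 := by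
    have := norm_sq_eq_sum_add_resid M.orthonormal u
    rw [hu] at this
    nlinarith [sq_nonneg ‖resid Z u‖]
  -- The squares over `L` sum to at most `1 = ∑ t`, so not every one can exceed its balanced value.
  -- Coordinate `b` has ratio at most `c` and, being above `τ`, carries enough weight to pull the
  -- norm below `Λ`.
  obtain ⟨b, hbL, hbt⟩ : ∃ b ∈ L, inner ℝ u (Z b) ^ 2 ≤ t b := by
    by_contra! hcon
    have h1 := Finset.sum_lt_sum_of_nonempty ⟨a, haL⟩ hcon
    rw [hb.sum_eq] at h1
    have h2 : ∑ k ∈ L, inner ℝ u (Z k) ^ 2 ≤ ∑ k, inner ℝ u (Z k) ^ 2 :=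
      Finset.sum_le_univ_sum_of_nonneg fun k => sq_nonneg _
    linarith
  have hφb : φ b (inner ℝ u (Z b) ^ 2) ≤ c := by
    rw [← hb.eq b hbL]
    exact (M.profile b).mono hδ (sq_nonneg _) hbt (hb.le_one hbL)
  have hub : τ ^ 2 ≤ inner ℝ u (Z b) ^ 2 := by
    rw [← sq_abs (inner ℝ u (Z b))]
    have := (hbig b hbL).le
    gcongr
  obtain ⟨p, hp0, hpk, hpq⟩ := M.approx u hu.le
  -- `s` is the relative gap between `c` and `Λ`, and `y = τ² s` below is the resulting relative
  -- deficit in the squared norm. It is linear in `z` for small `z` and saturates, hence the `min z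
  -- 1`.
  set s := 1 - Real.exp (-z) with hs
  have hs2 : min z 1 / 2 ≤ s := half_min_le hz0.le
  have hs1 : s ≤ 1 := by linarith [Real.exp_pos (-z)]
  have hmin0 : 0 < min z 1 := lt_min hz0 one_pos
  have hs0 : 0 < s := by linarith
  have hcs : c ≤ Λ * (1 - s) := by
    rw [hs, sub_sub_cancel, Real.exp_neg, ← div_eq_mul_inv, le_div_iff₀ (Real.exp_pos z)]
    exact hΛz
  -- the norm of the exact gradient
  have hp2 : ‖p‖ ^ 2 ≤ Λ ^ 2 - τ ^ 2 * (Λ ^ 2 - c ^ 2) := by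
    exact M.norm_sq_le hu.le hδ hp0 hpk (fun k => hamax k (Finset.mem_univ k)) hsum1 hc0.le hcΛ.le hφb hub
  set y := τ ^ 2 * s with hy
  have hy0 : 0 < y := by positivity
  have hy1 : y ≤ 1 := by nlinarith
  have hp1 : ‖p‖ ≤ Λ * (1 - y / 2) :=
    le_mul_one_sub_of_sq_le hc0.le hΛ0.le hs0.le hs1 hcs hy1 hp2
  -- the error term
  have herr : e / 2 ≤ Λ * ua * (y / 16) := by
    have h1 : min z₀ 1 ≤ min z 1 := min_le_min_right 1 hz
    have h2 : e ≤ c * τ ^ 3 * min z 1 / 16 := he.trans (by gcongr)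
    have h3 : c * τ ^ 3 * min z 1 / 16 ≤ Λ * ua * (τ ^ 2 * (2 * s)) / 16 := by
      have : c * τ ≤ Λ * ua := by gcongr
      calc c * τ ^ 3 * min z 1 / 16 = c * τ * (τ ^ 2 * min z 1) / 16 := by ring
        _ ≤ Λ * ua * (τ ^ 2 * (2 * s)) / 16 := by
          gcongr
          linarith
    rw [hy]
    linarith
  have hqn : ‖q u‖ ≤ Λ * (1 - y / 2 + y / 16) := by
    have h1 := norm_le_insert' (q u) p
    have h2 : Λ * ua * (y / 16) ≤ Λ * 1 * (y / 16) := by gcongr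
    nlinarith
  have hqpos : 0 < ‖q u‖ :=
    lt_of_lt_of_le (by positivity) (M.norm_lower' R hu hres hp0 hpk hpq)
  have hq0 : q u ≠ 0 := norm_pos_iff.1 hqpos
  have hqa : ua * Λ * (1 - y / 16) ≤ |inner ℝ (q u) (Z a)| := by
    have h1 : |inner ℝ p (Z a)| - |inner ℝ (q u) (Z a)| ≤ e / 2 := by
      refine (abs_sub_abs_le_abs_sub _ _).trans ?_
      rw [← inner_sub_left]
      refine (abs_inner_le_norm M.orthonormal _ a).trans ?_
      rwa [norm_sub_rev]
    rw [hpk a] at h1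
    nlinarith
  -- The gradient norm is at most `Λ(1 - 7y/16)`, and coordinate `a` of the image is at least
  -- `ua·Λ(1 - y/16)`. Normalizing therefore gains at least the factor `1 + y/4`.
  set A := 1 + y / 4 with hA
  have hAu : A * ua ≤ |inner ℝ (GHat q u) (Z a)| := by
    rw [GHat, if_neg hq0, real_inner_smul_left, abs_mul, abs_inv, abs_norm, inv_mul_eq_div,
      le_div_iff₀ hqpos]
    refine le_trans ?_ hqa
    calc A * ua * ‖q u‖ ≤ A * ua * (Λ * (1 - y / 2 + y / 16)) := by gcongr
      _ = ua * Λ * (A * (1 - y / 2 + y / 16)) := by ring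
      _ ≤ ua * Λ * (1 - y / 16) := by
          gcongr
          rw [hA]
          nlinarith
  have hG1 : |inner ℝ (GHat q u) (Z a)| ≤ 1 := by
    have := abs_inner_le_norm M.orthonormal (GHat q u) a
    rwa [norm_GHat hu] at this
  have hA1 : 1 ≤ A := by linarith
  have hA0 : 0 < A := by linarith
  refine ⟨a, haL, ?_⟩
  have hAsq : A ^ 2 * inner ℝ u (Z a) ^ 2 ≤ inner ℝ (GHat q u) (Z a) ^ 2 := by
    rw [← sq_abs (inner ℝ u (Z a)), ← sq_abs (inner ℝ (GHat q u) (Z a)), ← mul_pow]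
    exact pow_le_pow_left₀ (by positivity) hAu 2
  have hGsq := M.sq_mem (norm_GHat (q := q) hu).le a
  have hsqa := M.sq_mem hu.le a
  -- Elasticity applies at `a` because its ratio is at least `m^(-δ)`, which forces its square to be
  -- at least `ν²`. The squared coordinate grows by `A²`, so the ratio grows by `A^(2δκ)`.
  have hel := (M.profile a).mul_rpow_le R.γ_pos R.γ_le hr R.ν_pos R.κ_eq R.κ_le_one
    ((M.profile a).sq_le_of_le R hsqa.1 hsqa.2 (by linarith)) (one_le_pow₀ hA1 (n := 2))
    (hAsq.trans hGsq.2)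
  refine le_trans ?_ (hel.trans ((M.profile a).mono hδ (by positivity) hAsq hGsq.2))
  rw [Real.exp_add, ← mul_assoc]
  refine mul_le_mul hΛz ?_ (Real.exp_pos _).le hΛ0.le
  rw [Real.rpow_def_of_pos (by positivity), Real.log_pow]
  refine Real.exp_le_exp.2 ?_
  have hlog : y / 5 ≤ Real.log A := by
    refine le_trans ?_ (Real.one_sub_inv_le_log_of_pos hA0)
    rw [le_sub_iff_add_le, ← le_sub_iff_add_le', inv_le_comm₀ hA0 (by linarith), hA,
      ← one_div, div_le_iff₀ (by linarith)]
    nlinarith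
  have hκ := R.κ_pos
  have h8 : τ ^ 2 * min z 1 / 8 ≤ 2 * Real.log A := by
    have : τ ^ 2 * (min z 1 / 2) ≤ y := by rw [hy]; gcongr
    have h9 : 0 < τ ^ 2 * (min z 1 / 2) := by positivity
    nlinarith
  push_cast
  calc δ * κ * τ ^ 2 / 8 * min z 1 = δ * κ * (τ ^ 2 * min z 1 / 8) := by ring
    _ ≤ δ * κ * (2 * Real.log A) := by gcongr
    _ = _ := by ring

/-- A start with one gradient ratio above the balanced value makes some coordinate of `L` drop
to at most `τ`. -/
lemma escape (M : IsGradientModel Z φ r γ δ e q) (R : Regime d m r γ δ ν τ κ σ e)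
    {L : Finset (Fin m)} {t : Fin m → ℝ} {c : ℝ} (hb : IsBalanced φ L t c) {u : E d}
    (hu : ‖u‖ = 1) (hres : ‖resid Z u‖ ≤ 2 * σ) (hsmall : ∀ k ∉ L, |inner ℝ u (Z k)| ≤ τ)
    {z₀ : ℝ} (hz₀ : 0 < z₀) (he : e ≤ (m : ℝ) ^ (-δ) * τ ^ 3 * min z₀ 1 / 16)
    (ha : ∃ a ∈ L, c * Real.exp z₀ ≤ φ a (inner ℝ u (Z a) ^ 2)) {T₁ T₂ : ℕ}
    (hT₁ : 1 ≤ z₀ * (1 + δ * κ * τ ^ 2 / 8) ^ T₁)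
    (hT₂ : Real.log ((m : ℝ) ^ δ / r) < 1 + δ * κ * τ ^ 2 / 8 * T₂) :
    ∃ n ≤ T₁ + T₂, ∃ i ∈ L, |inner ℝ (giLoop q u n) (Z i)| ≤ τ := by
  by_contra! hcon
  have hτ := R.τ_pos
  have hδ := R.δ_pos
  have hκ := R.κ_pos
  have hbase := R.base_pos
  have hc := M.base_le R hb
  have hc0 : 0 < c := hbase.trans_le hc
  set ρ := δ * κ * τ ^ 2 / 8 with hρ
  have hρ0 : 0 < ρ := by positivity
  have hsm : ∀ n, ‖resid Z (giLoop q u n)‖ ≤ 2 * σ ∧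
      ∀ k ∉ L, |inner ℝ (giLoop q u n) (Z k)| ≤ τ := by
    intro n
    obtain ⟨h1, h2⟩ := M.giLoop_small R hu hres n
    refine ⟨h1, fun k hk => (h2 k (hsmall k hk)).trans (max_le ?_ ?_)⟩
    · linarith [R.θ_le_τ]
    · have hexp0 : (0 : ℝ) ≤ n + γ * n * (n - 1) := by
        rcases Nat.eq_zero_or_pos n with rfl | hn
        · simp
        · have : (1 : ℝ) ≤ n := by exact_mod_cast hn
          have : 0 ≤ γ * n * (n - 1) :=
            mul_nonneg (mul_nonneg R.γ_pos.le (by linarith)) (by linarith)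
          linarith
      have h41 : (4 : ℝ) ^ (-(n + γ * n * (n - 1) : ℝ)) ≤ 1 :=
        Real.rpow_le_one_of_one_le_of_nonpos (by norm_num) (by linarith)
      nlinarith
  -- `P n z` says that after `n` iterations some ratio on `L` exceeds `c` by at least the factor
  -- `exp z`.
  set P : ℕ → ℝ → Prop := fun n z =>
    ∃ a ∈ L, c * Real.exp z ≤ φ a (inner ℝ (giLoop q u n) (Z a) ^ 2)
  have hdown : ∀ n z z', z' ≤ z → P n z → P n z' := by
    rintro n z z' hzz ⟨a, ha, h⟩
    exact ⟨a, ha, le_trans (by gcongr) h⟩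
  have hstep : ∀ n ≤ T₁ + T₂, ∀ z, z₀ ≤ z → P n z → P (n + 1) (z + ρ * min z 1) := by
    intro n hn z hz hP
    simp only [P, giLoop_succ]
    exact M.growth R hb (norm_giLoop hu n) (hsm n).1 (fun i hi => hcon n hn i hi) (hsm n).2 hz₀ hz
      he hP
  -- First phase: while `z ≤ 1` the gain `ρ z` is proportional to `z`, so the excess grows
  -- geometrically. After reaching `1` it grows by `ρ` per step.
  have hphase1 : ∀ n ≤ T₁, P n (min (z₀ * (1 + ρ) ^ n) 1) := by
    intro n
    induction n with
    | zero =>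
      intro _
      refine hdown 0 z₀ _ (by simp) ?_
      simpa [P, giLoop] using ha
    | succ n ih =>
      intro hn
      have hP := ih (by omega)
      have hpow : 1 ≤ (1 + ρ) ^ n := one_le_pow₀ (by linarith)
      by_cases h1 : z₀ ≤ min (z₀ * (1 + ρ) ^ n) 1
      · refine hdown _ _ _ ?_ (hstep n (by omega) _ h1 hP)
        rw [min_eq_left (min_le_right _ _)]
        rcases min_cases (z₀ * (1 + ρ) ^ n) 1 with ⟨h, h'⟩ | ⟨h, h'⟩ <;> rw [h]
        · refine (min_le_left _ _).trans (le_of_eq ?_)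
          ring
        · exact (min_le_right _ _).trans (by linarith)
      · -- here `z₀ > 1`
        have hz1 : 1 < z₀ := by
          by_contra hz1
          exact h1 (le_min (by nlinarith) (by linarith))
        have hall : ∀ k ≤ n + 1, P k z₀ := by
          intro k
          induction k with
          | zero => intro _; simpa [P, giLoop] using ha
          | succ k ihk =>
            intro hk
            refine hdown _ _ _ ?_ (hstep k (by omega) _ le_rfl (ihk (by omega)))
            have : 0 ≤ ρ * min z₀ 1 := mul_nonneg hρ0.le (le_min hz₀.le zero_le_one)
            linarith
        exact hdown _ _ _ ((min_le_right _ _).trans hz1.le) (hall (n + 1) le_rfl)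
  have hP1 : P T₁ 1 := by
    have := hphase1 T₁ le_rfl
    rwa [min_eq_right hT₁] at this
  have hmax1 : ∀ n ≤ T₂, P (T₁ + n) (1 + ρ * n) := by
    intro n
    induction n with
    | zero => intro _; simpa using hP1
    | succ n ih =>
      intro hn
      have hP := ih (by omega)
      by_cases hz : z₀ ≤ 1 + ρ * n
      · have := hstep (T₁ + n) (by omega) _ hz hP
        refine hdown _ _ _ ?_ this
        rw [min_eq_right (by nlinarith [Nat.cast_nonneg (α := ℝ) n])]
        push_cast
        linarith
      · have hz1 : 1 ≤ z₀ := by nlinarith [Nat.cast_nonneg (α := ℝ) n]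
        have hall : ∀ k ≤ T₁ + n + 1, P k (z₀ + ρ * k) := by
          intro k
          induction k with
          | zero => intro _; simpa [P, giLoop] using ha
          | succ k ihk =>
            intro hk
            have hk0 : 0 ≤ ρ * k := mul_nonneg hρ0.le (Nat.cast_nonneg k)
            refine hdown _ _ _ ?_ (hstep k (by omega) _ (by linarith) (ihk (by omega)))
            rw [min_eq_right (by linarith)]
            push_cast
            linarith
        refine hdown _ _ _ ?_ (hall (T₁ + (n + 1)) (by omega))
        push_cast
        nlinarith [Nat.cast_nonneg (α := ℝ) T₁]
  obtain ⟨a, -, hal⟩ := hmax1 T₂ le_rfl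
  have hsq := M.sq_mem (norm_giLoop (q := q) hu (T₁ + T₂)).le a
  have h1 := (M.profile a).le_rpow R.γ_pos hsq.1 hsq.2
  have h2 : (inner ℝ (giLoop q u (T₁ + T₂)) (Z a) ^ 2) ^ γ ≤ 1 :=
    Real.rpow_le_one hsq.1 hsq.2 R.γ_pos.le
  -- The excess cannot last: `c ≥ m^(-δ)` and every ratio is at most `1/r`, which contradicts the
  -- choice of `T₂`.
  have h3 : (m : ℝ) ^ (-δ) * Real.exp (1 + ρ * T₂) ≤ 1 / r := by
    calc (m : ℝ) ^ (-δ) * Real.exp (1 + ρ * T₂) ≤ c * Real.exp (1 + ρ * T₂) := by gcongr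
      _ ≤ _ := hal
      _ ≤ _ := h1
      _ ≤ 1 / r := by
        have := R.r_pos
        gcongr
  have hr := R.r_pos
  have hm := R.m_pos
  have h4 : Real.exp (1 + ρ * T₂) ≤ (m : ℝ) ^ δ / r := by
    rw [Real.rpow_neg hm.le, inv_mul_le_iff₀ (by positivity)] at h3
    rwa [mul_one_div] at h3
  have h5 := (Real.le_log_iff_exp_le (by positivity)).2 h4
  linarith

/-- Exceeding a balanced coordinate by a factor `1 + η` raises its gradient ratio. -/
lemma exp_le_of_sq_le (M : IsGradientModel Z φ r γ δ e q) (R : Regime d m r γ δ ν τ κ σ e)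
    {L : Finset (Fin m)} {t : Fin m → ℝ} {c : ℝ} (hb : IsBalanced φ L t c) {i : Fin m}
    (hi : i ∈ L) {η x : ℝ} (hη : 0 ≤ η) (hη1 : η ≤ 1) (hx : (1 + η) ^ 2 * t i ≤ x) (hx1 : x ≤ 1) :
    c * Real.exp (δ * κ * η) ≤ φ i x := by
  have hδ := R.δ_pos
  have hκ := R.κ_pos
  have h1 := (M.profile i).mul_rpow_le R.γ_pos R.γ_le R.r_pos R.ν_pos R.κ_eq R.κ_le_one
    (M.sq_le_balanced R hb hi) (one_le_pow₀ (by linarith : 1 ≤ 1 + η) (n := 2)) (hx.trans hx1)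
  have h0 := mul_nonneg (sq_nonneg (1 + η)) (hb.nonneg i hi)
  refine le_trans ?_ (h1.trans ((M.profile i).mono hδ h0 hx hx1))
  rw [hb.eq i hi]
  have hc0 : 0 < c := R.base_pos.trans_le (M.base_le R hb)
  refine mul_le_mul_of_nonneg_left ?_ hc0.le
  rw [Real.rpow_def_of_pos (by positivity), Real.log_pow]
  refine Real.exp_le_exp.2 ?_
  have hlog : η / 2 ≤ Real.log (1 + η) := by
    refine le_trans ?_ (Real.one_sub_inv_le_log_of_pos (by linarith))
    rw [le_sub_iff_add_le, ← le_sub_iff_add_le', inv_le_comm₀ (by linarith) (by linarith),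
      ← one_div, div_le_iff₀ (by linarith)]
    nlinarith
  push_cast
  have : 0 ≤ δ * κ := by positivity
  nlinarith

end IsGradientModel

/-! ### Random jumps -/

/-- `x` is a tangent vector at `u` of length `σ`. -/
def IsJump (σ : ℝ) (u x : E d) : Prop := inner ℝ u x = 0 ∧ ‖x‖ = σ

/-- `u` is a unit vector nearly in the span of the hidden basis. -/
def IsTame (Z : Fin m → E d) (θ : ℝ) (u : E d) : Prop := ‖u‖ = 1 ∧ ‖resid Z u‖ ≤ θ

/-- The hidden coordinates of `u` exceeding `θ`. -/
def bigSet (Z : Fin m → E d) (θ : ℝ) (u : E d) : Finset (Fin m) :=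
  Finset.univ.filter fun k => θ < |inner ℝ u (Z k)|

lemma mem_bigSet {Z : Fin m → E d} {θ : ℝ} {u : E d} {k : Fin m} :
    k ∈ bigSet Z θ u ↔ θ < |inner ℝ u (Z k)| := by
  simp [bigSet]

lemma IsJump.norm_eq {σ : ℝ} (hσ : 0 < σ) {u x : E d} (hu : ‖u‖ = 1) (hx : IsJump σ u x) :
    ‖jumpMap u x‖ = 1 := by
  have h1 : ‖jumpMap u x‖ ^ 2 = 1 := by
    rw [jumpMap, norm_add_sq_real, real_inner_smul_left, real_inner_smul_right, hx.1, norm_smul,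
      norm_smul, hu, hx.2, Real.norm_eq_abs, Real.norm_eq_abs, mul_one, sq_abs, mul_pow, sq_abs,
      ← mul_pow, inv_mul_cancel_right₀ hσ.ne']
    have := Real.cos_sq_add_sin_sq σ
    linarith
  exact (pow_eq_one_iff_of_nonneg (norm_nonneg _) two_ne_zero).1 h1

lemma inner_jumpMap {σ : ℝ} {u x : E d} (hx : IsJump σ u x) (z : E d) :
    inner ℝ (jumpMap u x) z = Real.cos σ * inner ℝ u z + Real.sin σ / σ * inner ℝ x z := by
  rw [jumpMap, hx.2, inner_add_left, real_inner_smul_left, real_inner_smul_left, div_eq_mul_inv]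

lemma sin_div_bounds {σ : ℝ} (hσ : 0 < σ) (hσ1 : σ ≤ 1 / 12) :
    99 / 100 ≤ Real.sin σ / σ ∧ Real.sin σ / σ ≤ 1 := by
  constructor
  · rw [le_div_iff₀ hσ]
    have h := Real.sin_gt_sub_cube hσ
    have h2 : σ ^ 2 ≤ 1 / 144 := by nlinarith
    nlinarith
  · rw [div_le_one hσ]
    exact Real.sin_le hσ.le

namespace IsGradientModel

variable {r γ δ ν τ κ σ e : ℝ} {Z : Fin m → E d} {φ : Fin m → ℝ → ℝ} {q : E d → E d}

lemma abs_inner_jump_le (M : IsGradientModel Z φ r γ δ e q) (R : Regime d m r γ δ ν τ κ σ e)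
    {u x : E d} (hx : IsJump σ u x) (k : Fin m) :
    |inner ℝ (jumpMap u x) (Z k)| ≤ |inner ℝ u (Z k)| + σ := by
  obtain ⟨h1, h2⟩ := sin_div_bounds R.σ_pos R.σ_le_twelfth
  rw [inner_jumpMap hx]
  refine (abs_add_le _ _).trans (add_le_add ?_ ?_)
  · rw [abs_mul]
    exact mul_le_of_le_one_left (abs_nonneg _) (Real.abs_cos_le_one σ)
  · rw [abs_mul, abs_of_nonneg (by linarith)]
    have h3 := abs_inner_le_norm M.orthonormal x k
    rw [hx.2] at h3
    nlinarith [abs_nonneg (inner ℝ x (Z k) : ℝ)]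

lemma resid_jump_le (M : IsGradientModel Z φ r γ δ e q) (R : Regime d m r γ δ ν τ κ σ e)
    {u x : E d} (hu : IsTame Z (σ * τ / 10) u) (hx : IsJump σ u x) :
    ‖resid Z (jumpMap u x)‖ ≤ 2 * σ := by
  obtain ⟨h1, h2⟩ := sin_div_bounds R.σ_pos R.σ_le_twelfth
  rw [jumpMap, resid_add, resid_smul, resid_smul, hx.2, ← div_eq_mul_inv]
  refine (norm_add_le _ _).trans ?_
  rw [norm_smul, norm_smul, Real.norm_eq_abs, Real.norm_eq_abs, abs_of_nonneg (by linarith :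
    0 ≤ Real.sin σ / σ)]
  have h3 := norm_resid_le M.orthonormal x
  rw [hx.2] at h3
  have h4 := mul_le_of_le_one_left (norm_nonneg (resid Z u)) (Real.abs_cos_le_one σ)
  have h5 := mul_le_of_le_one_left (norm_nonneg (resid Z x)) h2
  have := R.θ_le_σ
  have := hu.2
  have := R.σ_pos
  linarith

/-- A jump followed by enough iterations preserves tameness and creates no new big coordinates. -/
lemma tame_next (M : IsGradientModel Z φ r γ δ e q) (R : Regime d m r γ δ ν τ κ σ e)
    {u x : E d} (hu : IsTame Z (σ * τ / 10) u) (hx : IsJump σ u x) {N : ℕ} (hN : 2 ≤ N)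
    (hN' : 10 / σ ≤ γ * N) :
    IsTame Z (σ * τ / 10) (giLoop q (jumpMap u x) N) ∧
      bigSet Z (σ * τ / 10) (giLoop q (jumpMap u x) N) ⊆ bigSet Z (σ * τ / 10) u := by
  have hw := hx.norm_eq R.σ_pos hu.1
  have hres := M.resid_jump_le R hu hx
  refine ⟨⟨norm_giLoop hw N, ?_⟩, fun k hk => ?_⟩
  · obtain ⟨n, rfl⟩ : ∃ n, N = n + 1 := ⟨N - 1, by omega⟩
    rw [giLoop_succ]
    exact (M.GHat_small R (norm_giLoop hw n) (M.giLoop_small R hw hres n).1).1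
  · rw [mem_bigSet] at hk ⊢
    by_contra! hcon
    refine absurd (M.giLoop_tiny R hw hres hN hN' (k := k) ?_) (not_le.2 hk)
    refine (M.abs_inner_jump_le R hx k).trans ?_
    linarith [R.θ_le_τ, R.σ_le_τ, R.τ_pos]

/-- It suffices that coordinate `i` touches `τ` at some time `n`: the remaining `N₀` or more
iterations push it to the noise floor, and no new big coordinate appears meanwhile. -/
lemma bigSet_ssubset (M : IsGradientModel Z φ r γ δ e q) (R : Regime d m r γ δ ν τ κ σ e)
    {u x : E d} (hu : IsTame Z (σ * τ / 10) u) (hx : IsJump σ u x) {N n N₀ : ℕ} (hN₀ : 2 ≤ N₀)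
    (hN₀' : 10 / σ ≤ γ * N₀) (hN : n + N₀ ≤ N) {i : Fin m} (hi : i ∈ bigSet Z (σ * τ / 10) u)
    (hn : |inner ℝ (giLoop q (jumpMap u x) n) (Z i)| ≤ τ) :
    bigSet Z (σ * τ / 10) (giLoop q (jumpMap u x) N) ⊂ bigSet Z (σ * τ / 10) u := by
  have hγ := R.γ_pos
  have hge : ∀ k : ℕ, N₀ ≤ k → 10 / σ ≤ γ * k := fun k hk =>
    hN₀'.trans (by gcongr)
  refine (Finset.ssubset_iff_of_subset
    (M.tame_next R hu hx (by omega) (hge N (by omega))).2).2 ⟨i, hi, ?_⟩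
  rw [mem_bigSet, not_lt]
  have hw := hx.norm_eq R.σ_pos hu.1
  have hres := M.resid_jump_le R hu hx
  obtain ⟨k, rfl⟩ : ∃ k, N = k + n := ⟨N - n, by omega⟩
  rw [giLoop_add]
  exact M.giLoop_tiny R (norm_giLoop hw n) (M.giLoop_small R hw hres n).1 (by omega)
    (hge k (by omega)) hn

/-- What is missing from the unit norm is the residual and the coordinates outside the big set, each
at most `στ/10`. Nonemptiness leaves at most `m` such terms, and `m τ² ≤ 1`. -/
lemma sum_bigSet_ge (M : IsGradientModel Z φ r γ δ e q) (R : Regime d m r γ δ ν τ κ σ e)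
    {u : E d} (hu : IsTame Z (σ * τ / 10) u) (hne : (bigSet Z (σ * τ / 10) u).Nonempty) :
    1 - σ ^ 2 / 100 ≤ ∑ k ∈ bigSet Z (σ * τ / 10) u, inner ℝ u (Z k) ^ 2 := by
  classical
  set L := bigSet Z (σ * τ / 10) u with hL
  have h1 := norm_sq_eq_sum_add_resid M.orthonormal u
  rw [hu.1, ← Finset.sum_add_sum_compl L] at h1
  have h2 : ∑ k ∈ Lᶜ, inner ℝ u (Z k) ^ 2 ≤ Lᶜ.card • (σ * τ / 10) ^ 2 := by
    refine Finset.sum_le_card_nsmul _ _ _ fun k hk => ?_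
    rw [Finset.mem_compl, hL, mem_bigSet, not_lt] at hk
    rw [← sq_abs]
    exact pow_le_pow_left₀ (abs_nonneg _) hk 2
  rw [nsmul_eq_mul] at h2
  have h3 : ‖resid Z u‖ ^ 2 ≤ (σ * τ / 10) ^ 2 := pow_le_pow_left₀ (norm_nonneg _) hu.2 2
  have h4 : (Lᶜ.card : ℝ) + 1 ≤ m := by
    have : Lᶜ.card + 1 ≤ m := by
      have h5 := Finset.card_compl_add_card L
      rw [Fintype.card_fin] at h5
      have := hne.card_pos
      omega
    exact_mod_cast this
  have h5 : m * (σ * τ / 10) ^ 2 ≤ σ ^ 2 / 100 := by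
    have := mul_le_mul_of_nonneg_left R.m_mul_τ (sq_nonneg σ)
    linarith
  have h6 := mul_le_mul_of_nonneg_right h4 (sq_nonneg (σ * τ / 10))
  linarith

lemma bigSet_nonempty (M : IsGradientModel Z φ r γ δ e q) (R : Regime d m r γ δ ν τ κ σ e)
    {u : E d} (hu : IsTame Z (σ * τ / 10) u) : (bigSet Z (σ * τ / 10) u).Nonempty := by
  by_contra hne
  rw [Finset.not_nonempty_iff_eq_empty] at hne
  have h1 := norm_sq_eq_sum_add_resid M.orthonormal u
  rw [hu.1] at h1
  have h2 : ∑ k, inner ℝ u (Z k) ^ 2 ≤ (Finset.univ : Finset (Fin m)).card • (σ * τ / 10) ^ 2 := by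
    refine Finset.sum_le_card_nsmul _ _ _ fun k _ => ?_
    have hk : k ∉ bigSet Z (σ * τ / 10) u := by rw [hne]; exact Finset.notMem_empty k
    rw [mem_bigSet, not_lt] at hk
    rw [← sq_abs]
    exact pow_le_pow_left₀ (abs_nonneg _) hk 2
  rw [nsmul_eq_mul, Finset.card_univ, Fintype.card_fin] at h2
  have h3 : ‖resid Z u‖ ^ 2 ≤ (σ * τ / 10) ^ 2 := pow_le_pow_left₀ (norm_nonneg _) hu.2 2
  have h5 := mul_le_mul_of_nonneg_left R.m_mul_τ (sq_nonneg σ)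
  have h6 := R.σ_le_twelfth
  have h7 := R.σ_pos
  have h8 := R.θ_le_σ
  have h9 := R.θ_pos
  nlinarith

/-- The relative excess over the balanced point produced by a jump. -/
def excess (d : ℕ) (σ ν : ℝ) : ℝ := 3 / 10 * (σ * ν / √d)

lemma excess_pos (R : Regime d m r γ δ ν τ κ σ e) : 0 < excess d σ ν := by
  have := R.σ_pos
  have := R.ν_pos
  have : (0 : ℝ) < d := by exact_mod_cast R.one_le_d
  unfold excess
  positivity

lemma one_le_sqrt (R : Regime d m r γ δ ν τ κ σ e) : 1 ≤ √(d : ℝ) := by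
  rw [Real.one_le_sqrt]
  exact_mod_cast R.one_le_d

lemma gap_le (R : Regime d m r γ δ ν τ κ σ e) : σ * ν / √d ≤ σ := by
  have := one_le_sqrt R
  rw [div_le_iff₀ (by linarith)]
  have := R.σ_pos
  have := R.ν_le
  nlinarith

/-- The gap created by a jump dominates the approximation error. -/
lemma error_le_gap (R : Regime d m r γ δ ν τ κ σ e) :
    e ≤ (m : ℝ) ^ (-δ) * τ ^ 3 * min (δ * κ * excess d σ ν) 1 / 16 := by
  have h1 := R.e_le_gap
  have hb := R.base_pos
  have hτ := R.τ_pos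
  have hκ := R.κ_pos
  have hg : 0 < σ * ν / √d := by
    have := excess_pos R
    unfold excess at this
    linarith
  have hg1 : σ * ν / √d ≤ 1 := (gap_le R).trans (by linarith [R.σ_le_twelfth])
  set g := σ * ν / √d
  have hb3 : 0 ≤ (m : ℝ) ^ (-δ) * τ ^ 3 := by positivity
  have h2 : 1 / 100 * (τ * κ * g) ≤ min (δ * κ * excess d σ ν) 1 / 16 := by
    have h3 : τ * κ * g ≤ δ * κ * g := by
      have := R.τ_le_δ
      gcongr
    have h4 : τ * κ * g ≤ 1 :=
      mul_le_one₀ (mul_le_one₀ R.τ_le_one hκ.le R.κ_le_one) hg.le hg1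
    have h5 : 0 < τ * κ * g := by positivity
    rw [le_div_iff₀ (by norm_num), le_min_iff]
    constructor
    · rw [excess]
      linarith
    · linarith
  have h6 := mul_le_mul_of_nonneg_left h2 hb3
  linarith

/-- Exceeding the balanced point after the jump loses a big coordinate. -/
lemma progress_of_exceed (M : IsGradientModel Z φ r γ δ e q) (R : Regime d m r γ δ ν τ κ σ e)
    {u x : E d} (hu : IsTame Z (σ * τ / 10) u) (hx : IsJump σ u x) {t : Fin m → ℝ} {c : ℝ}
    (hb : IsBalanced φ (bigSet Z (σ * τ / 10) u) t c) {T₁ T₂ N₀ N : ℕ} (hN₀ : 2 ≤ N₀)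
    (hN₀' : 10 / σ ≤ γ * N₀) (hN : T₁ + T₂ + N₀ ≤ N)
    (hT₁ : 1 ≤ δ * κ * excess d σ ν * (1 + δ * κ * τ ^ 2 / 8) ^ T₁)
    (hT₂ : Real.log ((m : ℝ) ^ δ / r) < 1 + δ * κ * τ ^ 2 / 8 * T₂)
    (hex : ∃ i ∈ bigSet Z (σ * τ / 10) u,
      (1 + excess d σ ν) ^ 2 * t i ≤ inner ℝ (jumpMap u x) (Z i) ^ 2) :
    bigSet Z (σ * τ / 10) (giLoop q (jumpMap u x) N) ⊂ bigSet Z (σ * τ / 10) u := by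
  obtain ⟨i, hi, hti⟩ := hex
  have hw := hx.norm_eq R.σ_pos hu.1
  have hη := excess_pos R
  have hη1 : excess d σ ν ≤ 1 := by
    have := gap_le R
    have := R.σ_le_twelfth
    unfold excess
    linarith
  obtain ⟨n, hn, j, hj, hjn⟩ := M.escape R hb hw (M.resid_jump_le R hu hx)
    (fun k hk => by
      rw [mem_bigSet, not_lt] at hk
      refine (M.abs_inner_jump_le R hx k).trans ?_
      linarith [R.θ_le_τ, R.σ_le_τ, R.τ_pos])
    (mul_pos (mul_pos R.δ_pos R.κ_pos) hη) (error_le_gap R)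
    ⟨i, hi, M.exp_le_of_sq_le R hb hi hη.le hη1 hti (M.sq_mem hw.le i).2⟩ hT₁ hT₂
  exact M.bigSet_ssubset R hu hx hN₀ hN₀' (by omega) hj hjn

/-- The outward push gains about `g/2` with `g = σν/√d`. The cosine and the slightly lowered
threshold for `u` lose only order `σ²`, and `σ² ≤ g/8`. This leaves a relative gain of `3g/10`, the
quantity `excess`. -/
lemma exceed_of_aligned (R : Regime d m r γ δ ν τ κ σ e)
    {u x : E d} (hx : IsJump σ u x) {t : ℝ} (ht0 : 0 ≤ t) (ht1 : t ≤ 1) {i : Fin m} {s : ℝ}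
    (hs : s = 1 ∨ s = -1) (hti : (1 - σ ^ 2 / 100) * t ≤ inner ℝ u (Z i) ^ 2)
    (hsu : 0 ≤ s * inner ℝ u (Z i)) (hsx : σ * ν / (2 * √d) ≤ s * inner ℝ x (Z i)) :
    (1 + excess d σ ν) ^ 2 * t ≤ inner ℝ (jumpMap u x) (Z i) ^ 2 := by
  have hσ := R.σ_pos
  have hσ1 := R.σ_le_twelfth
  obtain ⟨h1, h2⟩ := sin_div_bounds hσ hσ1
  have hcos := Real.one_sub_sq_div_two_le_cos (x := σ)
  have hd := one_le_sqrt R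
  have hs2 : s ^ 2 = 1 := by rcases hs with rfl | rfl <;> norm_num
  set a := √t with ha
  have ha0 : 0 ≤ a := Real.sqrt_nonneg _
  have ha1 : a ≤ 1 := Real.sqrt_le_one.2 ht1
  have hat : a ^ 2 = t := Real.sq_sqrt ht0
  set U := s * inner ℝ u (Z i) with hU
  set X := s * inner ℝ x (Z i) with hX
  have hσ2 : σ ^ 2 ≤ 1 / 144 := by nlinarith
  have hUa : (1 - σ ^ 2 / 100) * a ≤ U := by
    refine abs_le_of_sq_le_sq' ?_ hsu |>.2
    have h3 : U ^ 2 = inner ℝ u (Z i) ^ 2 := by rw [hU, mul_pow, hs2, one_mul]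
    rw [h3, mul_pow, hat]
    refine le_trans ?_ hti
    refine mul_le_mul_of_nonneg_right ?_ ht0
    nlinarith [sq_nonneg σ]
  set g := σ * ν / √d with hg
  have hg2 : σ * ν / (2 * √d) = g / 2 := by rw [hg]; field_simp
  rw [hg2] at hsx
  -- This is where `σ√d` must be small compared with `τ²`: the push has typical size `σ/√d`, and the
  -- curvature loss `σ²` must not eat it.
  have hσg : σ ^ 2 ≤ g / 8 := by
    rw [hg, le_div_iff₀ (by norm_num), le_div_iff₀ (by linarith)]
    have h3 := R.σ_sqrt_le
    have h4 : τ ^ 2 ≤ ν := by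
      have := R.τ_le
      have := R.τ_le_one
      have := R.τ_pos
      nlinarith
    have h5 : σ * (σ * √d) ≤ σ * (ν / 8) := mul_le_mul_of_nonneg_left (by linarith) hσ.le
    linarith
  have hw : s * inner ℝ (jumpMap u x) (Z i) = Real.cos σ * U + Real.sin σ / σ * X := by
    rw [inner_jumpMap hx]; ring
  have hg0 : 0 ≤ g := by nlinarith
  have hwge : (1 + 3 / 10 * g) * a ≤ s * inner ℝ (jumpMap u x) (Z i) := by
    rw [hw]
    have h6 : (1 - σ ^ 2 / 2) * ((1 - σ ^ 2 / 100) * a) ≤ Real.cos σ * U :=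
      mul_le_mul hcos hUa (mul_nonneg (by linarith) ha0) (by linarith)
    have h7 : 99 / 100 * (g / 2) ≤ Real.sin σ / σ * X :=
      mul_le_mul h1 hsx (by linarith) (by linarith)
    have h8 : (1 - 51 / 100 * σ ^ 2) * a ≤ (1 - σ ^ 2 / 2) * ((1 - σ ^ 2 / 100) * a) := by
      rw [← mul_assoc]
      refine mul_le_mul_of_nonneg_right ?_ ha0
      nlinarith [sq_nonneg (σ ^ 2)]
    have h9 : 99 / 200 * g * a ≤ 99 / 200 * g := mul_le_of_le_one_right (by linarith) ha1
    have h10 : 0 ≤ a * (99 / 200 * g - 3 / 10 * g - 51 / 100 * σ ^ 2) :=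
      mul_nonneg ha0 (by linarith)
    linarith
  have hfin : (s * inner ℝ (jumpMap u x) (Z i)) ^ 2 = inner ℝ (jumpMap u x) (Z i) ^ 2 := by
    rw [mul_pow, hs2, one_mul]
  rw [← hfin, ← hat, ← mul_pow, excess]
  exact pow_le_pow_left₀ (mul_nonneg (by linarith) ha0) hwge 2

/-- When `Z i` is nearly parallel to `u`, a tangent vector barely moves that coordinate. No luck is
needed then: the coordinate exceeds `√t` by `ν²/4`, while a jump changes it by little more than `σ ≤
ν²/12`. -/
lemma exceed_of_large (M : IsGradientModel Z φ r γ δ e q) (R : Regime d m r γ δ ν τ κ σ e)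
    {u x : E d} (hu : ‖u‖ = 1) (hx : IsJump σ u x) {t : ℝ} (ht0 : 0 ≤ t) (ht1 : t ≤ 1 - ν ^ 2)
    {i : Fin m} (hti : 1 - ν ^ 2 / 2 ≤ inner ℝ u (Z i) ^ 2) :
    (1 + excess d σ ν) ^ 2 * t ≤ inner ℝ (jumpMap u x) (Z i) ^ 2 := by
  have hσ := R.σ_pos
  have hσ1 := R.σ_le_twelfth
  obtain ⟨h1, h2⟩ := sin_div_bounds hσ hσ1
  have hcos := Real.one_sub_sq_div_two_le_cos (x := σ)
  set a := √t with ha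
  have ha0 : 0 ≤ a := Real.sqrt_nonneg _
  have hat : a ^ 2 = t := Real.sq_sqrt ht0
  have ha1 : a ≤ 1 := Real.sqrt_le_one.2 (ht1.trans (by linarith [sq_nonneg ν]))
  set U := |inner ℝ u (Z i)| with hU
  have hU1 : U ≤ 1 := by
    have := abs_inner_le_norm M.orthonormal u i
    rwa [hu] at this
  have hU0 : 0 ≤ U := abs_nonneg _
  have hU2 : 1 - ν ^ 2 / 2 ≤ U ^ 2 := by rwa [hU, sq_abs]
  have hdiff : a + ν ^ 2 / 4 ≤ U := by
    by_contra! hcon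
    have : U ^ 2 - a ^ 2 = (U - a) * (U + a) := by ring
    have h3 : (U - a) * (U + a) < ν ^ 2 / 4 * 2 := by
      rcases le_or_gt (U - a) 0 with h | h
      · have : (U - a) * (U + a) ≤ 0 := mul_nonpos_of_nonpos_of_nonneg h (by linarith)
        have := R.ν_pos
        have : 0 < ν ^ 2 := by positivity
        linarith
      · calc (U - a) * (U + a) ≤ (U - a) * 2 := mul_le_mul_of_nonneg_left (by linarith) h.le
          _ < _ := by linarith
    linarith
  have hσν : σ ≤ ν ^ 2 / 12 := by
    have := R.σ_le
    have : τ ^ 2 ≤ ν ^ 2 := pow_le_pow_left₀ R.τ_pos.le R.τ_le 2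
    linarith
  have hwge : U - σ ^ 2 / 2 - σ ≤ |inner ℝ (jumpMap u x) (Z i)| := by
    rw [inner_jumpMap hx]
    have h3 : |Real.cos σ * inner ℝ u (Z i)| - |Real.sin σ / σ * inner ℝ x (Z i)| ≤
        |Real.cos σ * inner ℝ u (Z i) + Real.sin σ / σ * inner ℝ x (Z i)| := by
      have := abs_sub_abs_le_abs_sub (Real.cos σ * inner ℝ u (Z i))
        (-(Real.sin σ / σ * inner ℝ x (Z i)))
      rwa [abs_neg, sub_neg_eq_add] at this
    have h4 : |Real.sin σ / σ * inner ℝ x (Z i)| ≤ σ := by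
      rw [abs_mul, abs_of_nonneg (by linarith)]
      have h5 := abs_inner_le_norm M.orthonormal x i
      rw [hx.2] at h5
      exact (mul_le_of_le_one_left (abs_nonneg _) h2).trans h5
    have h6 : U - σ ^ 2 / 2 ≤ |Real.cos σ * inner ℝ u (Z i)| := by
      rw [abs_mul]
      have h7 : 1 - σ ^ 2 / 2 ≤ |Real.cos σ| := hcos.trans (le_abs_self _)
      have h8 := mul_le_mul_of_nonneg_right h7 hU0
      have h9 : σ ^ 2 / 2 * U ≤ σ ^ 2 / 2 := mul_le_of_le_one_right (by positivity) hU1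
      linarith
    linarith
  have hη : excess d σ ν ≤ 3 / 10 * σ := by
    have := gap_le R
    unfold excess
    linarith
  have hη0 := excess_pos R
  have hσσ : σ ^ 2 ≤ σ / 12 := by nlinarith
  have hη1 : excess d σ ν * a ≤ excess d σ ν := mul_le_of_le_one_right hη0.le ha1
  rw [← hat, ← mul_pow, ← sq_abs (inner ℝ (jumpMap u x) (Z i))]
  refine pow_le_pow_left₀ (mul_nonneg (by linarith) ha0) ?_ 2
  linarith

/-- Losing a big coordinate: there are thresholds `t`, depending only on the set `L` of big
coordinates, such that a jump aligned with a suitable coordinate makes progress, and every jump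
does if there is no suitable coordinate. -/
lemma exists_progress (M : IsGradientModel Z φ r γ δ e q) (R : Regime d m r γ δ ν τ κ σ e)
    {T₁ T₂ N₀ N : ℕ} (hN₀ : 2 ≤ N₀) (hN₀' : 10 / σ ≤ γ * N₀) (hN : T₁ + T₂ + N₀ ≤ N)
    (hT₁ : 1 ≤ δ * κ * excess d σ ν * (1 + δ * κ * τ ^ 2 / 8) ^ T₁)
    (hT₂ : Real.log ((m : ℝ) ^ δ / r) < 1 + δ * κ * τ ^ 2 / 8 * T₂)
    (L : Finset (Fin m)) (hL : 2 ≤ L.card) :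
    ∃ t : Fin m → ℝ, ∀ u, IsTame Z (σ * τ / 10) u → bigSet Z (σ * τ / 10) u = L →
      (∀ i ∈ L, ∀ s : ℝ, (s = 1 ∨ s = -1) → t i ≤ inner ℝ u (Z i) ^ 2 →
        0 ≤ s * inner ℝ u (Z i) → ∀ x, IsJump σ u x → σ * ν / (2 * √d) ≤ s * inner ℝ x (Z i) →
        bigSet Z (σ * τ / 10) (giLoop q (jumpMap u x) N) ⊂ L) ∧
      ((¬ ∃ i ∈ L, t i ≤ inner ℝ u (Z i) ^ 2 ∧ inner ℝ u (Z i) ^ 2 ≤ 1 - ν ^ 2 / 2) →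
        ∀ x, IsJump σ u x → bigSet Z (σ * τ / 10) (giLoop q (jumpMap u x) N) ⊂ L) := by
  have hLne : L.Nonempty := Finset.card_pos.1 (by omega)
  obtain ⟨t, c, hb⟩ := M.exists_isBalanced R.γ_pos R.δ_pos hLne
  -- The balanced values are lowered by the mass that a tame vector may have outside `L`, so some
  -- coordinate of `L` always reaches its threshold.
  refine ⟨fun i => (1 - σ ^ 2 / 100) * t i, ?_⟩
  rintro u hu rfl
  refine ⟨fun i hi s hs hti hsu x hx hsx => ?_, fun hno x hx => ?_⟩
  · exact M.progress_of_exceed R hu hx hb hN₀ hN₀' hN hT₁ hT₂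
      ⟨i, hi, exceed_of_aligned R hx (hb.nonneg i hi) (hb.le_one hi) hs hti hsu hsx⟩
  · obtain ⟨i, hi, hti⟩ : ∃ i ∈ bigSet Z (σ * τ / 10) u,
        (1 - σ ^ 2 / 100) * t i ≤ inner ℝ u (Z i) ^ 2 := by
      by_contra! hcon
      have h1 := Finset.sum_lt_sum_of_nonempty hLne hcon
      rw [← Finset.mul_sum, hb.sum_eq, mul_one] at h1
      linarith [M.sum_bigSet_ge R hu hLne]
    have hlarge : 1 - ν ^ 2 / 2 ≤ inner ℝ u (Z i) ^ 2 := by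
      by_contra! hcon
      exact hno ⟨i, hi, hti, hcon.le⟩
    -- A second coordinate of `L` has balanced value at least `ν²`, which keeps `t i` away from `1`.
    obtain ⟨j, hj, hji⟩ := Finset.exists_mem_ne (Nat.lt_of_succ_le hL) i
    have hti1 : t i ≤ 1 - ν ^ 2 := by
      have h1 := M.sq_le_balanced R hb hj
      have h2 := Finset.add_le_sum hb.nonneg hi hj hji.symm
      rw [hb.sum_eq] at h2
      linarith
    exact M.progress_of_exceed R hu hx hb hN₀ hN₀' hN hT₁ hT₂
      ⟨i, hi, M.exceed_of_large R hu.1 hx (hb.nonneg i hi) hti1 hlarge⟩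

end IsGradientModel

/-! ### Convergence to a hidden basis element -/

/-- The component of `u` orthogonal to `z`. -/
def offAxis (z u : E d) : E d := u - inner ℝ u z • z

lemma offAxis_add (z u v : E d) : offAxis z (u + v) = offAxis z u + offAxis z v := by
  simp only [offAxis, inner_add_left, add_smul]
  abel

lemma offAxis_smul (z : E d) (a : ℝ) (u : E d) : offAxis z (a • u) = a • offAxis z u := by
  simp only [offAxis, real_inner_smul_left, mul_smul, smul_sub]

lemma norm_sq_offAxis {z : E d} (hz : ‖z‖ = 1) (u : E d) :
    ‖offAxis z u‖ ^ 2 = ‖u‖ ^ 2 - inner ℝ u z ^ 2 := by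
  rw [offAxis, norm_sub_sq_real, real_inner_smul_right, norm_smul, hz, Real.norm_eq_abs, mul_one,
    sq_abs]
  ring

lemma norm_offAxis_le {z : E d} (hz : ‖z‖ = 1) (u : E d) : ‖offAxis z u‖ ≤ ‖u‖ := by
  refine abs_le_of_sq_le_sq' ?_ (norm_nonneg _) |>.2
  rw [norm_sq_offAxis hz]
  linarith [sq_nonneg (inner ℝ u z : ℝ)]

/-- With the sign that makes the inner product `|c|`, the squared distance is `2(1 - |c|) ≤ 2(1 -
c²)`. -/
lemma exists_sign_norm_sub_le {z u : E d} (hz : ‖z‖ = 1) (hu : ‖u‖ = 1) :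
    ∃ s : ℝ, (s = 1 ∨ s = -1) ∧ ‖s • u - z‖ ≤ √2 * ‖offAxis z u‖ := by
  obtain ⟨s, hs, hsu⟩ : ∃ s : ℝ, (s = 1 ∨ s = -1) ∧ s * inner ℝ u z = |inner ℝ u z| := by
    rcases le_total 0 (inner ℝ u z : ℝ) with h | h
    · exact ⟨1, Or.inl rfl, by rw [one_mul, abs_of_nonneg h]⟩
    · exact ⟨-1, Or.inr rfl, by rw [neg_one_mul, abs_of_nonpos h]⟩
  refine ⟨s, hs, abs_le_of_sq_le_sq' ?_ (by positivity) |>.2⟩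
  have hs1 : |s| = 1 := by rcases hs with rfl | rfl <;> simp
  have h1 : |inner ℝ u z| ≤ 1 := by
    have := abs_real_inner_le_norm u z
    rwa [hu, hz, mul_one] at this
  rw [mul_pow, Real.sq_sqrt (by norm_num), norm_sq_offAxis hz, norm_sub_sq_real,
    real_inner_smul_left, hsu, norm_smul, Real.norm_eq_abs, hs1, hu, hz, ← sq_abs (inner ℝ u z)]
  nlinarith [abs_nonneg (inner ℝ u z : ℝ)]

namespace IsGradientModel

variable {r γ δ ν τ κ σ e : ℝ} {Z : Fin m → E d} {φ : Fin m → ℝ → ℝ} {q : E d → E d}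

/-- One iteration close to a hidden basis element. -/
lemma offAxis_GHat (M : IsGradientModel Z φ r γ δ e q) (R : Regime d m r γ δ ν τ κ σ e) {u : E d}
    (hu : ‖u‖ = 1) {i : Fin m} (hy : (1 + 2 * δ) * ‖offAxis (Z i) u‖ ^ 2 ≤ 1 / 50) :
    ‖offAxis (Z i) (GHat q u)‖ ≤
      (‖offAxis (Z i) u‖ * (‖offAxis (Z i) u‖ ^ (2 * γ) / r) + e / 2) / (97 / 100) := by
  classical
  have hZi := M.orthonormal.1 i
  have hδ := R.δ_pos
  obtain ⟨p, hp0, hpk, hpq⟩ := M.approx u hu.le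
  set y := ‖offAxis (Z i) u‖ with hydef
  have hy0 : 0 ≤ y := norm_nonneg _
  have hy2 : y ^ 2 = 1 - inner ℝ u (Z i) ^ 2 := by
    rw [hydef, norm_sq_offAxis hZi, hu, one_pow]
  have hsplit := norm_sq_eq_sum_add_resid M.orthonormal u
  rw [hu, one_pow, ← Finset.add_sum_erase _ _ (Finset.mem_univ i)] at hsplit
  have hrest : ∑ k ∈ Finset.univ.erase i, inner ℝ u (Z k) ^ 2 ≤ y ^ 2 := by
    rw [hy2]
    linarith [sq_nonneg ‖resid Z u‖]
  have hr := R.r_pos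
  have hyγ : 0 ≤ y ^ (2 * γ) / r := div_nonneg (Real.rpow_nonneg hy0 _) hr.le
  -- Every coordinate other than `i` has square at most `y²`, so all off-axis ratios share the bound
  -- `y^(2γ)/r`.
  have hφk : ∀ k ∈ Finset.univ.erase i, φ k (inner ℝ u (Z k) ^ 2) ≤ y ^ (2 * γ) / r := by
    intro k hk
    have hsq := M.sq_mem hu.le k
    refine ((M.profile k).le_rpow R.γ_pos hsq.1 hsq.2).trans ?_
    rw [Real.rpow_mul hy0, Real.rpow_two]
    have h1 : inner ℝ u (Z k) ^ 2 ≤ y ^ 2 :=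
      (Finset.single_le_sum (f := fun k => inner ℝ u (Z k) ^ 2)
        (fun _ _ => sq_nonneg _) hk).trans hrest
    exact div_le_div_of_nonneg_right (Real.rpow_le_rpow hsq.1 h1 R.γ_pos.le) hr.le
  have hoffp : ‖offAxis (Z i) p‖ ≤ y * (y ^ (2 * γ) / r) := by
    refine abs_le_of_sq_le_sq' ?_ (by positivity) |>.2
    rw [norm_sq_offAxis hZi, norm_sq_eq_sum_add_resid M.orthonormal p, hp0, norm_zero,
      ← Finset.add_sum_erase _ _ (Finset.mem_univ i)]
    have h1 : ∑ k ∈ Finset.univ.erase i, inner ℝ p (Z k) ^ 2 ≤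
        ∑ k ∈ Finset.univ.erase i, inner ℝ u (Z k) ^ 2 * (y ^ (2 * γ) / r) ^ 2 := by
      refine Finset.sum_le_sum fun k hk => ?_
      have hφ0 := (M.profile k).nonneg hδ (M.sq_mem hu.le k).1 (M.sq_mem hu.le k).2
      rw [← sq_abs (inner ℝ p (Z k)), hpk k, mul_pow, sq_abs]
      exact mul_le_mul_of_nonneg_left (pow_le_pow_left₀ hφ0 (hφk k hk) 2) (sq_nonneg _)
    rw [← Finset.sum_mul] at h1
    have h2 := mul_le_mul_of_nonneg_right hrest (sq_nonneg (y ^ (2 * γ) / r))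
    rw [mul_pow]
    linarith
  -- On the axis `|p_i| ≥ |u_i|^(1+2δ)`. Bernoulli gives `|p_i|² ≥ 1 - (1+2δ)y² ≥ 49/50 >
  -- (98/100)²`.
  have hpi : 98 / 100 ≤ |inner ℝ p (Z i)| := by
    refine abs_le_of_sq_le_sq' ?_ (abs_nonneg _) |>.2
    have hsq := M.sq_mem hu.le i
    have h1 := (M.profile i).rpow_le hδ hsq.1 hsq.2
    have h2 := one_add_mul_self_le_rpow_one_add (s := inner ℝ u (Z i) ^ 2 - 1)
      (by linarith [hsq.1]) (p := 1 + 2 * δ) (by linarith)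
    rw [add_sub_cancel] at h2
    have h3 : (inner ℝ u (Z i) ^ 2) ^ (1 + 2 * δ) ≤ |inner ℝ p (Z i)| ^ 2 := by
      rw [hpk i, mul_pow, sq_abs, add_comm, Real.rpow_add_one' hsq.1 (by linarith), mul_comm,
        mul_comm 2 δ, Real.rpow_mul hsq.1, Real.rpow_two]
      exact mul_le_mul_of_nonneg_left
        (pow_le_pow_left₀ (Real.rpow_nonneg hsq.1 δ) h1 2) hsq.1
    have h4 : (1 + 2 * δ) * (inner ℝ u (Z i) ^ 2 - 1) = -((1 + 2 * δ) * y ^ 2) := by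
      rw [hy2]; ring
    rw [h4] at h2
    linarith
  have he : e ≤ 1 / 100 := by
    have h1 := R.e_le
    have h2 := R.base_le_one
    have h3 := R.θ_le_τ
    have h4 := R.τ_le_one
    have h5 := mul_le_mul_of_nonneg_left h2 R.θ_pos.le
    linarith
  have hq : 97 / 100 ≤ ‖q u‖ := by
    have h1 := abs_inner_le_norm M.orthonormal p i
    have h2 := norm_sub_norm_le p (q u)
    rw [norm_sub_rev] at h2
    linarith
  have hqpos : 0 < ‖q u‖ := by linarith
  rw [GHat, if_neg (norm_pos_iff.1 hqpos), offAxis_smul, norm_smul, norm_inv, norm_norm,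
    inv_mul_eq_div]
  have hoffq : ‖offAxis (Z i) (q u)‖ ≤ y * (y ^ (2 * γ) / r) + e / 2 := by
    have h1 : q u = p + (q u - p) := by abel
    rw [h1, offAxis_add]
    exact (norm_add_le _ _).trans (add_le_add hoffp ((norm_offAxis_le hZi _).trans hpq))
  have h0 : 0 ≤ y * (y ^ (2 * γ) / r) + e / 2 := (norm_nonneg _).trans hoffq
  gcongr

/-- Superexponential convergence to the precision `4 e`. -/
lemma offAxis_giLoop (M : IsGradientModel Z φ r γ δ e q) (R : Regime d m r γ δ ν τ κ σ e) {u : E d}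
    (hu : ‖u‖ = 1) {i : Fin m} (hy : ‖offAxis (Z i) u‖ ≤ 11 / 10 * σ) (n : ℕ) :
    ‖offAxis (Z i) (giLoop q u n)‖ ≤ 11 / 10 * σ ∧
      (‖offAxis (Z i) (giLoop q u n)‖ ≤ 4 * e ∨
        8 / r * ‖offAxis (Z i) (giLoop q u n)‖ ^ (2 * γ) ≤ 2 ^ (-(1 + 2 * γ) ^ n)) := by
  have hr := R.r_pos
  have hγ := R.γ_pos
  have hτ := R.τ_pos
  have hσ := R.σ_pos
  have he0 := R.e_pos
  have heσ : e ≤ σ / 20 := by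
    have h1 := R.e_le
    have h2 := mul_le_mul_of_nonneg_left R.base_le_one R.θ_pos.le
    have h3 := R.θ_le_σ
    linarith
  have heτ : 4 * e ≤ τ := by linarith [R.σ_le_τ]
  have hsmall : ∀ y : ℝ, 0 ≤ y → y ≤ τ → y ^ (2 * γ) / r ≤ 1 / 16 := by
    intro y hy0 hyτ
    rw [div_le_iff₀ hr]
    have h1 := Real.rpow_le_rpow hy0 hyτ (by linarith : 0 ≤ 2 * γ)
    rw [R.τ_pow] at h1
    have h2 := mul_le_mul_of_nonneg_left R.base_le_one hr.le
    linarith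
  induction n with
  | zero =>
    refine ⟨by simpa [giLoop] using hy, Or.inr ?_⟩
    have h1 : ‖offAxis (Z i) u‖ ≤ τ := by linarith [R.σ_le_τ]
    have h2 := hsmall _ (norm_nonneg _) h1
    rw [pow_zero, Real.rpow_neg_one]
    simp only [giLoop, Function.iterate_zero, id]
    calc 8 / r * ‖offAxis (Z i) u‖ ^ (2 * γ) = 8 * (‖offAxis (Z i) u‖ ^ (2 * γ) / r) := by ring
      _ ≤ 8 * (1 / 16) := by gcongr
      _ = 2⁻¹ := by norm_num
  | succ n ih =>
    obtain ⟨ih1, ih2⟩ := ih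
    rw [giLoop_succ]
    set v := giLoop q u n with hv
    have hv1 : ‖v‖ = 1 := norm_giLoop hu n
    set y := ‖offAxis (Z i) v‖ with hydef
    have hy0 : 0 ≤ y := norm_nonneg _
    have hyδ : (1 + 2 * δ) * y ^ 2 ≤ 1 / 50 := by
      have h1 := R.σ_sq_le'
      have h2 : y ^ 2 ≤ (11 / 10 * σ) ^ 2 := pow_le_pow_left₀ hy0 ih1 2
      have h3 := mul_le_mul_of_nonneg_left h2 (by linarith [R.δ_pos] : 0 ≤ 1 + 2 * δ)
      have : 0 ≤ (1 + 2 * δ) * σ ^ 2 := mul_nonneg (by linarith [R.δ_pos]) (sq_nonneg _)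
      linarith
    have hstep := M.offAxis_GHat R hv1 hyδ
    set y' := ‖offAxis (Z i) (GHat q v)‖ with hy'def
    have hy'0 : 0 ≤ y' := norm_nonneg _
    rw [← hydef, le_div_iff₀ (by norm_num)] at hstep
    have hyτ : y ≤ τ := by linarith [R.σ_le_τ]
    have hX := hsmall y hy0 hyτ
    have hX0 : 0 ≤ y ^ (2 * γ) / r := div_nonneg (Real.rpow_nonneg hy0 _) hr.le
    have hyX : y * (y ^ (2 * γ) / r) ≤ y * (1 / 16) := mul_le_mul_of_nonneg_left hX hy0
    have hy1 : y' ≤ 11 / 10 * σ := by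
      rcases le_total (y * (y ^ (2 * γ) / r)) e with h | h <;> linarith
    refine ⟨hy1, ?_⟩
    -- If `y ≤ 4e`, or if the contracted part is at most `e`, the new off-axis part is again at most
    -- `4e`. Otherwise the error is absorbed into the contracted part.
    rcases le_total y (4 * e) with hc | hc
    · left
      linarith
    · rcases le_total (y * (y ^ (2 * γ) / r)) e with h | h
      · left
        linarith
      · rcases ih2 with h4 | hY
        · left
          linarith
        · right
          -- With `Y = 8y^(2γ)/r` this reads `y' ≤ Y y`, hence `Y' ≤ Y^(1+2γ)`. The induction starts
          -- from `Y ≤ 1/2`, since `y ≤ τ`.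
          have hle : y' ≤ 8 / r * y ^ (2 * γ) * y := by
            have : 8 / r * y ^ (2 * γ) * y = 8 * (y * (y ^ (2 * γ) / r)) := by ring
            rw [this]
            linarith
          have hYn : 0 ≤ 8 / r * y ^ (2 * γ) := by positivity
          set Y := 8 / r * y ^ (2 * γ) with hYdef
          calc 8 / r * y' ^ (2 * γ) ≤ 8 / r * (Y * y) ^ (2 * γ) := by gcongr
            _ = Y * Y ^ (2 * γ) := by rw [Real.mul_rpow hYn hy0, hYdef]; ring
            _ ≤ 2 ^ (-(1 + 2 * γ) ^ n) * (2 ^ (-(1 + 2 * γ) ^ n)) ^ (2 * γ) := by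
                gcongr
            _ = 2 ^ (-(1 + 2 * γ) ^ (n + 1)) := by
                rw [← Real.rpow_mul (by norm_num), ← Real.rpow_add (by norm_num)]
                congr 1
                ring

/-- From a tame vector with a single big coordinate, a jump followed by enough iterations yields an
accurate approximation of the corresponding hidden basis element. -/
lemma accurate_of_single (M : IsGradientModel Z φ r γ δ e q) (R : Regime d m r γ δ ν τ κ σ e)
    {u x : E d} (hu : IsTame Z (σ * τ / 10) u) (hx : IsJump σ u x) {i : Fin m}
    (hi : bigSet Z (σ * τ / 10) u = {i}) {N N' : ℕ} (hN : N' ≤ N)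
    (hN' : 2 ^ (-(1 + 2 * γ) ^ N') ≤ 8 / r * (4 * e) ^ (2 * γ)) :
    ∃ s : ℝ, (s = 1 ∨ s = -1) ∧ ‖s • giLoop q (jumpMap u x) N - Z i‖ ≤ √2 * (4 * e) := by
  have hZi := M.orthonormal.1 i
  have hw := hx.norm_eq R.σ_pos hu.1
  have hσ := R.σ_pos
  have hγ := R.γ_pos
  have hr := R.r_pos
  have hy : ‖offAxis (Z i) (jumpMap u x)‖ ≤ 11 / 10 * σ := by
    obtain ⟨h1, h2⟩ := sin_div_bounds R.σ_pos R.σ_le_twelfth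
    rw [jumpMap, offAxis_add, offAxis_smul, offAxis_smul, hx.2, ← div_eq_mul_inv]
    refine (norm_add_le _ _).trans ?_
    rw [norm_smul, norm_smul, Real.norm_eq_abs, Real.norm_eq_abs, abs_of_nonneg (by linarith :
      0 ≤ Real.sin σ / σ)]
    have h3 := norm_offAxis_le hZi x
    rw [hx.2] at h3
    have h4 := mul_le_of_le_one_left (norm_nonneg (offAxis (Z i) u)) (Real.abs_cos_le_one σ)
    have h5 := mul_le_of_le_one_left (norm_nonneg (offAxis (Z i) x)) h2
    have h6 : ‖offAxis (Z i) u‖ ≤ σ / 10 := by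
      refine abs_le_of_sq_le_sq' ?_ (by positivity) |>.2
      have h7 := M.sum_bigSet_ge R hu (M.bigSet_nonempty R hu)
      rw [hi, Finset.sum_singleton] at h7
      rw [norm_sq_offAxis hZi, hu.1]
      linarith
    linarith
  have hfin : ‖offAxis (Z i) (giLoop q (jumpMap u x) N)‖ ≤ 4 * e := by
    rcases (M.offAxis_giLoop R hw hy N).2 with h | h
    · exact h
    · have h1 : (2 : ℝ) ^ (-(1 + 2 * γ) ^ N) ≤ 2 ^ (-(1 + 2 * γ) ^ N') := by
        refine Real.rpow_le_rpow_of_exponent_le (by norm_num) (neg_le_neg ?_)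
        exact pow_le_pow_right₀ (by linarith) hN
      have h2 := (h.trans h1).trans hN'
      have h3 := le_of_mul_le_mul_left h2 (by positivity)
      exact (Real.rpow_le_rpow_iff (norm_nonneg _) (by linarith [R.e_pos]) (by linarith)).1 h3
  obtain ⟨s, hs, hsle⟩ := exists_sign_norm_sub_le hZi (norm_giLoop (q := q) hw N)
  exact ⟨s, hs, hsle.trans (by gcongr)⟩

/-! ### Initialization -/

/-- If `x` is a maximal orthonormal family orthogonal to `k` good approximations of hidden basis
elements, then some member of it is correlated with a hidden basis element not yet found. -/
lemma exists_inner_sq_ge (hZ : Orthonormal ℝ Z) {k : ℕ} (hkm : k < m) {π : Fin k → Fin m}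
    (hπ : Function.Injective π) {μ : Fin k → E d} {s : Fin k → ℝ} {ε : ℝ}
    (hμ : ∀ l, ‖s l • μ l - Z (π l)‖ ≤ ε) {x : Fin (d - k) → E d} (hx : Orthonormal ℝ x)
    (hperp : ∀ l j, inner ℝ (μ l) (x j) = 0) :
    ∃ (i : Fin m) (j : Fin (d - k)), 1 - d * ε ^ 2 ≤ d * inner ℝ (x j) (Z i) ^ 2 := by
  classical
  have hmd : m ≤ d := by
    have := hZ.linearIndependent.fintype_card_le_finrank
    simpa using this
  have hperp' : ∀ l j, inner ℝ (x j) (μ l) = 0 := fun l j => by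
    rw [real_inner_comm, hperp l j]
  -- Completing `Z` to an orthonormal basis of the whole space turns the claim into a count of
  -- projected lengths.
  obtain ⟨b, hb⟩ := Orthonormal.exists_orthonormalBasis_extension_of_card_eq (𝕜 := ℝ) (E := E d)
    (ι := Fin d) (by simp) (v := fun a => if h : a.1 < m then Z ⟨a.1, h⟩ else 0)
    (s := {a | a.1 < m}) (by
      refine ⟨fun a => ?_, fun a a' haa => ?_⟩
      · change ‖(if h : a.1.1 < m then Z ⟨a.1.1, h⟩ else 0)‖ = 1
        rw [dif_pos (show a.1.1 < m from a.2), hZ.1]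
      · change inner ℝ (if h : a.1.1 < m then Z ⟨a.1.1, h⟩ else 0)
          (if h : a'.1.1 < m then Z ⟨a'.1.1, h⟩ else 0) = 0
        rw [dif_pos (show a.1.1 < m from a.2), dif_pos (show a'.1.1 < m from a'.2)]
        refine hZ.2 fun heq => haa ?_
        rw [Fin.mk.injEq] at heq
        exact Subtype.ext (Fin.ext heq))
  have hbZ : ∀ i : Fin m, b (Fin.castLE hmd i) = Z i := by
    intro i
    rw [hb _ (show (Fin.castLE hmd i).1 < m from i.2)]
    simp
  obtain ⟨i, hi⟩ : ∃ i, i ∉ Finset.univ.image π := by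
    by_contra! hcon
    have h1 : (Finset.univ : Finset (Fin m)) ⊆ Finset.univ.image π := fun i _ => hcon i
    have h2 := (Finset.card_le_card h1).trans Finset.card_image_le
    simp at h2
    omega
  -- `f a` is the squared length of the projection of `b a` onto the span of `x`; these add up to
  -- the dimension `d - k`.
  set f : Fin d → ℝ := fun a => ∑ j, inner ℝ (x j) (b a) ^ 2 with hf
  have hftot : ∑ a, f a = d - k := by
    rw [hf, Finset.sum_comm]
    have h1 : ∀ j, ∑ a, inner ℝ (x j) (b a) ^ 2 = 1 := by
      intro j
      have := b.sum_sq_norm_inner_left (x j)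
      rw [hx.1 j, one_pow] at this
      rw [← this]
      simp
    simp only [h1, Finset.sum_const, Finset.card_univ, Fintype.card_fin, nsmul_eq_mul, mul_one]
    rw [Nat.cast_sub (by omega)]
  have hbessel : ∀ z : E d, ∑ j, inner ℝ (x j) z ^ 2 ≤ ‖z‖ ^ 2 := by
    intro z
    have := hx.sum_inner_products_le z (s := Finset.univ)
    simpa using this
  have hf1 : ∀ a, f a ≤ 1 := by
    intro a
    have := hbessel (b a)
    rwa [b.orthonormal.1 a, one_pow] at this
  have hfπ : ∀ l, f (Fin.castLE hmd (π l)) ≤ ε ^ 2 := by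
    intro l
    have h1 : f (Fin.castLE hmd (π l)) = ∑ j, inner ℝ (x j) (s l • μ l - Z (π l)) ^ 2 := by
      rw [hf]
      refine Finset.sum_congr rfl fun j _ => ?_
      rw [hbZ, inner_sub_right, real_inner_smul_right, hperp' l j]
      ring
    rw [h1]
    exact (hbessel _).trans (pow_le_pow_left₀ (norm_nonneg _) (hμ l) 2)
  set T : Finset (Fin d) := Finset.univ.image fun l => Fin.castLE hmd (π l) with hT
  have hinj : Function.Injective fun l => Fin.castLE hmd (π l) :=
    (Fin.castLE_injective hmd).comp hπ
  have hTcard : T.card = k := by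
    rw [hT, Finset.card_image_of_injective _ hinj, Finset.card_univ, Fintype.card_fin]
  set a₀ := Fin.castLE hmd i with ha₀
  have ha₀T : a₀ ∉ T := by
    intro h
    rw [hT, Finset.mem_image] at h
    obtain ⟨l, -, hl⟩ := h
    exact hi (Finset.mem_image.2 ⟨l, Finset.mem_univ _, Fin.castLE_injective hmd hl⟩)
  -- The `k` found directions contribute at most `ε²` each and the other `d - k - 1` at most `1`
  -- each. The total `d - k` leaves at least `1 - kε²` for the new direction, which is then averaged
  -- over the at most `d` vectors `x j`.
  have hfa₀ : 1 - d * ε ^ 2 ≤ f a₀ := by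
    rw [← Finset.sum_add_sum_compl (insert a₀ T), Finset.sum_insert ha₀T] at hftot
    have h1 : ∑ a ∈ T, f a ≤ T.card • ε ^ 2 := by
      refine Finset.sum_le_card_nsmul _ _ _ fun a ha => ?_
      rw [hT, Finset.mem_image] at ha
      obtain ⟨l, -, rfl⟩ := ha
      exact hfπ l
    have h2 : ∑ a ∈ (insert a₀ T)ᶜ, f a ≤ (insert a₀ T)ᶜ.card • (1 : ℝ) :=
      Finset.sum_le_card_nsmul _ _ _ fun a _ => hf1 a
    have h3 : (insert a₀ T)ᶜ.card + (k + 1) = d := by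
      have := Finset.card_compl_add_card (insert a₀ T)
      rw [Finset.card_insert_of_notMem ha₀T, hTcard, Fintype.card_fin] at this
      exact this
    have h4 : ((insert a₀ T)ᶜ.card : ℝ) + (k + 1) = d := by exact_mod_cast h3
    rw [hTcard, nsmul_eq_mul] at h1
    rw [nsmul_eq_mul, mul_one] at h2
    have h5 : (k : ℝ) * ε ^ 2 ≤ d * ε ^ 2 := by
      have : (k : ℝ) ≤ d := by exact_mod_cast (by omega : k ≤ d)
      gcongr
    linarith
  refine ⟨i, ?_⟩
  by_contra! hcon
  have hne : (Finset.univ : Finset (Fin (d - k))).Nonempty :=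
    ⟨⟨0, by omega⟩, Finset.mem_univ _⟩
  have h1 := Finset.sum_lt_sum_of_nonempty hne fun j _ => hcon j
  rw [← Finset.mul_sum] at h1
  have h2 : ∑ j, inner ℝ (x j) (Z i) ^ 2 = f a₀ := by rw [hf, ha₀]; simp only [hbZ]
  rw [h2, Finset.sum_const, Finset.card_univ, Fintype.card_fin, nsmul_eq_mul] at h1
  have h3 : ((d - k : ℕ) : ℝ) ≤ d := by exact_mod_cast Nat.sub_le d k
  have h4 : 0 ≤ f a₀ := Finset.sum_nonneg fun j _ => sq_nonneg _
  rcases le_or_gt 0 (1 - d * ε ^ 2) with h5 | h5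
  · have h6 := mul_le_mul_of_nonneg_left hfa₀ (Nat.cast_nonneg (α := ℝ) d)
    have h7 : (0 : ℝ) < d - (d - k : ℕ) ∨ (d : ℝ) = (d - k : ℕ) := by
      rcases h3.lt_or_eq with h | h
      · left; linarith
      · right; exact h.symm
    rcases h7 with h7 | h7
    · nlinarith
    · rw [← h7] at h1
      linarith
  · have := hcon ⟨0, by omega⟩
    have h8 : 0 ≤ (d : ℝ) * inner ℝ (x ⟨0, by omega⟩) (Z i) ^ 2 := by positivity
    linarith

/-- The first iterate of a run started orthogonally to good approximations is tame, and its
coordinates along the hidden basis elements already found are tiny. -/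
lemma tame_init (M : IsGradientModel Z φ r γ δ e q) (R : Regime d m r γ δ ν τ κ σ e) {k : ℕ}
    (hkm : k < m) {π : Fin k → Fin m} (hπ : Function.Injective π) {μ : Fin k → E d}
    {s : Fin k → ℝ} (hμ : ∀ l, ‖s l • μ l - Z (π l)‖ ≤ √2 * (4 * e)) {x : Fin (d - k) → E d}
    (hx : Orthonormal ℝ x) (hperp : ∀ l j, inner ℝ (μ l) (x j) = 0) {j : Fin (d - k)}
    (hj : ∀ j', ‖q (x j')‖ ≤ ‖q (x j)‖) :
    IsTame Z (σ * τ / 10) (GHat q (x j)) ∧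
      ∀ l, |inner ℝ (GHat q (x j)) (Z (π l))| ≤ σ * τ / 10 := by
  have hδ := R.δ_pos
  have hd : (1 : ℝ) ≤ d := by exact_mod_cast R.one_le_d
  have hd0 : (0 : ℝ) < d := by linarith
  have hperp' : ∀ l j, inner ℝ (x j) (μ l) = 0 := fun l j => by
    rw [real_inner_comm, hperp l j]
  have he0 := R.e_pos
  have heσ : e ≤ σ / 20 := by
    have h1 := R.e_le
    have h2 := mul_le_mul_of_nonneg_left R.base_le_one R.θ_pos.le
    have h3 := R.θ_le_σ
    linarith
  have hsqrt2 : √2 ≤ 3 / 2 := Real.sqrt_le_iff.2 ⟨by norm_num, by norm_num⟩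
  have h6e : √2 * (4 * e) ≤ 6 * e := by nlinarith
  obtain ⟨i, j₀, hij⟩ := exists_inner_sq_ge M.orthonormal hkm hπ hμ hx hperp
  obtain ⟨p, hp0, hpk, hpq⟩ := M.approx (x j₀) (hx.1 j₀).le
  have hsq := M.sq_mem (hx.1 j₀).le i
  -- Some `x j₀` has a squared hidden coordinate of about `1/d`, so its gradient is of order
  -- `(1/d)^(1/2+δ) = B`.
  set B : ℝ := (√d * (d : ℝ) ^ δ)⁻¹ with hB
  have hBpos : 0 < B := by rw [hB]; positivity
  have heB : e ≤ σ * τ / 80 * B := by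
    have := R.e_le_dim
    rw [hB, ← div_eq_mul_inv, le_div_iff₀ (by positivity)]
    exact this
  have hpi : 19 / 20 * B ≤ |inner ℝ p (Z i)| := by
    refine abs_le_of_sq_le_sq' ?_ (abs_nonneg _) |>.2
    have h1 := (M.profile i).rpow_le hδ hsq.1 hsq.2
    have h3 : (inner ℝ (x j₀) (Z i) ^ 2) ^ (1 + 2 * δ) ≤ |inner ℝ p (Z i)| ^ 2 := by
      rw [hpk i, mul_pow, sq_abs, add_comm, Real.rpow_add_one' hsq.1 (by linarith), mul_comm,
        mul_comm 2 δ, Real.rpow_mul hsq.1, Real.rpow_two]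
      exact mul_le_mul_of_nonneg_left
        (pow_le_pow_left₀ (Real.rpow_nonneg hsq.1 δ) h1 2) hsq.1
    have h36 : d * (√2 * (4 * e)) ^ 2 ≤ 36 / 400 * (d * σ ^ 2) := by
      have : (√2 * (4 * e)) ^ 2 ≤ (6 * (σ / 20)) ^ 2 :=
        pow_le_pow_left₀ (by positivity) (by linarith) 2
      nlinarith
    have hσd := R.σ_sq_le
    have hdσ : 0 ≤ d * σ ^ 2 := by positivity
    have hdσδ : 0 ≤ d * σ ^ 2 * δ := by positivity
    have h2 := one_add_mul_self_le_rpow_one_add (s := -(d * (√2 * (4 * e)) ^ 2))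
      (by nlinarith) (p := 1 + 2 * δ) (by linarith)
    have h4 : 1 + -(d * (√2 * (4 * e)) ^ 2) ≤ d * inner ℝ (x j₀) (Z i) ^ 2 := by linarith
    have h5 := Real.rpow_le_rpow (by nlinarith) h4 (by linarith : 0 ≤ 1 + 2 * δ)
    rw [Real.mul_rpow hd0.le hsq.1] at h5
    have h7 : 361 / 400 ≤ (d : ℝ) ^ (1 + 2 * δ) * (inner ℝ (x j₀) (Z i) ^ 2) ^ (1 + 2 * δ) := by
      refine le_trans ?_ (h2.trans h5)
      have := mul_le_mul_of_nonneg_left h36 (by linarith : 0 ≤ 1 + 2 * δ)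
      linarith
    have h8 : B ^ 2 * (d : ℝ) ^ (1 + 2 * δ) = 1 := by
      rw [hB, inv_pow, mul_pow, Real.sq_sqrt hd0.le, Real.rpow_add hd0, Real.rpow_one,
        mul_comm 2 δ, Real.rpow_mul hd0.le, Real.rpow_two]
      exact inv_mul_cancel₀ (by positivity)
    calc (19 / 20 * B) ^ 2 = B ^ 2 * (361 / 400) := by ring
      _ ≤ B ^ 2 * ((d : ℝ) ^ (1 + 2 * δ) * (inner ℝ (x j₀) (Z i) ^ 2) ^ (1 + 2 * δ)) := by gcongr
      _ = (inner ℝ (x j₀) (Z i) ^ 2) ^ (1 + 2 * δ) := by rw [← mul_assoc, h8, one_mul]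
      _ ≤ _ := h3
  have hθσ := R.θ_le_σ
  have hq : 9 / 10 * B ≤ ‖q (x j)‖ := by
    refine le_trans ?_ (hj j₀)
    have h1 := abs_inner_le_norm M.orthonormal p i
    have h2 := norm_sub_norm_le p (q (x j₀))
    rw [norm_sub_rev] at h2
    have h3 : σ * τ / 80 * B ≤ 1 / 80 * B := by
      refine mul_le_mul_of_nonneg_right ?_ hBpos.le
      linarith [R.σ_le_twelfth]
    linarith
  obtain ⟨p', hp0', hpk', hpq'⟩ := M.approx (x j) (hx.1 j).le
  obtain ⟨hres, hcoord⟩ := M.GHat_bounds (by positivity) hp0' hpk' hpq' hq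
  have hθ := R.θ_pos
  have heB' : e / (9 / 10 * B) ≤ σ * τ / 10 := by
    rw [div_le_iff₀ (by positivity)]
    have := mul_pos hθ hBpos
    linarith
  refine ⟨⟨norm_GHat (hx.1 j), hres.trans (le_trans ?_ heB')⟩, fun l => (hcoord (π l)).trans ?_⟩
  · gcongr
    linarith
  · refine le_trans ?_ heB'
    gcongr
    -- `x j` is exactly orthogonal to `μ l`, so its component along a found basis vector is only the
    -- recovery error. Its contribution `6e/16` and the gradient error `e/2` together stay below
    -- `e`.
    have h1 : |inner ℝ (x j) (Z (π l))| ≤ 6 * e := by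
      have h2 : inner ℝ (x j) (Z (π l)) = - inner ℝ (x j) (s l • μ l - Z (π l)) := by
        rw [inner_sub_right, real_inner_smul_right, hperp' l j]
        ring
      rw [h2, abs_neg]
      refine (abs_real_inner_le_norm _ _).trans ?_
      rw [hx.1 j, one_mul]
      exact (hμ l).trans h6e
    set c := |inner ℝ (x j) (Z (π l))| with hc
    have hc0 : 0 ≤ c := abs_nonneg _
    have hcτ : c ≤ τ := by linarith [R.σ_le_τ, R.τ_pos]
    have hsq' := M.sq_mem (hx.1 j).le (π l)
    have h3 := (M.profile (π l)).le_rpow R.γ_pos hsq'.1 hsq'.2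
    have h4 : (inner ℝ (x j) (Z (π l)) ^ 2) ^ γ ≤ τ ^ (2 * γ) := by
      rw [Real.rpow_mul R.τ_pos.le, Real.rpow_two]
      refine Real.rpow_le_rpow hsq'.1 ?_ R.γ_pos.le
      rw [← sq_abs]
      exact pow_le_pow_left₀ hc0 hcτ 2
    rw [R.τ_pow] at h4
    have h5 : φ (π l) (inner ℝ (x j) (Z (π l)) ^ 2) ≤ 1 / 16 := by
      refine h3.trans ?_
      rw [div_le_iff₀ R.r_pos]
      have := mul_le_mul_of_nonneg_left R.base_le_one R.r_pos.le
      linarith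
    have h6 : c * φ (π l) (inner ℝ (x j) (Z (π l)) ^ 2) ≤ 6 * e * (1 / 16) :=
      mul_le_mul h1 h5 ((M.profile (π l)).nonneg hδ hsq'.1 hsq'.2) (by linarith)
    linarith

end IsGradientModel

/-! ### The uniform measure on a sphere -/

section Sphere

section

variable {V : Type*} [NormedAddCommGroup V] [InnerProductSpace ℝ V]

lemma exists_linearIsometryEquiv_map [FiniteDimensional ℝ V] {e f : V} (h : ‖e‖ = ‖f‖) : ∃ A : V ≃ₗᵢ[ℝ] V, A e = f :=
  ⟨_, Submodule.reflection_sub h⟩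

lemma abs_inner_le_one_of_norm {x e : V} (hx : ‖x‖ = 1) (he : ‖e‖ = 1) : |inner ℝ x e| ≤ 1 := by
  have := abs_real_inner_le_norm x e
  rwa [hx, he, mul_one] at this

lemma sum_inner_sq_basis {n : ℕ} (b : OrthonormalBasis (Fin n) ℝ V) {x : V} (hx : ‖x‖ = 1) :
    ∑ i, (inner ℝ x (b i) : ℝ) ^ 2 = 1 := by
  have := b.sum_sq_inner_left x
  rw [hx, one_pow] at this
  exact this

end

open scoped Pointwise

variable {V : Type*} [NormedAddCommGroup V] [InnerProductSpace ℝ V] [FiniteDimensional ℝ V]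
  [MeasurableSpace V] [BorelSpace V]

/-- A linear equivalence scales Haar measure by a constant. An isometry fixes the unit ball, which
has positive finite measure, so the constant is `1`. -/
lemma addHaar_preimage_linearIsometryEquiv (A : V ≃ₗᵢ[ℝ] V) (s : Set V) :
    (Measure.addHaar : Measure V) (A ⁻¹' s) = (Measure.addHaar : Measure V) s := by
  have key := Measure.addHaar_preimage_linearEquiv (Measure.addHaar : Measure V) A.toLinearEquiv
  have hc := key (ball 0 1)
  have hb : A.toLinearEquiv ⁻¹' (ball (0 : V) 1) = ball 0 1 := by
    ext x
    simp
  rw [hb] at hc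
  have h0 : (Measure.addHaar : Measure V) (ball 0 1) ≠ 0 := (measure_ball_pos _ _ one_pos).ne'
  have h1 : (Measure.addHaar : Measure V) (ball 0 1) ≠ ⊤ := measure_ball_lt_top.ne
  have h2 := key s
  have hone := (ENNReal.mul_left_inj h0 h1).1 ((one_mul _).trans hc)
  rw [← hone, one_mul] at h2
  exact h2

/-- Surface measure is the volume of the cone over a set, up to a fixed factor, and an isometry maps
cones to cones. -/
lemma toSphere_preimage_linearIsometryEquiv (A : V ≃ₗᵢ[ℝ] V) {s : Set V} (hs : MeasurableSet s) :
    (Measure.addHaar : Measure V).toSphere ((↑) ⁻¹' (A ⁻¹' s)) =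
      (Measure.addHaar : Measure V).toSphere ((↑) ⁻¹' s) := by
  have hA : MeasurableSet (A ⁻¹' s) := A.continuous.measurable hs
  rw [Measure.toSphere_apply' _ (measurable_subtype_coe hA),
    Measure.toSphere_apply' _ (measurable_subtype_coe hs)]
  refine congrArg _ (Eq.trans ?_ (addHaar_preimage_linearIsometryEquiv A _))
  congr 1
  ext x
  simp only [Subtype.image_preimage_coe, mem_smul, mem_preimage, mem_inter_iff]
  constructor
  · rintro ⟨c, hc, y, ⟨hy, hys⟩, rfl⟩
    exact ⟨c, hc, A y, ⟨by simpa using hy, hys⟩, (map_smul A c y).symm⟩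
  · rintro ⟨c, hc, y, ⟨hy, hys⟩, h⟩
    exact ⟨c, hc, A.symm y, ⟨by simpa using hy, by simpa using hys⟩, A.injective (by simpa using h)⟩

variable (V) in
/-- The uniform measure on the unit sphere, as a measure on the whole space. -/
def sphereMeasure : Measure V := (uniformSphere V).map (↑)

instance isProbabilityMeasure_uniformSphere [Nontrivial V] :
    IsProbabilityMeasure (uniformSphere V) := by
  refine ⟨?_⟩
  rw [uniformSphere, Measure.smul_apply, smul_eq_mul]
  refine ENNReal.inv_mul_cancel ?_ (measure_ne_top _ _)
  rw [Ne, Measure.measure_univ_eq_zero]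
  exact Measure.toSphere_ne_zero _

instance isProbabilityMeasure_sphereMeasure [Nontrivial V] :
    IsProbabilityMeasure (sphereMeasure V) :=
  Measure.isProbabilityMeasure_map measurable_subtype_coe.aemeasurable

lemma map_sphereMeasure (A : V ≃ₗᵢ[ℝ] V) : (sphereMeasure V).map A = sphereMeasure V := by
  ext s hs
  have hA : Measurable A := A.continuous.measurable
  rw [Measure.map_apply hA hs, sphereMeasure, Measure.map_apply measurable_subtype_coe hs,
    Measure.map_apply measurable_subtype_coe (hA hs), uniformSphere, Measure.smul_apply,
    Measure.smul_apply, toSphere_preimage_linearIsometryEquiv A hs]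

lemma integral_sphereMeasure_comp (A : V ≃ₗᵢ[ℝ] V) (f : V → ℝ) :
    ∫ x, f (A x) ∂(sphereMeasure V) = ∫ x, f x ∂(sphereMeasure V) := by
  conv_rhs => rw [← map_sphereMeasure A]
  exact (integral_map_equiv A.toHomeomorph.toMeasurableEquiv f).symm

lemma ae_sphereMeasure_norm : ∀ᵐ x ∂(sphereMeasure V), ‖x‖ = 1 := by
  rw [sphereMeasure, ae_map_iff measurable_subtype_coe.aemeasurable
    (measurableSet_eq_fun measurable_norm measurable_const)]
  exact Filter.Eventually.of_forall fun x => by simp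

lemma integrable_sphereMeasure [Nontrivial V] {f : V → ℝ} (hf : Continuous f) (C : ℝ)
    (hC : ∀ x, ‖x‖ = 1 → |f x| ≤ C) : Integrable f (sphereMeasure V) :=
  Integrable.of_bound hf.aestronglyMeasurable C (ae_sphereMeasure_norm.mono hC)

lemma integral_inner_comp_eq (φ : ℝ → ℝ) {e f : V} (h : ‖e‖ = ‖f‖) :
    ∫ x, φ (inner ℝ x e) ∂(sphereMeasure V) = ∫ x, φ (inner ℝ x f) ∂(sphereMeasure V) := by
  obtain ⟨A, hA⟩ := exists_linearIsometryEquiv_map h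
  rw [← integral_sphereMeasure_comp A (fun x => φ (inner ℝ x f))]
  simp_rw [← hA, A.inner_map_map]

/-- The second moment of a coordinate. -/
lemma integral_inner_sq [Nontrivial V] {e : V} (he : ‖e‖ = 1) :
    ∫ x, (inner ℝ x e : ℝ) ^ 2 ∂(sphereMeasure V) = 1 / Module.finrank ℝ V := by
  set b := stdOrthonormalBasis ℝ V
  have hint (i) : Integrable (fun x : V => (inner ℝ x (b i) : ℝ) ^ 2) (sphereMeasure V) := by
    refine integrable_sphereMeasure (by fun_prop) 1 fun x hx => ?_
    rw [abs_of_nonneg (sq_nonneg _), sq_le_one_iff_abs_le_one]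
    exact abs_inner_le_one_of_norm hx (b.orthonormal.1 i)
  have h1 : ∑ i, ∫ x, (inner ℝ x (b i) : ℝ) ^ 2 ∂(sphereMeasure V) = 1 := by
    rw [← integral_finsetSum _ fun i _ => hint i, integral_congr_ae (g := fun _ => (1 : ℝ))]
    · simp
    · exact ae_sphereMeasure_norm.mono fun x hx => sum_inner_sq_basis b hx
  have h2 (i) : ∫ x, (inner ℝ x (b i) : ℝ) ^ 2 ∂(sphereMeasure V) =
      ∫ x, (inner ℝ x e : ℝ) ^ 2 ∂(sphereMeasure V) :=
    integral_inner_comp_eq (· ^ 2) ((b.orthonormal.1 i).trans he.symm)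
  simp_rw [h2, Finset.sum_const, Finset.card_univ, Fintype.card_fin, nsmul_eq_mul] at h1
  have : (Module.finrank ℝ V : ℝ) ≠ 0 := by
    exact_mod_cast Module.finrank_pos.ne'
  field_simp
  linarith

/-- The fourth moment of a coordinate. -/
lemma integral_inner_pow_four_le [Nontrivial V] {e : V} (he : ‖e‖ = 1) :
    ∫ x, (inner ℝ x e : ℝ) ^ 4 ∂(sphereMeasure V) ≤ 3 / (Module.finrank ℝ V : ℝ) ^ 2 := by
  set b := stdOrthonormalBasis ℝ V
  set M := ∫ x, (inner ℝ x e : ℝ) ^ 4 ∂(sphereMeasure V) with hM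
  have hb (i) (x : V) (hx : ‖x‖ = 1) : |(inner ℝ x (b i) : ℝ)| ≤ 1 :=
    abs_inner_le_one_of_norm hx (b.orthonormal.1 i)
  have hb2 (i) (x : V) (hx : ‖x‖ = 1) : (inner ℝ x (b i) : ℝ) ^ 2 ≤ 1 :=
    (sq_le_one_iff_abs_le_one _).2 (hb i x hx)
  have hint (i j) : Integrable
      (fun x : V => (inner ℝ x (b i) : ℝ) ^ 2 * (inner ℝ x (b j) : ℝ) ^ 2) (sphereMeasure V) := by
    refine integrable_sphereMeasure (by fun_prop) 1 fun x hx => ?_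
    rw [abs_of_nonneg (by positivity)]
    exact mul_le_one₀ (hb2 i x hx) (sq_nonneg _) (hb2 j x hx)
  have hM4 {f : V} (hf : ‖f‖ = 1) : ∫ x, (inner ℝ x f : ℝ) ^ 4 ∂(sphereMeasure V) = M :=
    integral_inner_comp_eq (· ^ 4) (hf.trans he.symm)
  have hdiag (i) : ∫ x, (inner ℝ x (b i) : ℝ) ^ 2 * (inner ℝ x (b i) : ℝ) ^ 2
      ∂(sphereMeasure V) = M := by
    rw [← hM4 (b.orthonormal.1 i)]
    exact integral_congr_ae (Filter.Eventually.of_forall fun x => by simp only []; ring)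
  -- Rotation invariance by 45 degrees: both `(b i ± b j)/√2` have fourth moment `M`. Adding the two
  -- expansions gives `2M = M + 3E` for the mixed moment `E`.
  have hoff (i j) (hij : i ≠ j) : ∫ x, (inner ℝ x (b i) : ℝ) ^ 2 * (inner ℝ x (b j) : ℝ) ^ 2
      ∂(sphereMeasure V) = M / 3 := by
    have hin : inner ℝ (b i) (b j) = (0 : ℝ) := b.orthonormal.2 hij
    have hn (s : ℝ) (hs : s ^ 2 = 1) : ‖(√2)⁻¹ • (b i + s • b j)‖ = 1 := by
      have : ‖(√2)⁻¹ • (b i + s • b j)‖ ^ 2 = 1 := by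
        rw [norm_smul, mul_pow, norm_add_sq_real, real_inner_smul_right, hin, norm_smul,
          b.orthonormal.1 i, b.orthonormal.1 j, mul_one, Real.norm_eq_abs, Real.norm_eq_abs,
          sq_abs, sq_abs, hs, inv_pow, Real.sq_sqrt (by norm_num)]
        norm_num
      exact (pow_eq_one_iff_of_nonneg (norm_nonneg _) two_ne_zero).1 this
    have hex (s : ℝ) (x : V) : (inner ℝ x ((√2)⁻¹ • (b i + s • b j)) : ℝ) ^ 4 =
        (inner ℝ x (b i) + s * inner ℝ x (b j)) ^ 4 / 4 := by
      rw [real_inner_smul_right, inner_add_right, real_inner_smul_right, mul_pow, inv_pow]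
      have : √2 ^ 4 = 4 := by
        rw [show √2 ^ 4 = (√2 ^ 2) ^ 2 by ring, Real.sq_sqrt (by norm_num)]
        norm_num
      rw [this]
      ring
    have hI (s : ℝ) (hs : s ^ 2 = 1) : Integrable
        (fun x : V => (inner ℝ x (b i) + s * inner ℝ x (b j) : ℝ) ^ 4 / 4) (sphereMeasure V) := by
      simp_rw [← hex]
      refine integrable_sphereMeasure (by fun_prop) 1 fun x hx => ?_
      rw [abs_pow]
      exact pow_le_one₀ (abs_nonneg _) (abs_inner_le_one_of_norm hx (hn s hs))
    have hp := hM4 (hn 1 (by norm_num))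
    have hm := hM4 (hn (-1) (by norm_num))
    simp_rw [hex] at hp hm
    have hs := integral_add (hI 1 (by norm_num)) (hI (-1) (by norm_num))
    rw [hp, hm] at hs
    have he' : ∀ x : V, (inner ℝ x (b i) + 1 * inner ℝ x (b j) : ℝ) ^ 4 / 4 +
        (inner ℝ x (b i) + -1 * inner ℝ x (b j) : ℝ) ^ 4 / 4 =
        1 / 2 * ((inner ℝ x (b i) : ℝ) ^ 2 * (inner ℝ x (b i) : ℝ) ^ 2) +
        1 / 2 * ((inner ℝ x (b j) : ℝ) ^ 2 * (inner ℝ x (b j) : ℝ) ^ 2) +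
        3 * ((inner ℝ x (b i) : ℝ) ^ 2 * (inner ℝ x (b j) : ℝ) ^ 2) := fun x => by ring
    simp_rw [he'] at hs
    have hij2 : Integrable (fun x : V =>
        1 / 2 * ((inner ℝ x (b i) : ℝ) ^ 2 * (inner ℝ x (b i) : ℝ) ^ 2) +
        1 / 2 * ((inner ℝ x (b j) : ℝ) ^ 2 * (inner ℝ x (b j) : ℝ) ^ 2)) (sphereMeasure V) :=
      ((hint i i).const_mul _).add ((hint j j).const_mul _)
    rw [integral_add hij2 ((hint i j).const_mul _), integral_add ((hint i i).const_mul _) ((hint j j).const_mul _),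
      integral_const_mul, integral_const_mul, integral_const_mul, hdiag, hdiag] at hs
    linarith
  obtain ⟨n, hn⟩ : ∃ n : ℝ, n = Module.finrank ℝ V := ⟨_, rfl⟩
  have hn1 : (1 : ℝ) ≤ n := by rw [hn]; exact_mod_cast Module.finrank_pos
  have h1 : ∑ i, ∑ j, ∫ x, (inner ℝ x (b i) : ℝ) ^ 2 * (inner ℝ x (b j) : ℝ) ^ 2
      ∂(sphereMeasure V) = 1 := by
    rw [Finset.sum_congr rfl fun i _ => (integral_finsetSum _ fun j _ => hint i j).symm,
      ← integral_finsetSum _ fun i _ => integrable_finsetSum _ fun j _ => hint i j,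
      integral_congr_ae (g := fun _ => (1 : ℝ))]
    · simp
    · refine ae_sphereMeasure_norm.mono fun x hx => ?_
      simp only [← Finset.mul_sum, sum_inner_sq_basis b hx, mul_one]
  have h2 : ∀ i j, ∫ x, (inner ℝ x (b i) : ℝ) ^ 2 * (inner ℝ x (b j) : ℝ) ^ 2
      ∂(sphereMeasure V) = M / 3 + if i = j then 2 * M / 3 else 0 := by
    intro i j
    split_ifs with h
    · rw [h, hdiag]; ring
    · rw [hoff i j h, add_zero]
  -- Integrating `(∑ xᵢ²)² = 1` over the sphere yields `n²M/3 + 2nM/3 = 1`, that is `M =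
  -- 3/(n(n+2))`.
  simp_rw [h2, Finset.sum_add_distrib, Finset.sum_ite_eq, Finset.mem_univ, if_true,
    Finset.sum_const, Finset.card_univ, Fintype.card_fin, nsmul_eq_mul, ← hn] at h1
  rw [← hn]
  have hM0 : 0 ≤ M := integral_nonneg fun x => by positivity
  rw [le_div_iff₀ (by positivity)]
  nlinarith [mul_nonneg hM0 (by linarith : (0 : ℝ) ≤ n)]

/-- A coordinate is of the typical size with probability bounded from below. -/
lemma sphereMeasure_coord_ge [Nontrivial V] {e : V} (he : ‖e‖ = 1) :
    (1 / 24 : ℝ) ≤ (sphereMeasure V).real {x | 1 / √(2 * Module.finrank ℝ V) ≤ inner ℝ x e} := by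
  set n := Module.finrank ℝ V with hn
  have hn1 : (1 : ℝ) ≤ n := by exact_mod_cast Module.finrank_pos
  set a := 1 / √(2 * n : ℝ) with ha
  have ha0 : 0 ≤ a := by positivity
  have ha2 : a ^ 2 = 1 / (2 * n) := by
    rw [ha, div_pow, Real.sq_sqrt (by positivity), one_pow]
  set A := {x : V | a ≤ inner ℝ x e} with hA
  set A' := {x : V | a ≤ inner ℝ x (-e)} with hA'
  have hAm : MeasurableSet A := by
    exact measurableSet_le measurable_const (by fun_prop)
  have hAm' : MeasurableSet A' := measurableSet_le measurable_const (by fun_prop)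
  have hsymm : (sphereMeasure V).real A' = (sphereMeasure V).real A := by
    have h := integral_inner_comp_eq ((Ici a).indicator 1) (e := -e) (f := e) (norm_neg e)
    have h1 : ∀ f : V, (fun x : V => (Ici a).indicator (1 : ℝ → ℝ) (inner ℝ x f)) =
        {x : V | a ≤ inner ℝ x f}.indicator 1 := fun f => rfl
    rw [h1, h1, integral_indicator_one hAm, integral_indicator_one hAm'] at h
    exact h
  have hint2 : Integrable (fun x : V => (inner ℝ x e : ℝ) ^ 2) (sphereMeasure V) := by
    refine integrable_sphereMeasure (by fun_prop) 1 fun x hx => ?_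
    rw [abs_pow]
    exact pow_le_one₀ (abs_nonneg _) (abs_inner_le_one_of_norm hx he)
  have hint4 : Integrable (fun x : V => (inner ℝ x e : ℝ) ^ 4) (sphereMeasure V) := by
    refine integrable_sphereMeasure (by fun_prop) 1 fun x hx => ?_
    rw [abs_pow]
    exact pow_le_one₀ (abs_nonneg _) (abs_inner_le_one_of_norm hx he)
  have hI : Integrable (A.indicator (1 : V → ℝ)) (sphereMeasure V) :=
    (integrable_const (1 : ℝ)).indicator hAm
  have hI' : Integrable (A'.indicator (1 : V → ℝ)) (sphereMeasure V) :=
    (integrable_const (1 : ℝ)).indicator hAm'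
  -- Pointwise form of a Paley–Zygmund argument: off the two caps the square is below `1/(2n)`, and
  -- on them AM–GM gives `X² ≤ 3/n + (n/12)X⁴`. Integrating gives `1/n ≤ (3/4 + 6Q)/n`, hence `Q ≥
  -- 1/24`.
  have hpt (x : V) : (inner ℝ x e : ℝ) ^ 2 ≤ 1 / (2 * n) +
      (3 / n * A.indicator (1 : V → ℝ) x + 3 / n * A'.indicator (1 : V → ℝ) x +
        n / 12 * (inner ℝ x e : ℝ) ^ 4) := by
    have hi0 : 0 ≤ A.indicator (1 : V → ℝ) x := indicator_nonneg (fun _ _ => zero_le_one) x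
    have hi0' : 0 ≤ A'.indicator (1 : V → ℝ) x := indicator_nonneg (fun _ _ => zero_le_one) x
    have h4 : (0 : ℝ) ≤ n / 12 * (inner ℝ x e : ℝ) ^ 4 := by positivity
    by_cases hx : |inner ℝ x e| < a
    · have : (inner ℝ x e : ℝ) ^ 2 ≤ a ^ 2 := sq_le_sq' (by linarith [abs_lt.1 hx])
        (abs_lt.1 hx).2.le
      rw [ha2] at this
      have h5 : (0 : ℝ) ≤ 3 / n := by positivity
      nlinarith [mul_nonneg h5 hi0, mul_nonneg h5 hi0']
    · have h1 : 1 ≤ A.indicator (1 : V → ℝ) x + A'.indicator (1 : V → ℝ) x := by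
        rcases le_abs.1 (not_lt.1 hx) with h | h
        · have : x ∈ A := h
          rw [indicator_of_mem this]
          simpa using hi0'
        · have : x ∈ A' := by simpa [hA', inner_neg_right] using h
          rw [indicator_of_mem this]
          simpa using hi0
      have h2 : (inner ℝ x e : ℝ) ^ 2 ≤ 3 / n + n / 12 * (inner ℝ x e : ℝ) ^ 4 := by
        have h3 : (0 : ℝ) ≤ n / 12 * ((inner ℝ x e : ℝ) ^ 2 - 6 / n) ^ 2 := by positivity
        have h6 : (n : ℝ) / 12 * ((inner ℝ x e : ℝ) ^ 2 - 6 / n) ^ 2 =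
          n / 12 * (inner ℝ x e : ℝ) ^ 4 - (inner ℝ x e : ℝ) ^ 2 + 3 / n := by
          field_simp
          ring
        linarith
      have h5 : (0 : ℝ) ≤ 3 / n := by positivity
      have h7 : (0 : ℝ) ≤ 1 / (2 * n) := by positivity
      nlinarith [mul_le_mul_of_nonneg_left h1 h5]
  have hmono := integral_mono hint2 ((integrable_const _).add
    (((hI.const_mul _).add (hI'.const_mul _)).add (hint4.const_mul _))) hpt
  have e1 : ∫ x, (1 / (2 * n) + (3 / n * A.indicator (1 : V → ℝ) x +
      3 / n * A'.indicator (1 : V → ℝ) x + n / 12 * (inner ℝ x e : ℝ) ^ 4)) ∂(sphereMeasure V) =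
      1 / (2 * n) + (3 / n * (sphereMeasure V).real A + 3 / n * (sphereMeasure V).real A +
        n / 12 * ∫ x, (inner ℝ x e : ℝ) ^ 4 ∂(sphereMeasure V)) := by
    have i2 : Integrable (fun x => 3 / n * A.indicator (1 : V → ℝ) x +
        3 / n * A'.indicator (1 : V → ℝ) x) (sphereMeasure V) :=
      (hI.const_mul _).add (hI'.const_mul _)
    have i3 : Integrable (fun x => 3 / n * A.indicator (1 : V → ℝ) x +
        3 / n * A'.indicator (1 : V → ℝ) x + n / 12 * (inner ℝ x e : ℝ) ^ 4) (sphereMeasure V) :=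
      i2.add (hint4.const_mul _)
    rw [integral_add (integrable_const _) i3, integral_add i2 (hint4.const_mul _),
      integral_add (hI.const_mul _) (hI'.const_mul _), integral_const_mul, integral_const_mul,
      integral_const_mul, integral_indicator_one hAm, integral_indicator_one hAm', hsymm,
      integral_const, probReal_univ, one_smul]
  have hmono' := hmono.trans_eq e1
  rw [integral_inner_sq he] at hmono'
  have h4 := mul_le_mul_of_nonneg_left (integral_inner_pow_four_le he)
    (by positivity : (0 : ℝ) ≤ n / 12)
  have h5 : (n : ℝ) / 12 * (3 / (n : ℝ) ^ 2) = 1 / (4 * n) := by field_simp; norm_num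
  rw [← hn, h5] at h4
  set Q := (sphereMeasure V).real A
  have h6 : (1 : ℝ) / n ≤ 1 / (2 * n) + (3 / n * Q + 3 / n * Q + 1 / (4 * n)) := by
    rw [← hn] at hmono'
    linarith
  have h7 : (1 : ℝ) / (2 * n) + (3 / n * Q + 3 / n * Q + 1 / (4 * n)) = (3 / 4 + 6 * Q) / n := by
    field_simp
    ring
  rw [h7, div_le_div_iff_of_pos_right (by linarith)] at h6
  linarith

end Sphere

/-! ### Uniform tangent vectors -/

lemma finrank_orthogonal_span {u : E d} (hu : ‖u‖ = 1) :
    Module.finrank ℝ ((ℝ ∙ u)ᗮ : Submodule ℝ (E d)) + 1 = d := by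
  have h := Submodule.finrank_add_finrank_orthogonal (ℝ ∙ u : Submodule ℝ (E d))
  have hu0 : u ≠ 0 := by rintro rfl; simp at hu
  rw [finrank_span_singleton hu0, finrank_euclideanSpace, Fintype.card_fin] at h
  omega

lemma nontrivial_orthogonal_span (hd : 2 ≤ d) {u : E d} (hu : ‖u‖ = 1) :
    Nontrivial ((ℝ ∙ u)ᗮ : Submodule ℝ (E d)) := by
  refine Module.nontrivial_of_finrank_pos (R := ℝ) ?_
  have := finrank_orthogonal_span hu
  omega

lemma uniformTangent_apply (σ : ℝ) (u : E d) {S : Set (E d)} (hS : MeasurableSet S) :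
    uniformTangent σ u S =
      sphereMeasure ((ℝ ∙ u)ᗮ : Submodule ℝ (E d)) {v | σ • (v : E d) ∈ S} := by
  have h1 : Measurable fun v : ((ℝ ∙ u)ᗮ : Submodule ℝ (E d)) => σ • (v : E d) :=
    measurable_subtype_coe.const_smul σ
  have h2 : Measurable fun v : sphere (0 : ((ℝ ∙ u)ᗮ : Submodule ℝ (E d))) 1 => σ • (v.1 : E d) :=
    h1.comp measurable_subtype_coe
  rw [uniformTangent, Measure.map_apply h2 hS]
  exact (Measure.map_apply measurable_subtype_coe (h1 hS)).symm

lemma uniformTangent_eq_zero (σ : ℝ) {u : E d} {S : Set (E d)}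
    (hS : MeasurableSet S) (hout : ∀ x ∈ S, ‖x‖ = |σ| → inner ℝ u x = (0 : ℝ) → False) :
    uniformTangent σ u S = 0 := by
  rw [uniformTangent_apply σ u hS]
  refine measure_eq_zero_iff_ae_notMem.2 (ae_sphereMeasure_norm.mono fun v hv hvS => ?_)
  refine hout _ hvS ?_ ?_
  · rw [norm_smul, Real.norm_eq_abs, Submodule.norm_coe, hv, mul_one]
  · rw [real_inner_smul_right, Submodule.mem_orthogonal_singleton_iff_inner_right.1 v.2, mul_zero]

/-- The projection of `z` to `u^⊥` has length at least `ρ`, so the coordinate estimate on the sphere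
of `u^⊥`, of dimension `d - 1 ≤ d`, applies in that direction. -/
lemma uniformTangent_coord_ge (hd : 2 ≤ d) {σ ρ : ℝ} (hσ : 0 ≤ σ) (hρ : 0 < ρ) {u z : E d}
    (hu : ‖u‖ = 1) (hz : ‖z‖ = 1) (huz : (inner ℝ u z : ℝ) ^ 2 ≤ 1 - ρ ^ 2) :
    ENNReal.ofReal (1 / 24) ≤ uniformTangent σ u {x | σ * ρ / √(2 * d) ≤ inner ℝ x z} := by
  have := nontrivial_orthogonal_span hd hu
  set W := ((ℝ ∙ u)ᗮ : Submodule ℝ (E d))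
  have hmem : z - inner ℝ u z • u ∈ W := by
    rw [Submodule.mem_orthogonal_singleton_iff_inner_right, inner_sub_right,
      real_inner_smul_right, real_inner_self_eq_norm_sq, hu]
    ring
  set y : W := ⟨_, hmem⟩ with hy
  have hyn : ρ ≤ ‖y‖ := by
    refine abs_le_of_sq_le_sq' ?_ (norm_nonneg _) |>.2
    rw [hy, Submodule.coe_norm, norm_sub_sq_real, real_inner_smul_right, norm_smul, hu, hz,
      mul_one, Real.norm_eq_abs, sq_abs, real_inner_comm]
    rw [real_inner_comm] at huz
    nlinarith
  have hy0 : 0 < ‖y‖ := hρ.trans_le hyn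
  set e : W := ‖y‖⁻¹ • y with he
  have he1 : ‖e‖ = 1 := by
    rw [he, norm_smul, norm_inv, norm_norm, inv_mul_cancel₀ hy0.ne']
  have hS : MeasurableSet {x : E d | σ * ρ / √(2 * d) ≤ inner ℝ x z} :=
    measurableSet_le measurable_const (by fun_prop)
  rw [uniformTangent_apply σ u hS]
  have hfin := finrank_orthogonal_span hu
  refine (ENNReal.ofReal_le_ofReal (sphereMeasure_coord_ge he1)).trans ?_
  rw [ofReal_measureReal]
  refine measure_mono fun v hv => ?_
  have hv' : 1 / √(2 * Module.finrank ℝ W) ≤ inner ℝ v e := hv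
  have hn1 : (1 : ℝ) ≤ Module.finrank ℝ W := by exact_mod_cast Module.finrank_pos
  have hnd : (Module.finrank ℝ W : ℝ) ≤ d := by
    exact_mod_cast (by omega : Module.finrank ℝ ((ℝ ∙ u)ᗮ : Submodule ℝ (E d)) ≤ d)
  have h1 : 1 / √(2 * d) ≤ 1 / √(2 * Module.finrank ℝ W) :=
    one_div_le_one_div_of_le (by positivity) (Real.sqrt_le_sqrt (by linarith))
  have h2 : (inner ℝ (v : E d) z : ℝ) = inner ℝ v y := by
    rw [hy, Submodule.coe_inner, inner_sub_right, real_inner_smul_right,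
      Submodule.mem_orthogonal_singleton_iff_inner_left.1 v.2, mul_zero, sub_zero]
  have h3 : (inner ℝ v y : ℝ) = ‖y‖ * inner ℝ v e := by
    rw [he, real_inner_smul_right, mul_inv_cancel_left₀ hy0.ne']
  change σ * ρ / √(2 * d) ≤ inner ℝ (σ • (v : E d)) z
  rw [real_inner_smul_left, h2, h3, mul_div_assoc]
  refine mul_le_mul_of_nonneg_left ?_ hσ
  calc ρ / √(2 * d) = ρ * (1 / √(2 * d)) := by ring
    _ ≤ ‖y‖ * inner ℝ v e := mul_le_mul hyn (h1.trans hv') (by positivity) hy0.le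

/-! ### Measurability of the iteration -/

lemma measurable_GHat {q : E d → E d} (hq : Measurable q) : Measurable (GHat q) := by
  classical
  unfold GHat
  exact Measurable.ite (hq (measurableSet_singleton 0)) measurable_id (hq.norm.inv.smul hq)

lemma measurable_giLoop {q : E d → E d} (hq : Measurable q) (N : ℕ) {α : Type*}
    {_ : MeasurableSpace α} {f : α → E d} (hf : Measurable f) : Measurable fun a => giLoop q (f a) N :=
  ((measurable_GHat hq).iterate N).comp hf

lemma measurable_jumpMap {α : Type*} {_ : MeasurableSpace α} {f g : α → E d} (hf : Measurable f)
    (hg : Measurable g) : Measurable fun a => jumpMap (f a) (g a) := by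
  unfold jumpMap
  fun_prop

lemma measurableSet_filter_eq {α ι : Type*} [MeasurableSpace α] [Fintype ι] {p : ι → α → Prop}
    [∀ a, DecidablePred fun i => p i a] (hp : ∀ i, MeasurableSet {a | p i a}) (L : Finset ι) :
    MeasurableSet {a | (Finset.univ.filter fun i => p i a) = L} := by
  have : {a | (Finset.univ.filter fun i => p i a) = L} = ⋂ i, {a | p i a ↔ i ∈ L} := by
    ext a
    simp [Finset.ext_iff]
  rw [this]
  refine MeasurableSet.iInter fun i => ?_
  by_cases hi : i ∈ L
  · simpa only [hi, iff_true] using hp i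
  · simp only [hi, iff_false]
    exact (hp i).compl

lemma measurableSet_isTame (Z : Fin m → E d) (θ : ℝ) : MeasurableSet {u | IsTame Z θ u} := by
  have h : Measurable fun u : E d => ‖resid Z u‖ := by
    unfold resid
    fun_prop
  exact (measurableSet_eq_fun measurable_norm measurable_const).inter
    (measurableSet_le h measurable_const)

lemma measurableSet_bigSet_eq (Z : Fin m → E d) (θ : ℝ) (L : Finset (Fin m)) :
    MeasurableSet {u | bigSet Z θ u = L} :=
  measurableSet_filter_eq (fun _ => measurableSet_lt measurable_const (by fun_prop)) L

/-! ### A single execution of the inner algorithm -/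

/-- After `N` steps following a well-aligned jump, some big coordinate is lost. -/
def LosesBig (Z : Fin m → E d) (q : E d → E d) (σ τ ν : ℝ) (N : ℕ) : Prop :=
  ∀ L : Finset (Fin m), 2 ≤ L.card →
    ∃ t : Fin m → ℝ, ∀ u, IsTame Z (σ * τ / 10) u → bigSet Z (σ * τ / 10) u = L →
      (∀ i ∈ L, ∀ s : ℝ, (s = 1 ∨ s = -1) → t i ≤ inner ℝ u (Z i) ^ 2 →
        0 ≤ s * inner ℝ u (Z i) → ∀ x, IsJump σ u x → σ * ν / (2 * √d) ≤ s * inner ℝ x (Z i) →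
        bigSet Z (σ * τ / 10) (giLoop q (jumpMap u x) N) ⊂ L) ∧
      ((¬ ∃ i ∈ L, t i ≤ inner ℝ u (Z i) ^ 2 ∧ inner ℝ u (Z i) ^ 2 ≤ 1 - ν ^ 2 / 2) →
        ∀ x, IsJump σ u x → bigSet Z (σ * τ / 10) (giLoop q (jumpMap u x) N) ⊂ L)

/-- A potential that halves at least whenever a big coordinate is lost. -/
def potential (Z : Fin m → E d) (θ : ℝ) (u : E d) : ENNReal :=
  if 2 ≤ (bigSet Z θ u).card then 2 ^ (bigSet Z θ u).card else 0

lemma potential_le_of_subset {Z : Fin m → E d} {θ : ℝ} {u v : E d}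
    (h : bigSet Z θ v ⊆ bigSet Z θ u) : potential Z θ v ≤ potential Z θ u := by
  have hc := Finset.card_le_card h
  unfold potential
  split_ifs with h1 h2
  · exact pow_le_pow_right₀ one_le_two hc
  · omega
  · exact zero_le
  · exact le_rfl

lemma potential_le_half {Z : Fin m → E d} {θ : ℝ} {u v : E d} (hu : 2 ≤ (bigSet Z θ u).card)
    (h : bigSet Z θ v ⊂ bigSet Z θ u) : potential Z θ v ≤ 2 ^ ((bigSet Z θ u).card - 1) := by
  have hc := Finset.card_lt_card h
  unfold potential
  split_ifs with h1
  · exact pow_le_pow_right₀ one_le_two (by omega)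
  · exact zero_le

lemma measurable_potential (Z : Fin m → E d) (θ : ℝ) : Measurable (potential Z θ) := by
  have h : potential Z θ = fun u => ∑ L : Finset (Fin m),
      {u | bigSet Z θ u = L}.indicator (fun _ => if 2 ≤ L.card then 2 ^ L.card else 0) u := by
    funext u
    rw [Finset.sum_eq_single (bigSet Z θ u)]
    · exact (indicator_of_mem (s := {v | bigSet Z θ v = bigSet Z θ u}) (a := u) rfl
        fun _ => if 2 ≤ (bigSet Z θ u).card then (2 : ENNReal) ^ (bigSet Z θ u).card else 0).symm
    · intro L _ hL
      refine indicator_of_notMem (s := {v | bigSet Z θ v = L}) (fun h => hL (Eq.symm h)) _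
    · simp
  rw [h]
  exact Finset.measurable_sum _ fun L _ =>
    measurable_const.indicator (measurableSet_bigSet_eq Z θ L)

namespace FindBasisElementRun

variable {Ω : Type*} [mΩ : MeasurableSpace Ω] {P : Measure Ω} {q : E d → E d} {σ : ℝ}
  {N₁ N₂ I k : ℕ} {μ : Fin k → Ω → E d} {ℱ : ℕ → MeasurableSpace Ω} {out : Ω → E d}

/-- The iteration only depends on the direction of the gradient estimate. -/
def rescale {g : E d → E d} {c : ℝ}
    (X : FindBasisElementRun P g σ N₁ N₂ I μ ℱ out) (hG : GHat (c • g) = GHat g) :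
    FindBasisElementRun P (c • g) σ N₁ N₂ I μ ℱ out where
  x := X.x
  measurable_x := X.measurable_x
  x_orthonormal := X.x_orthonormal
  x_perp := X.x_perp
  j := X.j
  measurable_j := X.measurable_j
  j_max ω i := by
    simp only [Pi.smul_apply, norm_smul]
    exact mul_le_mul_of_nonneg_left (X.j_max ω i) (norm_nonneg c)
  u := X.u
  jump := X.jump
  u_zero ω := by rw [hG, X.u_zero, giLoop, giLoop, hG]
  measurable_jump := X.measurable_jump
  jump_law := X.jump_law
  u_succ t ht ω := by rw [X.u_succ t ht, giLoop, giLoop, hG]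
  out_eq := X.out_eq

variable (X : FindBasisElementRun P q σ N₁ N₂ I μ ℱ out)

lemma measurable_u (hq : Measurable q) (hmono : ∀ t, ℱ t ≤ ℱ (t + 1)) :
    ∀ t ≤ I, Measurable[ℱ t] (X.u t) := by
  intro t
  induction t with
  | zero =>
    intro _
    have h1 : X.u 0 = fun ω => ∑ i, if X.j ω = i then
        giLoop q (GHat q (X.x ω i)) N₁ else 0 := by
      funext ω
      rw [X.u_zero]
      simp
    rw [h1]
    refine Finset.measurable_sum _ fun i _ => Measurable.ite ?_ ?_ measurable_const
    · exact X.measurable_j (measurableSet_singleton i)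
    · exact measurable_giLoop hq N₁ ((measurable_GHat hq).comp (X.measurable_x i))
  | succ t ih =>
    intro ht
    have h1 : X.u (t + 1) = fun ω => giLoop q (jumpMap (X.u t ω) (X.jump t ω)) N₂ := by
      funext ω
      exact X.u_succ t (by omega) ω
    rw [h1]
    have h2 : Measurable[ℱ (t + 1)] (X.u t) := (ih (by omega)).mono (hmono t) le_rfl
    exact measurable_giLoop hq N₂ (measurable_jumpMap h2 (X.measurable_jump t (by omega)))

/-- The law of the jump is given only for fixed events and fixed target sets, whereas orthogonality
couples the jump with the random `u t`. So `u t` is approximated by a dense sequence: near `c l` the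
jump is almost orthogonal to `c l`, almost surely, and countably many such statements combine. -/
lemma ae_isJump (hq : Measurable q) (hle : ∀ t, ℱ t ≤ mΩ) (hmono : ∀ t, ℱ t ≤ ℱ (t + 1)) (hσ : 0 < σ) {t : ℕ}
    (ht : t < I) : ∀ᵐ ω ∂P, IsJump σ (X.u t ω) (X.jump t ω) := by
  have hu := X.measurable_u hq hmono t ht.le
  have key (A : Set Ω) (hA : MeasurableSet[ℱ t] A) (S : Set (E d)) (hS : MeasurableSet S)
      (h : ∀ ω ∈ A, ∀ x ∈ S, ‖x‖ = |σ| → inner ℝ (X.u t ω) x = (0 : ℝ) → False) :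
      ∀ᵐ ω ∂P, ω ∈ A → X.jump t ω ∉ S := by
    have h0 : P (A ∩ X.jump t ⁻¹' S) = 0 := by
      rw [X.jump_law t ht A hA S hS]
      exact setLIntegral_eq_zero (hle t A hA) fun ω hω => uniformTangent_eq_zero σ hS (h ω hω)
    rw [measure_eq_zero_iff_ae_notMem] at h0
    exact h0.mono fun ω hω hωA hωS => hω ⟨hωA, hωS⟩
  obtain ⟨c, hc⟩ := TopologicalSpace.exists_dense_seq (E d)
  have h1 : ∀ᵐ ω ∂P, ‖X.jump t ω‖ = σ := by
    have := key univ MeasurableSet.univ {x | ‖x‖ ≠ σ}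
      (measurableSet_eq_fun measurable_norm measurable_const).compl
      fun ω _ x hx hxσ _ => hx (by rw [hxσ, abs_of_pos hσ])
    exact this.mono fun ω hω => not_not.1 (hω trivial)
  have h2 : ∀ᵐ ω ∂P, ∀ n l : ℕ, ω ∈ {ω | ‖X.u t ω - c l‖ < 1 / ((n : ℝ) + 1)} →
      |(inner ℝ (c l) (X.jump t ω) : ℝ)| ≤ σ * (1 / ((n : ℝ) + 1)) := by
    rw [ae_all_iff]
    intro n
    rw [ae_all_iff]
    intro l
    have hm : MeasurableSet[ℱ t] {ω | ‖X.u t ω - c l‖ < 1 / ((n : ℝ) + 1)} := by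
      have : MeasurableSet {v : E d | ‖v - c l‖ < 1 / ((n : ℝ) + 1)} :=
        measurableSet_lt (measurable_id.sub_const _).norm measurable_const
      exact hu this
    have hf : Measurable fun x : E d => |(inner ℝ (c l) x : ℝ)| :=
      (measurable_const.inner measurable_id).abs
    have := key _ hm {x | ¬ |(inner ℝ (c l) x : ℝ)| ≤ σ * (1 / ((n : ℝ) + 1))}
      (measurableSet_le hf measurable_const).compl ?_
    · exact this.mono fun ω hω h => not_not.1 (hω h)
    · intro ω hω x hx hxσ hin
      refine hx ?_
      have h3 : (inner ℝ (c l) x : ℝ) = inner ℝ (c l - X.u t ω) x := by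
        rw [inner_sub_left, hin, sub_zero]
      rw [h3]
      refine (abs_real_inner_le_norm _ _).trans ?_
      rw [hxσ, abs_of_pos hσ, mul_comm, norm_sub_rev]
      exact mul_le_mul_of_nonneg_left (le_of_lt hω) hσ.le
  filter_upwards [h1, h2] with ω hω1 hω2
  refine ⟨?_, hω1⟩
  have h3 : ∀ n : ℕ, |(inner ℝ (X.u t ω) (X.jump t ω) : ℝ)| ≤ 2 * σ * (1 / ((n : ℝ) + 1)) := by
    intro n
    obtain ⟨l, hl⟩ := hc.exists_dist_lt (X.u t ω) (by positivity : (0 : ℝ) < 1 / ((n : ℝ) + 1))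
    rw [dist_eq_norm] at hl
    have h4 := hω2 n l hl
    have h5 : (inner ℝ (X.u t ω) (X.jump t ω) : ℝ) =
        inner ℝ (X.u t ω - c l) (X.jump t ω) + inner ℝ (c l) (X.jump t ω) := by
      rw [← inner_add_left, sub_add_cancel]
    rw [h5]
    refine (abs_add_le _ _).trans ?_
    have h6 := abs_real_inner_le_norm (X.u t ω - c l) (X.jump t ω)
    rw [hω1] at h6
    have h7 := mul_le_mul_of_nonneg_right hl.le hσ.le
    linarith
  have h4 : Filter.Tendsto (fun n : ℕ => 2 * σ * (1 / ((n : ℝ) + 1))) Filter.atTop (nhds 0) := by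
    simpa using tendsto_one_div_add_atTop_nhds_zero_nat.const_mul (2 * σ)
  exact abs_nonpos_iff.1 (ge_of_tendsto' h4 h3)

end FindBasisElementRun

/-- At least `1/24` of the mass has its bound halved: `1 - (1/24)/2 = 47/48`. -/
lemma setLIntegral_le_of_half {Ω : Type*} [MeasurableSpace Ω] {P : Measure Ω} [IsFiniteMeasure P]
    {A G : Set Ω} (hA : MeasurableSet A) (hG : MeasurableSet G) {f : Ω → ENNReal} {n : ℕ}
    (hn : 1 ≤ n) (hf : ∀ᵐ ω ∂P, ω ∈ A → f ω ≤ 2 ^ n)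
    (hfG : ∀ᵐ ω ∂P, ω ∈ A → ω ∈ G → f ω ≤ 2 ^ (n - 1))
    (hAG : ENNReal.ofReal (1 / 24) * P A ≤ P (A ∩ G)) :
    ∫⁻ ω in A, f ω ∂P ≤ ENNReal.ofReal (47 / 48) * (2 ^ n * P A) := by
  have h1 : ∫⁻ ω in A, f ω ∂P ≤ 2 ^ (n - 1) * P (A ∩ G) + 2 ^ n * P (A \ G) := by
    rw [← lintegral_inter_add_sdiff _ A hG, ← setLIntegral_const, ← setLIntegral_const]
    refine add_le_add (setLIntegral_mono_ae' (hA.inter hG) ?_)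
      (setLIntegral_mono_ae' (hA.diff hG) ?_)
    · exact hfG.mono fun ω h hω => h hω.1 hω.2
    · exact hf.mono fun ω h hω => h hω.1
  refine h1.trans ?_
  have h2 : P A = P (A ∩ G) + P (A \ G) := (measure_inter_add_sdiff A hG).symm
  have hx := measure_ne_top P (A ∩ G)
  have hy := measure_ne_top P (A \ G)
  rw [h2] at hAG ⊢
  generalize P (A ∩ G) = x at *
  generalize P (A \ G) = y at *
  lift x to NNReal using hx
  lift y to NNReal using hy
  obtain ⟨k, rfl⟩ : ∃ k, n = k + 1 := ⟨n - 1, by omega⟩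
  have e1 : ENNReal.ofReal (1 / 24) = ((1 / 24 : NNReal) : ENNReal) := by
    rw [ENNReal.ofReal, Real.toNNReal_div (by norm_num)]
    simp
  have e2 : ENNReal.ofReal (47 / 48) = ((47 / 48 : NNReal) : ENNReal) := by
    rw [ENNReal.ofReal, Real.toNNReal_div (by norm_num)]
    simp
  rw [e1] at hAG
  rw [e2, Nat.add_sub_cancel]
  norm_cast at hAG ⊢
  have h3 : (1 / 24 : ℝ) * (x + y) ≤ x := by exact_mod_cast hAG
  have h4 : (2 ^ k * x + 2 ^ (k + 1) * y : ℝ) ≤ 47 / 48 * (2 ^ (k + 1) * (x + y)) := by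
    rw [pow_succ]
    have : (0 : ℝ) < 2 ^ k := by positivity
    nlinarith
  exact_mod_cast h4

namespace FindBasisElementRun

variable {Ω : Type*} [mΩ : MeasurableSpace Ω] {P : Measure Ω}
  {q : E d → E d} {σ r γ δ ν τ κ e : ℝ} {Z : Fin m → E d} {φ : Fin m → ℝ → ℝ}
  {N₁ N₂ I k : ℕ} {μ : Fin k → Ω → E d} {ℱ : ℕ → MeasurableSpace Ω} {out : Ω → E d}
  (X : FindBasisElementRun P q σ N₁ N₂ I μ ℱ out)

/-- On an event known before the jump, the potential decreases on average. -/
lemma setLIntegral_potential_le [IsProbabilityMeasure P] (hq : Measurable q) (hle : ∀ t, ℱ t ≤ mΩ)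
    (hmono : ∀ t, ℱ t ≤ ℱ (t + 1)) (hd : 2 ≤ d)
    (M : IsGradientModel Z φ r γ δ e q) (R : Regime d m r γ δ ν τ κ σ e)
    (hN : 2 ≤ N₂) (hN' : 10 / σ ≤ γ * N₂) (hL : LosesBig Z q σ τ ν N₂) {t : ℕ} (ht : t < I)
    {A : Set Ω} (hA : MeasurableSet[ℱ t] A)
    (htame : ∀ᵐ ω ∂P, ω ∈ A → IsTame Z (σ * τ / 10) (X.u t ω)) :
    ∫⁻ ω in A, potential Z (σ * τ / 10) (X.u (t + 1) ω) ∂P ≤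
      ENNReal.ofReal (47 / 48) * ∫⁻ ω in A, potential Z (σ * τ / 10) (X.u t ω) ∂P := by
  classical
  set θ := σ * τ / 10 with hθ
  have hu := X.measurable_u hq hmono t ht.le
  choose! T hT using hL
  -- Cut the event into finitely many cells on which the big set, the candidates for alignment and
  -- the signs of the coordinates are constant. On a cell the good jumps form a fixed set, as the
  -- law of the jump requires.
  set S : Finset (Fin m) × Finset (Fin m) × Finset (Fin m) → Set (E d) := fun a =>
    {u | bigSet Z θ u = a.1 ∧
      (Finset.univ.filter fun i => T a.1 i ≤ inner ℝ u (Z i) ^ 2 ∧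
        inner ℝ u (Z i) ^ 2 ≤ 1 - ν ^ 2 / 2) = a.2.1 ∧
      (Finset.univ.filter fun i => (0 : ℝ) ≤ inner ℝ u (Z i)) = a.2.2} with hS
  have hSm (a) : MeasurableSet (S a) := by
    refine (measurableSet_bigSet_eq Z θ a.1).inter ((measurableSet_filter_eq
      (fun i => ?_) a.2.1).inter (measurableSet_filter_eq (fun i => ?_) a.2.2))
    · have hf : Measurable fun u : E d => (inner ℝ u (Z i) : ℝ) ^ 2 := by fun_prop
      exact (measurableSet_le measurable_const hf).inter (measurableSet_le hf measurable_const)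
    · exact measurableSet_le measurable_const (by fun_prop)
  have hpm (a) : MeasurableSet[ℱ t] (A ∩ X.u t ⁻¹' S a) := hA.inter (hu (hSm a))
  have hAU : A = ⋃ a, A ∩ X.u t ⁻¹' S a := by
    ext ω
    simp only [mem_iUnion, mem_inter_iff]
    exact ⟨fun h => ⟨(bigSet Z θ (X.u t ω), Finset.univ.filter fun i =>
      T (bigSet Z θ (X.u t ω)) i ≤ inner ℝ (X.u t ω) (Z i) ^ 2 ∧
        inner ℝ (X.u t ω) (Z i) ^ 2 ≤ 1 - ν ^ 2 / 2, _), h, rfl, rfl, rfl⟩, fun ⟨_, h, _⟩ => h⟩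
  have hdisj : Pairwise (Function.onFun Disjoint fun a => A ∩ X.u t ⁻¹' S a) := by
    intro a b hab
    refine Set.disjoint_left.2 fun ω h1 h2 => hab ?_
    obtain ⟨-, h1, h1', h1''⟩ := h1
    obtain ⟨-, h2, h2', h2''⟩ := h2
    have e1 : a.1 = b.1 := h1.symm.trans h2
    rw [← e1] at h2'
    exact Prod.ext e1 (Prod.ext (h1'.symm.trans h2') (h1''.symm.trans h2''))
  have hint (f : Ω → ENNReal) : ∫⁻ ω in A, f ω ∂P = ∑' a, ∫⁻ ω in A ∩ X.u t ⁻¹' S a, f ω ∂P := by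
    conv_lhs => rw [hAU]
    exact lintegral_iUnion (fun a => hle t _ (hpm a)) hdisj f
  rw [hint, hint, ← ENNReal.tsum_mul_left]
  refine ENNReal.tsum_le_tsum fun a => ?_
  obtain ⟨L, Q, W⟩ := a
  set B := A ∩ X.u t ⁻¹' S (L, Q, W) with hB
  have hBm : MeasurableSet B := hle t _ (hpm _)
  have hjump := X.ae_isJump hq hle hmono R.σ_pos ht
  have hbig : ∀ ω ∈ B, bigSet Z θ (X.u t ω) = L := fun ω hω => hω.2.1
  have hsub : ∀ᵐ ω ∂P, ω ∈ B → bigSet Z θ (X.u (t + 1) ω) ⊆ L := by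
    filter_upwards [hjump, htame] with ω hj hω hωB
    rw [← hbig ω hωB, X.u_succ t ht]
    exact (M.tame_next R (hω hωB.1) hj hN hN').2
  by_cases hcard : 2 ≤ L.card
  · have hpot : ∫⁻ ω in B, potential Z θ (X.u t ω) ∂P = 2 ^ L.card * P B := by
      rw [← setLIntegral_const]
      refine setLIntegral_congr_fun hBm fun ω hω => ?_
      simp only [potential, hbig ω hω, if_pos hcard]
    rw [hpot]
    obtain ⟨G, hGm, hG, hPG⟩ : ∃ G : Set (E d), MeasurableSet G ∧
        (∀ᵐ ω ∂P, ω ∈ B → X.jump t ω ∈ G → bigSet Z θ (X.u (t + 1) ω) ⊂ L) ∧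
        ENNReal.ofReal (1 / 24) * P B ≤ P (B ∩ X.jump t ⁻¹' G) := by
      -- With a candidate in `L`, the good jumps are those pushing it outwards; without one, every
      -- jump makes progress and all jumps are good.
      by_cases hQ : ∃ i ∈ L, i ∈ Q
      · obtain ⟨i, hiL, hiQ⟩ := hQ
        set s : ℝ := if i ∈ W then 1 else -1 with hs
        have hs1 : s = 1 ∨ s = -1 := by
          rw [hs]
          split_ifs <;> simp
        have hQi : ∀ ω ∈ B, T L i ≤ inner ℝ (X.u t ω) (Z i) ^ 2 ∧
            inner ℝ (X.u t ω) (Z i) ^ 2 ≤ 1 - ν ^ 2 / 2 := by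
          intro ω hω
          have h1 : i ∈ Q := hiQ
          rw [← show _ = Q from hω.2.2.1, Finset.mem_filter] at h1
          exact h1.2
        have hWi : ∀ ω ∈ B, 0 ≤ s * inner ℝ (X.u t ω) (Z i) := by
          intro ω hω
          have h1 : i ∈ W ↔ (0 : ℝ) ≤ inner ℝ (X.u t ω) (Z i) := by
            rw [← show _ = W from hω.2.2.2, Finset.mem_filter]
            simp
          rw [hs]
          split_ifs with h
          · rw [one_mul]
            exact h1.1 h
          · rw [h1, not_le] at h
            linarith
        refine ⟨{x | σ * ν / (2 * √d) ≤ s * inner ℝ x (Z i)},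
          measurableSet_le measurable_const (by fun_prop), ?_, ?_⟩
        · filter_upwards [hjump, htame] with ω hj hω hωB hωG
          rw [X.u_succ t ht]
          exact (hT L hcard _ (hω hωB.1) (hbig ω hωB)).1 i hiL s hs1 (hQi ω hωB).1 (hWi ω hωB)
            _ hj hωG
        · rw [X.jump_law t ht _ (hpm _) _ (measurableSet_le measurable_const (by fun_prop)),
            ← setLIntegral_const]
          refine setLIntegral_mono_ae' hBm (htame.mono fun ω hω hωB => ?_)
          have hz : ‖s • Z i‖ = 1 := by
            rw [norm_smul, M.orthonormal.1 i]
            rcases hs1 with h | h <;> simp [h]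
          -- Take `ρ = ν/√2`: then `σρ/√(2d) = σν/(2√d)`, and the candidates' bound `1 - ν²/2` is `1
          -- - ρ²`.
          have h1 := uniformTangent_coord_ge hd R.σ_pos.le
            (div_pos R.ν_pos (Real.sqrt_pos.2 two_pos)) (hω hωB.1).1 hz ?_
          · refine h1.trans_eq (congrArg _ ?_)
            ext x
            rw [mem_ofPred_eq, mem_ofPred_eq, real_inner_smul_right, Real.sqrt_mul two_pos.le,
              ← mul_div_assoc, div_div, ← mul_assoc, Real.mul_self_sqrt two_pos.le]
          · rw [real_inner_smul_right, div_pow, Real.sq_sqrt two_pos.le, mul_pow]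
            have : s ^ 2 = 1 := by rcases hs1 with h | h <;> simp [h]
            rw [this, one_mul]
            exact (hQi ω hωB).2
      · refine ⟨univ, MeasurableSet.univ, ?_, ?_⟩
        · filter_upwards [hjump, htame] with ω hj hω hωB _
          rw [X.u_succ t ht]
          refine (hT L hcard _ (hω hωB.1) (hbig ω hωB)).2 ?_ _ hj
          rintro ⟨i, hi, hi'⟩
          refine hQ ⟨i, hi, ?_⟩
          rw [← show _ = Q from hωB.2.2.1, Finset.mem_filter]
          exact ⟨Finset.mem_univ i, hi'⟩
        · rw [preimage_univ, inter_univ]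
          refine (mul_le_mul_left (ENNReal.ofReal_le_one.2 (by norm_num)) _).trans (one_mul _).le
    refine setLIntegral_le_of_half hBm
      (((X.measurable_jump t ht).mono (hle _) le_rfl) hGm) (by omega) ?_ ?_ hPG
    · filter_upwards [hsub] with ω h hωB
      rw [← hbig ω hωB] at h ⊢
      refine (potential_le_of_subset (h hωB)).trans_eq ?_
      rw [potential, if_pos (by rw [hbig ω hωB]; exact hcard)]
    · filter_upwards [hG] with ω h hωB hωG
      have := h hωB hωG
      rw [← hbig ω hωB] at this ⊢
      exact potential_le_half (by rw [hbig ω hωB]; exact hcard) this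
  · have h0 : ∫⁻ ω in B, potential Z θ (X.u (t + 1) ω) ∂P = ∫⁻ ω in B, 0 ∂P := by
      refine setLIntegral_congr_fun_ae hBm (hsub.mono fun ω h hωB => ?_)
      have := Finset.card_le_card (h hωB)
      rw [potential, if_neg (by omega)]
    rw [h0, lintegral_zero]
    exact zero_le

/-- Tameness of the initial vector persists, and big coordinates do not appear. -/
lemma ae_tame (hq : Measurable q) (hle : ∀ t, ℱ t ≤ mΩ)
    (hmono : ∀ t, ℱ t ≤ ℱ (t + 1)) (M : IsGradientModel Z φ r γ δ e q)
    (R : Regime d m r γ δ ν τ κ σ e) (hN : 2 ≤ N₂) (hN' : 10 / σ ≤ γ * N₂) :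
    ∀ t ≤ I, ∀ᵐ ω ∂P, IsTame Z (σ * τ / 10) (X.u 0 ω) → IsTame Z (σ * τ / 10) (X.u t ω) ∧
      bigSet Z (σ * τ / 10) (X.u t ω) ⊆ bigSet Z (σ * τ / 10) (X.u 0 ω) := by
  intro t
  induction t with
  | zero => exact fun _ => Filter.Eventually.of_forall fun ω h => ⟨h, subset_rfl⟩
  | succ t ih =>
    intro ht
    filter_upwards [ih (by omega), X.ae_isJump hq hle hmono R.σ_pos (by omega : t < I)]
      with ω h1 h2 h3
    obtain ⟨h4, h5⟩ := h1 h3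
    obtain ⟨h6, h7⟩ := M.tame_next R h4 h2 hN hN'
    rw [X.u_succ t (by omega)]
    exact ⟨h6, h7.trans h5⟩

lemma lintegral_potential_le [IsProbabilityMeasure P] (hq : Measurable q) (hle : ∀ t, ℱ t ≤ mΩ)
    (hmono : ∀ t, ℱ t ≤ ℱ (t + 1)) (hd : 2 ≤ d)
    (M : IsGradientModel Z φ r γ δ e q) (R : Regime d m r γ δ ν τ κ σ e)
    (hN : 2 ≤ N₂) (hN' : 10 / σ ≤ γ * N₂) (hL : LosesBig Z q σ τ ν N₂) :
    ∀ t ≤ I, ∫⁻ ω in {ω | IsTame Z (σ * τ / 10) (X.u 0 ω)},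
      potential Z (σ * τ / 10) (X.u t ω) ∂P ≤ ENNReal.ofReal ((47 / 48) ^ t) * 2 ^ m := by
  have hmono' : ∀ t, ℱ 0 ≤ ℱ t := fun t => monotone_nat_of_le_succ hmono (Nat.zero_le t)
  have hA : MeasurableSet[ℱ 0] {ω | IsTame Z (σ * τ / 10) (X.u 0 ω)} :=
    X.measurable_u hq hmono 0 (Nat.zero_le _) (measurableSet_isTame Z _)
  intro t
  induction t with
  | zero =>
    intro _
    rw [pow_zero, ENNReal.ofReal_one, one_mul]
    calc ∫⁻ ω in {ω | IsTame Z (σ * τ / 10) (X.u 0 ω)}, potential Z (σ * τ / 10) (X.u 0 ω) ∂P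
        ≤ ∫⁻ ω, potential Z (σ * τ / 10) (X.u 0 ω) ∂P := setLIntegral_le_lintegral _ _
      _ ≤ ∫⁻ _, 2 ^ m ∂P := by
          refine lintegral_mono fun ω => ?_
          unfold potential
          split_ifs
          · refine pow_le_pow_right₀ one_le_two ((Finset.card_le_univ _).trans_eq ?_)
            exact Fintype.card_fin m
          · exact zero_le
      _ = 2 ^ m := by rw [lintegral_const, measure_univ, mul_one]
  | succ t ih =>
    intro ht
    refine (X.setLIntegral_potential_le hq hle hmono hd M R hN hN' hL (by omega) (hmono' t _ hA)
      ((X.ae_tame hq hle hmono M R hN hN' t (by omega)).mono fun ω h hω => (h hω).1)).trans ?_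
    rw [pow_succ', ENNReal.ofReal_mul (by norm_num), mul_assoc]
    gcongr
    exact ih (by omega)

/-- It is unlikely that several big coordinates survive. -/
lemma measure_several_big_le [IsProbabilityMeasure P] (hq : Measurable q) (hle : ∀ t, ℱ t ≤ mΩ)
    (hmono : ∀ t, ℱ t ≤ ℱ (t + 1)) (hd : 2 ≤ d)
    (M : IsGradientModel Z φ r γ δ e q) (R : Regime d m r γ δ ν τ κ σ e)
    (hN : 2 ≤ N₂) (hN' : 10 / σ ≤ γ * N₂) (hL : LosesBig Z q σ τ ν N₂) {t : ℕ} (ht : t ≤ I) :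
    P {ω | IsTame Z (σ * τ / 10) (X.u 0 ω) ∧ 2 ≤ (bigSet Z (σ * τ / 10) (X.u t ω)).card} ≤
      ENNReal.ofReal ((47 / 48) ^ t * 2 ^ m) := by
  have hA : MeasurableSet {ω | IsTame Z (σ * τ / 10) (X.u 0 ω)} :=
    hle 0 _ (X.measurable_u hq hmono 0 (Nat.zero_le _) (measurableSet_isTame Z _))
  have hpot : Measurable fun ω => potential Z (σ * τ / 10) (X.u t ω) :=
    (measurable_potential Z _).comp ((X.measurable_u hq hmono t ht).mono (hle t) le_rfl)
  have h1 := mul_meas_ge_le_lintegral (μ := P.restrict {ω | IsTame Z (σ * τ / 10) (X.u 0 ω)})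
    hpot 1
  rw [one_mul, Measure.restrict_apply (measurableSet_le measurable_const hpot)] at h1
  refine (measure_mono fun ω hω => ?_).trans (h1.trans
    ((X.lintegral_potential_le hq hle hmono hd M R hN hN' hL t ht).trans_eq ?_))
  · refine ⟨?_, hω.1⟩
    rw [mem_ofPred_eq, potential, if_pos hω.2]
    exact one_le_pow₀ one_le_two
  · rw [ENNReal.ofReal_mul (by positivity), ENNReal.ofReal_pow (by norm_num : (0 : ℝ) ≤ 2),
      ENNReal.ofReal_ofNat]

end FindBasisElementRun

section

/-! ### The full recovery algorithm -/

variable {Ω : Type*} [mΩ : MeasurableSpace Ω] {P : Measure Ω}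
  {q : E d → E d} {σ r γ δ ν τ κ e : ℝ} {Z : Fin m → E d} {φ : Fin m → ℝ → ℝ}
  {N₁ N₂ I : ℕ}

/-- A call which is left with at most one big coordinate finds a new hidden basis element. -/
lemma FindBasisElementRun.ae_finds_new {k : ℕ} {μ : Fin k → Ω → E d} {ℱ : ℕ → MeasurableSpace Ω}
    {out : Ω → E d} (X : FindBasisElementRun P q σ N₁ N₂ I μ ℱ out) (hq : Measurable q)
    (hle : ∀ t, ℱ t ≤ mΩ) (hmono : ∀ t, ℱ t ≤ ℱ (t + 1))
    (M : IsGradientModel Z φ r γ δ e q) (R : Regime d m r γ δ ν τ κ σ e)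
    (hN : 2 ≤ N₂) (hN' : 10 / σ ≤ γ * N₂) {n : ℕ} (hn : n ≤ N₂)
    (hn' : 2 ^ (-(1 + 2 * γ) ^ n) ≤ 8 / r * (4 * e) ^ (2 * γ)) (hI : 1 ≤ I) (hk : k < m) :
    ∀ᵐ ω ∂P, ¬ (IsTame Z (σ * τ / 10) (X.u 0 ω) ∧
        2 ≤ (bigSet Z (σ * τ / 10) (X.u (I - 1) ω)).card) →
      ∀ (π : Fin k → Fin m) (s : Fin k → ℝ), Function.Injective π →
        (∀ l, ‖s l • μ l ω - Z (π l)‖ ≤ √2 * (4 * e)) →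
        ∃ i, (∀ l, π l ≠ i) ∧ ∃ s' : ℝ, (s' = 1 ∨ s' = -1) ∧
          ‖s' • out ω - Z i‖ ≤ √2 * (4 * e) := by
  -- The first `I - 1` rounds eliminate big coordinates; the last round is reserved for convergence
  -- from a single big coordinate.
  filter_upwards [X.ae_tame hq hle hmono M R hN hN' (I - 1) (by omega),
    X.ae_isJump hq hle hmono R.σ_pos (by omega : I - 1 < I)] with ω h1 h2 h3 π s hπ hμ
  obtain ⟨h4, h5⟩ := M.tame_init R hk hπ hμ (X.x_orthonormal ω) (fun l j => X.x_perp ω j l)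
    (X.j_max ω)
  have h6 := M.giLoop_stay R h4.1 h4.2 N₁
  have h7 : IsTame Z (σ * τ / 10) (X.u 0 ω) := by
    rw [X.u_zero]
    exact ⟨norm_giLoop h4.1 _, h6.1⟩
  obtain ⟨h8, h9⟩ := h1 h7
  have h10 : (bigSet Z (σ * τ / 10) (X.u (I - 1) ω)).card = 1 := by
    have := Finset.card_pos.2 (M.bigSet_nonempty R h8)
    have : ¬ 2 ≤ (bigSet Z (σ * τ / 10) (X.u (I - 1) ω)).card := fun h => h3 ⟨h7, h⟩
    omega
  obtain ⟨i, hi⟩ := Finset.card_eq_one.1 h10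
  refine ⟨i, fun l hl => ?_, ?_⟩
  · have h11 : i ∈ bigSet Z (σ * τ / 10) (X.u 0 ω) := h9 (by rw [hi]; simp)
    rw [mem_bigSet, X.u_zero] at h11
    have := h6.2 (π l) (h5 l)
    rw [hl] at this
    exact absurd h11 (not_lt.2 this)
  · have h12 := X.u_succ (I - 1) (by omega) ω
    rw [Nat.sub_add_cancel hI] at h12
    rw [X.out_eq, h12]
    exact M.accurate_of_single R h8 h2 hi hn hn'

/-- Each call extends a partial injection by an index not yet used; after `m` calls it is a
bijection of `Fin m`. -/
lemma exists_perm_of_forall_new {μ : ℕ → E d} {ε : ℝ}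
    (h : ∀ k < m, ∀ (π : Fin k → Fin m) (s : Fin k → ℝ), Function.Injective π →
      (∀ l : Fin k, ‖s l • μ l - Z (π l)‖ ≤ ε) →
      ∃ i, (∀ l, π l ≠ i) ∧ ∃ s' : ℝ, (s' = 1 ∨ s' = -1) ∧ ‖s' • μ k - Z i‖ ≤ ε) :
    ∃ (π : Equiv.Perm (Fin m)) (s : Fin m → ℝ), (∀ i, s i = 1 ∨ s i = -1) ∧
      ∀ i : Fin m, ‖s i • μ i - Z (π i)‖ ≤ ε := by
  have key : ∀ k ≤ m, ∃ (π : Fin k → Fin m) (s : Fin k → ℝ), Function.Injective π ∧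
      (∀ l, s l = 1 ∨ s l = -1) ∧ ∀ l : Fin k, ‖s l • μ l - Z (π l)‖ ≤ ε := by
    intro k
    induction k with
    | zero => exact fun _ => ⟨Fin.elim0, Fin.elim0, fun a => a.elim0, fun a => a.elim0,
        fun a => a.elim0⟩
    | succ k ih =>
      intro hk
      obtain ⟨π, s, hπ, hs, hμ⟩ := ih (by omega)
      obtain ⟨i, hi, s', hs', hμ'⟩ := h k (by omega) π s hπ hμ
      refine ⟨Fin.snoc π i, Fin.snoc s s', ?_, fun l => ?_, fun l => ?_⟩
      · intro a b hab
        induction a using Fin.lastCases with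
        | last =>
          induction b using Fin.lastCases with
          | last => rfl
          | cast b => simp only [Fin.snoc_last, Fin.snoc_castSucc] at hab; exact absurd hab.symm (hi b)
        | cast a =>
          induction b using Fin.lastCases with
          | last => simp only [Fin.snoc_last, Fin.snoc_castSucc] at hab; exact absurd hab (hi a)
          | cast b => simp only [Fin.snoc_castSucc] at hab; rw [hπ hab]
      · induction l using Fin.lastCases with
        | last => simpa using hs'
        | cast l => simpa using hs l
      · induction l using Fin.lastCases with
        | last => simpa using hμ'
        | cast l => simpa using hμ l
  obtain ⟨π, s, hπ, hs, hμ⟩ := key m le_rfl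
  exact ⟨Equiv.ofBijective π (Finite.injective_iff_bijective.1 hπ), s, hs, hμ⟩

/-- Union bound over the first `m` calls, each failing with probability at most `p/m`. Outside the
bad events recovery is deterministic up to a null set, so independence between calls is not needed.
-/
theorem RobustGIRecoveryRun.measure_recovers_ge [IsProbabilityMeasure P] {mhat : ℕ}
    (Y : RobustGIRecoveryRun P q σ N₁ N₂ I mhat) (hq : Measurable q) (hd : 2 ≤ d)
    (M : IsGradientModel Z φ r γ δ e q) (R : Regime d m r γ δ ν τ κ σ e)
    (hN : 2 ≤ N₂) (hN' : 10 / σ ≤ γ * N₂) (hL : LosesBig Z q σ τ ν N₂) {n : ℕ} (hn : n ≤ N₂)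
    (hn' : 2 ^ (-(1 + 2 * γ) ^ n) ≤ 8 / r * (4 * e) ^ (2 * γ)) (hI : 1 ≤ I) (hm : m ≤ mhat)
    {p : ℝ} (hp : 0 ≤ p) (hIp : (47 / 48) ^ (I - 1) * 2 ^ m ≤ p / m) :
    ENNReal.ofReal (1 - p) ≤
      P {ω | ∃ (π : Equiv.Perm (Fin m)) (s : Fin m → ℝ), (∀ i, s i = 1 ∨ s i = -1) ∧
        ∀ i : Fin m, ‖s i • Y.μ i ω - Z (π i)‖ ≤ √2 * (4 * e)} := by
  set S := {ω | ∃ (π : Equiv.Perm (Fin m)) (s : Fin m → ℝ), (∀ i, s i = 1 ∨ s i = -1) ∧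
        ∀ i : Fin m, ‖s i • Y.μ i ω - Z (π i)‖ ≤ √2 * (4 * e)}
  have hlt (k : Fin m) : (k : ℕ) < mhat := k.2.trans_le hm
  set bad : Fin m → Set Ω := fun k => {ω | IsTame Z (σ * τ / 10) ((Y.call k (hlt k)).u 0 ω) ∧
    2 ≤ (bigSet Z (σ * τ / 10) ((Y.call k (hlt k)).u (I - 1) ω)).card} with hbad
  have h1 (k : Fin m) : P (bad k) ≤ ENNReal.ofReal (p / m) :=
    ((Y.call k (hlt k)).measure_several_big_le hq (Y.ℱ_le k) (Y.ℱ_mono k) hd M R hN hN' hL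
      (Nat.sub_le I 1)).trans (ENNReal.ofReal_le_ofReal hIp)
  have h2 : P (⋃ k, bad k) ≤ ENNReal.ofReal p := by
    refine (measure_iUnion_fintype_le P bad).trans ?_
    calc ∑ k, P (bad k) ≤ ∑ _k : Fin m, ENNReal.ofReal (p / m) := Finset.sum_le_sum fun k _ => h1 k
      _ = ENNReal.ofReal p := by
          rw [Finset.sum_const, Finset.card_univ, Fintype.card_fin, ← ENNReal.ofReal_nsmul,
            nsmul_eq_mul, mul_div_cancel₀ _ R.m_pos.ne']
  have h3 : ∀ᵐ ω ∂P, ω ∈ S ∪ ⋃ k, bad k := by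
    have h4 := ae_all_iff.2 fun k : Fin m => (Y.call k (hlt k)).ae_finds_new hq (Y.ℱ_le k)
      (Y.ℱ_mono k) M R hN hN' hn hn' hI k.2
    filter_upwards [h4] with ω hω
    by_cases hωb : ω ∈ ⋃ k, bad k
    · exact Or.inr hωb
    · refine Or.inl (exists_perm_of_forall_new (μ := fun i => Y.μ i ω) fun k hk => ?_)
      exact hω ⟨k, hk⟩ fun hb => hωb (mem_iUnion.2 ⟨⟨k, hk⟩, hb⟩)
  have h5 : 1 ≤ P S + P (⋃ k, bad k) := by
    rw [← measure_univ (μ := P)]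
    exact (measure_mono_ae (h3.mono fun ω h _ => h)).trans (measure_union_le _ _)
  rw [ENNReal.ofReal_sub _ hp, ENNReal.ofReal_one, tsub_le_iff_right]
  exact h5.trans (add_le_add_right h2 _)

end

/-! ### Iteration counts -/

section Counts

variable {r γ δ ν τ κ σ e : ℝ}

namespace Regime

lemma log_ν (R : Regime d m r γ δ ν τ κ σ e) :
    2 * γ * Real.log ν = Real.log r - δ * Real.log m := by
  rw [← Real.log_rpow R.ν_pos, R.ν_pow, Real.log_mul R.r_pos.ne' R.base_pos.ne',
    Real.log_rpow R.m_pos]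
  ring

/-- Eliminating `ν` gives `γ log(1/κ) = -δ log r + (δ-γ) δ log m`. The bound is relaxed to the
bracket that occurs in the spreading time. -/
lemma log_inv_κ_le (R : Regime d m r γ δ ν τ κ σ e) :
    Real.log (1 / κ) ≤ δ / γ * (Real.log (4 / r) + δ * Real.log m) := by
  have hγ := R.γ_pos
  have hm0 : 0 ≤ Real.log m := Real.log_nonneg (by exact_mod_cast R.one_le_m)
  have h4 : Real.log (4 / r) = Real.log 4 - Real.log r :=
    Real.log_div (by norm_num) R.r_pos.ne'
  have hl4 : 0 ≤ Real.log 4 := Real.log_nonneg (by norm_num)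
  have h1 : Real.log (1 / κ) = -Real.log r - 2 * (δ - γ) * Real.log ν := by
    rw [one_div, Real.log_inv, R.κ_eq, Real.log_mul R.r_pos.ne' (Real.rpow_pos_of_pos R.ν_pos _).ne',
      Real.log_rpow R.ν_pos]
    ring
  have h2 : γ * Real.log (1 / κ) = -(δ * Real.log r) + (δ - γ) * δ * Real.log m := by
    rw [h1]
    linear_combination -(δ - γ) * R.log_ν
  rw [div_mul_eq_mul_div, le_div_iff₀ hγ, mul_comm, h2, h4]
  have h3 : 0 ≤ δ * Real.log 4 := mul_nonneg R.δ_pos.le hl4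
  have h5 : 0 ≤ γ * δ * Real.log m := mul_nonneg (mul_nonneg hγ.le R.δ_pos.le) hm0
  nlinarith

lemma one_le_log (R : Regime d m r γ δ ν τ κ σ e) :
    4 / 3 ≤ Real.log (4 / r) := by
  have h4 : Real.log (4 / r) = Real.log 4 - Real.log r :=
    Real.log_div (by norm_num) R.r_pos.ne'
  have h5 : Real.log 4 = 2 * Real.log 2 := by
    rw [show (4 : ℝ) = 2 ^ 2 by norm_num, Real.log_pow]
    norm_num
  have h6 : Real.log r ≤ 0 := Real.log_nonpos R.r_pos.le R.r_le
  linarith [Real.log_two_gt_d9]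

end Regime

/-- Uses `log(1+ρ) ≥ 1 - 1/(1+ρ) = 1/(1 + 1/ρ)`. This is the length of the geometric phase in
`escape`. -/
lemma exists_pow_ge {z ρ T : ℝ} (hz : 0 < z) (hρ : 0 < ρ)
    (hT : (1 + 1 / ρ) * Real.log (1 / z) ≤ T) :
    1 ≤ z * (1 + ρ) ^ ⌈T⌉₊ := by
  have h1 : Real.log (1 / z) ≤ ⌈T⌉₊ * Real.log (1 + ρ) := by
    have h2 : 1 - (1 + ρ)⁻¹ ≤ Real.log (1 + ρ) := Real.one_sub_inv_le_log_of_pos (by linarith)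
    have h3 : 1 - (1 + ρ)⁻¹ = 1 / (1 + 1 / ρ) := by field_simp; ring
    rw [h3] at h2
    calc Real.log (1 / z) ≤ T * (1 / (1 + 1 / ρ)) := by
          rw [mul_one_div, le_div_iff₀ (by positivity)]
          linarith
      _ ≤ ⌈T⌉₊ * Real.log (1 + ρ) :=
          mul_le_mul (Nat.le_ceil T) h2 (by positivity) (Nat.cast_nonneg _)
  rw [← Real.log_pow] at h1
  have h4 := (Real.log_le_log_iff (by positivity) (by positivity)).1 h1
  rwa [div_le_iff₀' hz] at h4

/-- The number of steps over which the coordinates spread. -/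
def spreadTime (d m : ℕ) (r γ δ ν τ κ σ : ℝ) : ℝ :=
  3 / 2 * (√d / (σ * ν)) * (1 / ν) * (1 / τ ^ 2) * (1 / κ) *
    ((Real.log (4 / r) + δ * Real.log m) / γ)

namespace Regime

lemma spreadTime_ge (R : Regime d m r γ δ ν τ κ σ e) :
    3 / 2 * (√d / (σ * ν)) * (1 / τ ^ 2) * (1 / κ) *
      ((Real.log (4 / r) + δ * Real.log m) / γ) ≤ spreadTime d m r γ δ ν τ κ σ := by
  have hm0 : 0 ≤ Real.log m := Real.log_nonneg (by exact_mod_cast R.one_le_m)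
  have := R.one_le_log
  have := R.γ_pos
  have := R.δ_pos
  have := R.σ_pos
  have := R.ν_pos
  have := R.τ_pos
  have := R.κ_pos
  have hV : 1 ≤ 1 / ν := (one_le_div R.ν_pos).2 R.ν_le
  have hL : 0 ≤ Real.log (4 / r) + δ * Real.log m := by positivity
  unfold spreadTime
  rw [show 3 / 2 * (√d / (σ * ν)) * (1 / ν) * (1 / τ ^ 2) * (1 / κ) *
    ((Real.log (4 / r) + δ * Real.log m) / γ) = 3 / 2 * (√d / (σ * ν)) * (1 / τ ^ 2) * (1 / κ) *
      ((Real.log (4 / r) + δ * Real.log m) / γ) * (1 / ν) by ring]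
  exact le_mul_of_one_le_right (by positivity) hV

lemma le_sqrt_div (R : Regime d m r γ δ ν τ κ σ e) : 12 / τ ^ 2 ≤ √d / (σ * ν) := by
  have := R.σ_pos
  have := R.ν_pos
  have := R.τ_pos
  have h1 : (1 : ℝ) ≤ √d := Real.one_le_sqrt.2 (by exact_mod_cast R.one_le_d)
  rw [div_le_div_iff₀ (by positivity) (by positivity)]
  have h2 : σ * ν ≤ τ ^ 2 / 12 := (mul_le_of_le_one_right R.σ_pos.le R.ν_le).trans R.σ_le
  have h3 : τ ^ 2 ≤ √d * τ ^ 2 := le_mul_of_one_le_left (by positivity) h1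
  linarith

/-- Five spreading times suffice for the final decay from `τ` to the noise floor in `giLoop_tiny`.
-/
lemma ten_div_le (R : Regime d m r γ δ ν τ κ σ e) :
    10 / σ ≤ γ * (5 * spreadTime d m r γ δ ν τ κ σ) := by
  have hm0 : 0 ≤ Real.log m := Real.log_nonneg (by exact_mod_cast R.one_le_m)
  have hγ := R.γ_pos
  have hδ := R.δ_pos
  have hσ := R.σ_pos
  have hν := R.ν_pos
  have hτ := R.τ_pos
  have hκ := R.κ_pos
  have hA : 1 ≤ 1 / τ ^ 2 := (one_le_div (by positivity)).2 (pow_le_one₀ hτ.le R.τ_le_one)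
  have hK : 1 ≤ 1 / κ := (one_le_div hκ).2 R.κ_le_one
  have hL : 4 / 3 ≤ Real.log (4 / r) + δ * Real.log m := by
    linarith [R.one_le_log, mul_nonneg hδ.le hm0]
  have hG : 1 / σ ≤ √d / (σ * ν) := by
    have h1 : (1 : ℝ) ≤ √d := Real.one_le_sqrt.2 (by exact_mod_cast R.one_le_d)
    refine div_le_div₀ (by positivity) h1 (by positivity) ?_
    exact mul_le_of_le_one_right hσ.le R.ν_le
  have h1 := R.spreadTime_ge
  have h2 : 3 / 2 * (1 / σ) * 1 * 1 * (4 / 3 / γ) ≤ 3 / 2 * (√d / (σ * ν)) * (1 / τ ^ 2) * (1 / κ) *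
      ((Real.log (4 / r) + δ * Real.log m) / γ) := by gcongr
  have h3 : 10 / σ = γ * (5 * (3 / 2 * (1 / σ) * 1 * 1 * (4 / 3 / γ))) := by
    field_simp
    norm_num
  rw [h3]
  gcongr
  exact h2.trans h1

/-- One spreading time covers the linear phase in `escape`. -/
lemma log_div_le (R : Regime d m r γ δ ν τ κ σ e) :
    Real.log (4 / r) + δ * Real.log m ≤
      δ * κ * τ ^ 2 / 8 * spreadTime d m r γ δ ν τ κ σ := by
  have hm0 : 0 ≤ Real.log m := Real.log_nonneg (by exact_mod_cast R.one_le_m)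
  have hγ := R.γ_pos
  have hδ := R.δ_pos
  have hσ := R.σ_pos
  have hν := R.ν_pos
  have hτ := R.τ_pos
  have hκ := R.κ_pos
  have hL : 4 / 3 ≤ Real.log (4 / r) + δ * Real.log m := by
    linarith [R.one_le_log, mul_nonneg hδ.le hm0]
  have hG : 12 ≤ √d / (σ * ν) := by
    refine le_trans ?_ R.le_sqrt_div
    rw [le_div_iff₀ (by positivity)]
    linarith [pow_le_one₀ (n := 2) hτ.le R.τ_le_one]
  have h2 : 3 / 2 * 12 * (1 / τ ^ 2) * (1 / κ) * ((Real.log (4 / r) + δ * Real.log m) / δ) ≤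
      3 / 2 * (√d / (σ * ν)) * (1 / τ ^ 2) * (1 / κ) *
      ((Real.log (4 / r) + δ * Real.log m) / γ) := by
    have := R.γ_le
    gcongr
  calc Real.log (4 / r) + δ * Real.log m
      ≤ 18 / 8 * (Real.log (4 / r) + δ * Real.log m) := by linarith
    _ = δ * κ * τ ^ 2 / 8 * (3 / 2 * 12 * (1 / τ ^ 2) * (1 / κ) *
        ((Real.log (4 / r) + δ * Real.log m) / δ)) := by field_simp; norm_num
    _ ≤ _ := by
        gcongr
        exact h2.trans R.spreadTime_ge

/-- Ten spreading times cover the geometric phase. The reciprocal of the initial excess is `(10/3) D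
K G` with `D = 1/δ`, `K = 1/κ`, `G = √d/(σν)`. The spreading time is linear in `G`, so `log G ≤ G`
suffices, while `log K` is controlled through `log_inv_κ_le`. With `m ≥ 2`, `log m` keeps the
bracket divided by `γ` away from zero. -/
lemma mul_log_gap_le (R : Regime d m r γ δ ν τ κ σ e) (hm : 2 ≤ m) :
    (1 + 1 / (δ * κ * τ ^ 2 / 8)) * Real.log (1 / (δ * κ * IsGradientModel.excess d σ ν)) ≤
      10 * spreadTime d m r γ δ ν τ κ σ := by
  have hγ := R.γ_pos
  have hδ := R.δ_pos
  have hσ := R.σ_pos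
  have hν := R.ν_pos
  have hτ := R.τ_pos
  have hκ := R.κ_pos
  have hd0 : 0 < √d := Real.sqrt_pos.2 (by exact_mod_cast R.one_le_d)
  have hlm : 0.69 ≤ Real.log m := by
    have : Real.log 2 ≤ Real.log m := Real.log_le_log two_pos (by exact_mod_cast hm)
    linarith [Real.log_two_gt_d9]
  set X := spreadTime d m r γ δ ν τ κ σ with hX
  have hX1 : 3 / 2 * (√d / (σ * ν)) * (1 / τ ^ 2) * (1 / κ) *
      ((Real.log (4 / r) + δ * Real.log m) / γ) ≤ X := R.spreadTime_ge
  set L := Real.log (4 / r) + δ * Real.log m with hLdef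
  have hL1 : 4 / 3 ≤ L := by linarith [R.one_le_log, mul_nonneg hδ.le (by linarith : 0 ≤ Real.log m)]
  have hL2 : 0.69 * δ ≤ L := by
    have := R.one_le_log
    nlinarith
  have hLγ1 : 4 / 3 / δ ≤ L / γ := div_le_div₀ (by linarith) hL1 hγ R.γ_le
  have hLγ2 : 0.69 ≤ L / γ := by
    rw [le_div_iff₀ hγ]
    linarith [R.γ_le]
  have hKlog : Real.log (1 / κ) ≤ δ / γ * L := R.log_inv_κ_le
  have hz : 1 / (δ * κ * IsGradientModel.excess d σ ν) = 10 / 3 * ((1 / δ) * ((1 / κ) * (√d / (σ * ν)))) := by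
    unfold IsGradientModel.excess
    field_simp
  have hGA := R.le_sqrt_div
  have hA : 1 ≤ 1 / τ ^ 2 := (one_le_div (by positivity)).2 (pow_le_one₀ hτ.le R.τ_le_one)
  have hK : 1 ≤ 1 / κ := (one_le_div hκ).2 R.κ_le_one
  have hδA : 1 / δ ≤ 1 / τ ^ 2 := by
    refine one_div_le_one_div_of_le (by positivity) (le_trans ?_ R.τ_le_δ)
    rw [sq]
    exact mul_le_of_le_one_left hτ.le R.τ_le_one
  have hρ : 1 / (δ * κ * τ ^ 2 / 8) = 8 * ((1 / κ) * (1 / τ ^ 2) * (1 / δ)) := by field_simp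
  have hG0 : 0 < √d / (σ * ν) := by positivity
  have hlogG : Real.log (√d / (σ * ν)) ≤ √d / (σ * ν) := Real.log_le_self hG0.le
  have hlogK : Real.log (1 / κ) ≤ 1 / κ := Real.log_le_self (by positivity)
  have hlogδ : Real.log (1 / δ) ≤ 1 / δ := Real.log_le_self (by positivity)
  have hlog3 : Real.log (10 / 3) ≤ 7 / 3 := by
    have := Real.log_le_sub_one_of_pos (by norm_num : (0 : ℝ) < 10 / 3)
    linarith
  have hδ0 : 0 < 1 / δ := by positivity
  rw [hz, hρ, Real.log_mul (by norm_num) (by positivity), Real.log_mul (by positivity)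
    (by positivity), Real.log_mul (by positivity) (by positivity)]
  have hδγ : 1 / δ * (δ / γ * L) = L / γ := by field_simp
  have hLδ : 4 / 3 / δ = 4 / 3 * (1 / δ) := by ring
  rw [hLδ] at hLγ1
  rw [show 12 / τ ^ 2 = 12 * (1 / τ ^ 2) by ring] at hGA
  clear_value X L
  generalize √d / (σ * ν) = G at *
  generalize 1 / τ ^ 2 = A at *
  generalize 1 / κ = K at *
  generalize 1 / δ = D at *
  generalize L / γ = Λ at *
  have hAK : 1 ≤ A * K := one_le_mul_of_one_le_of_one_le hA hK
  have hG12 : 12 ≤ G := by linarith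
  have hWΛ : 0 ≤ A * K * Λ := by positivity
  have hGAK : G * (A * K) ≤ X := by
    refine le_trans ?_ hX1
    have : G * (A * K) * 1 ≤ G * (A * K) * (3 / 2 * Λ) := by gcongr; linarith
    linarith
  have hGW : 2 * (G * (K * A * D)) ≤ X := by
    refine le_trans ?_ hX1
    have : 3 / 2 * G * A * K * (4 / 3 * D) ≤ 3 / 2 * G * A * K * Λ := by gcongr
    linarith
  have hΛ18 : 18 * (K * A * Λ) ≤ X := by
    refine le_trans ?_ hX1
    have : 12 * (A * K * Λ) ≤ G * (A * K * Λ) := by gcongr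
    linarith
  have hX0 : G ≤ X := le_trans (le_mul_of_one_le_right hG0.le hAK) hGAK
  have hKX : K ≤ X := by
    refine le_trans ?_ hGAK
    have h1 : 1 ≤ G * A := one_le_mul_of_one_le_of_one_le (by linarith) hA
    calc K ≤ G * A * K := le_mul_of_one_le_left (by linarith) h1
      _ = _ := by ring
  have hW0 : 0 ≤ K * A * D := by positivity
  have hW24 : 24 * (K * A * D) ≤ X := by
    have : 12 * (K * A * D) ≤ G * (K * A * D) := by gcongr
    linarith
  have hp1 : K * A * D * Real.log (10 / 3) ≤ K * A * D * (7 / 3) := by gcongr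
  have hp2 : K * A * D * Real.log D ≤ K * A * D * (G / 12) := by gcongr; linarith
  have hp3 : K * A * D * Real.log K ≤ K * A * Λ := by
    calc K * A * D * Real.log K ≤ K * A * D * (δ / γ * L) := by gcongr
      _ = K * A * (D * (δ / γ * L)) := by ring
      _ = _ := by rw [hδγ]
  have hp4 : K * A * D * Real.log G ≤ K * A * D * G := by gcongr
  have hX12 : 12 ≤ X := hG12.trans hX0
  linarith

/-- The spreading time suffices for the loss of a big coordinate. -/
lemma exists_step_counts (R : Regime d m r γ δ ν τ κ σ e) (hm : 2 ≤ m) {Y : ℝ} (hY : 1 ≤ Y)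
    (hXY : spreadTime d m r γ δ ν τ κ σ ≤ Y) {N : ℕ} (hN : 100 * Y ≤ N) :
    ∃ T₁ T₂ N₀ : ℕ, 2 ≤ N₀ ∧ 10 / σ ≤ γ * N₀ ∧ T₁ + T₂ + N₀ ≤ N ∧
      1 ≤ δ * κ * IsGradientModel.excess d σ ν * (1 + δ * κ * τ ^ 2 / 8) ^ T₁ ∧
      Real.log ((m : ℝ) ^ δ / r) < 1 + δ * κ * τ ^ 2 / 8 * T₂ := by
  have hδ := R.δ_pos
  have hτ := R.τ_pos
  have hκ := R.κ_pos
  have hγ := R.γ_pos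
  have h10 := R.ten_div_le
  have hlog := R.log_div_le
  have hgap := R.mul_log_gap_le hm
  set X := spreadTime d m r γ δ ν τ κ σ with hX
  have hX0 : 0 ≤ X := by
    have : 0 < γ * (5 * X) := (div_pos (by norm_num) R.σ_pos).trans_le h10
    have := pos_of_mul_pos_right this hγ.le
    linarith
  -- Sixteen spreading times plus rounding fit into `100 Y`, because `Y ≥ 1`.
  refine ⟨⌈10 * X⌉₊, ⌈X⌉₊, ⌈5 * X⌉₊ + 2, by omega, ?_, ?_, ?_, ?_⟩
  · refine h10.trans ?_
    push_cast
    gcongr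
    linarith [Nat.le_ceil (5 * X)]
  · have h1 := (Nat.ceil_lt_add_one (by linarith : 0 ≤ 10 * X)).le
    have h2 := (Nat.ceil_lt_add_one hX0).le
    have h3 := (Nat.ceil_lt_add_one (by linarith : 0 ≤ 5 * X)).le
    have h4 : ((⌈10 * X⌉₊ + ⌈X⌉₊ + (⌈5 * X⌉₊ + 2) : ℕ) : ℝ) ≤ (N : ℕ) := by
      push_cast
      linarith
    exact_mod_cast h4
  · exact exists_pow_ge (mul_pos (mul_pos hδ hκ) (IsGradientModel.excess_pos R)) (by positivity) hgap
  · have h1 : δ * κ * τ ^ 2 / 8 * X ≤ δ * κ * τ ^ 2 / 8 * ⌈X⌉₊ := by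
      gcongr
      exact Nat.le_ceil X
    have h2 : Real.log ((m : ℝ) ^ δ / r) = δ * Real.log m - Real.log r := by
      rw [Real.log_div (Real.rpow_pos_of_pos R.m_pos _).ne' R.r_pos.ne', Real.log_rpow R.m_pos]
    have h3 : Real.log (4 / r) = Real.log 4 - Real.log r :=
      Real.log_div (by norm_num) R.r_pos.ne'
    have h4 : 0 ≤ Real.log 4 := Real.log_nonneg (by norm_num)
    linarith

end Regime

lemma IsGradientModel.losesBig {Z : Fin m → E d} {φ : Fin m → ℝ → ℝ} {q : E d → E d}
    (M : IsGradientModel Z φ r γ δ e q) (R : Regime d m r γ δ ν τ κ σ e) {Y : ℝ} (hY : 1 ≤ Y)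
    (hXY : spreadTime d m r γ δ ν τ κ σ ≤ Y) {N : ℕ} (hN : 100 * Y ≤ N) :
    LosesBig Z q σ τ ν N := by
  intro L hL
  -- Two big coordinates are only possible when `m ≥ 2`, so the step counts may assume it.
  have hm : 2 ≤ m := hL.trans ((Finset.card_le_univ L).trans_eq (Fintype.card_fin m))
  obtain ⟨T₁, T₂, N₀, h1, h2, h3, h4, h5⟩ := R.exists_step_counts hm hY hXY hN
  exact M.exists_progress R h1 h2 h3 h4 h5 L hL

end Counts

/-! ### The parameters of the algorithm -/

section Parameters

section ErrorBounds

variable {s ν τ κ σ e b T D : ℝ}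

/-- This and the next two results extract the three error budgets from the single hypothesis on `ε`,
with `s = √d`, `b = m^(-δ)`, `T = τ^(2δ)` and `D = d^(-δ)`. Each drops factors at most `1`. -/
lemma error_le (hs : 1 ≤ s) (hσ : 0 < σ) (hτ : 0 < τ) (hτ1 : τ ≤ 1) (hν : 0 < ν) (hν1 : ν ≤ 1)
    (hκ1 : κ ≤ 1) (hb : 0 < b) (hT : 0 < T) (hT1 : T ≤ 1) (hD : 0 < D) (hD1 : D ≤ 1)
    (he : e ≤ 9 / 2560 * (κ * ν) * b * (τ ^ 2 * T) * (σ / s * ν ^ 2 * τ ^ 2) * D) :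
    e ≤ σ * τ / 20 * b := by
  have hτ4 : τ ^ 4 ≤ τ := pow_le_of_le_one hτ.le hτ1 (by norm_num)
  have hν2 : ν ^ 2 ≤ 1 := pow_le_one₀ hν.le hν1
  calc e ≤ _ := he
    _ ≤ 9 / 2560 * (1 * 1) * b * (τ ^ 2 * 1) * (σ / 1 * 1 * τ ^ 2) * 1 := by gcongr
    _ = 9 / 2560 * b * σ * τ ^ 4 := by ring
    _ ≤ 1 / 20 * b * σ * τ := by
        gcongr ?_ * b * σ * ?_
        norm_num
    _ = _ := by ring

lemma error_le_gap (hs : 1 ≤ s) (hσ : 0 < σ) (hτ : 0 < τ) (hν : 0 < ν) (hν1 : ν ≤ 1)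
    (hκ : 0 < κ) (hb : 0 < b) (hT : 0 < T) (hT1 : T ≤ 1) (hD : 0 < D) (hD1 : D ≤ 1)
    (he : e ≤ 9 / 2560 * (κ * ν) * b * (τ ^ 2 * T) * (σ / s * ν ^ 2 * τ ^ 2) * D) :
    e ≤ 1 / 100 * b * τ ^ 4 * κ * (σ * ν / s) := by
  have hν2 : ν ^ 2 ≤ 1 := pow_le_one₀ hν.le hν1
  calc e ≤ _ := he
    _ ≤ 1 / 100 * (κ * ν) * b * (τ ^ 2 * 1) * (σ / s * 1 * τ ^ 2) * 1 := by
        gcongr ?_ * _ * _ * (_ * ?_) * (_ * ?_ * _) * ?_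
        norm_num
    _ = _ := by ring

lemma error_le_dim (hs : 1 ≤ s) (hσ : 0 < σ) (hτ : 0 < τ) (hτ1 : τ ≤ 1) (hν : 0 < ν) (hν1 : ν ≤ 1)
    (hκ1 : κ ≤ 1) (hb : 0 < b) (hb1 : b ≤ 1) (hT : 0 < T) (hT1 : T ≤ 1) {D' : ℝ}
    (hDD : D * D' = 1) (hD' : 0 < D')
    (he : e ≤ 9 / 2560 * (κ * ν) * b * (τ ^ 2 * T) * (σ / s * ν ^ 2 * τ ^ 2) * D) :
    e * (s * D') ≤ σ * τ / 80 := by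
  have hτ4 : τ ^ 4 ≤ τ := pow_le_of_le_one hτ.le hτ1 (by norm_num)
  have hν2 : ν ^ 2 ≤ 1 := pow_le_one₀ hν.le hν1
  have hss : σ / s * s = σ := div_mul_cancel₀ _ (by linarith)
  calc e * (s * D')
      ≤ 9 / 2560 * (κ * ν) * b * (τ ^ 2 * T) * (σ / s * ν ^ 2 * τ ^ 2) * D * (s * D') := by
        gcongr
    _ = 9 / 2560 * (κ * ν) * b * (τ ^ 2 * T) * ((σ / s * s) * ν ^ 2 * τ ^ 2) * (D * D') := by ring
    _ = 9 / 2560 * (κ * ν) * b * (τ ^ 2 * T) * (σ * ν ^ 2 * τ ^ 2) := by rw [hss, hDD, mul_one]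
    _ ≤ 9 / 2560 * (1 * 1) * 1 * (τ ^ 2 * 1) * (σ * 1 * τ ^ 2) := by gcongr
    _ = 9 / 2560 * σ * τ ^ 4 := by ring
    _ ≤ 1 / 80 * σ * τ := by
        gcongr ?_ * σ * ?_
        norm_num
    _ = _ := by ring

end ErrorBounds

lemma Regime.of_bounds {r γ δ ν τ κ σ e : ℝ} (hd : 2 ≤ d) (hm : 1 ≤ m) (hr : 0 < r) (hr1 : r ≤ 1)
    (hγ : 0 < γ) (hγδ : γ ≤ δ) (hν : 0 < ν) (hν' : ν ^ (2 * γ) = r * (m : ℝ) ^ (-δ))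
    (hτ : 0 < τ) (hτ' : τ ^ (2 * γ) = r * (m : ℝ) ^ (-δ) / 16) (hκ : κ = r * ν ^ (2 * (δ - γ)))
    (hσ : 0 < σ) (hσ' : σ ≤ 1 / (6 * √(2 * d * (1 + 2 * δ))) * τ ^ 2) (he : 0 < e)
    (he' : e ≤ 9 / 2560 * (κ * ν) * (m : ℝ) ^ (-δ) * τ ^ (2 + 2 * δ) * (σ / √d * ν ^ 2 * τ ^ 2) *
      (d : ℝ) ^ (-δ)) :
    Regime d m r γ δ ν τ κ σ e := by
  have hδ : 0 < δ := hγ.trans_le hγδ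
  have hd2 : (2 : ℝ) ≤ d := by exact_mod_cast hd
  have hm1 : (1 : ℝ) ≤ m := by exact_mod_cast hm
  have hb0 : 0 < (m : ℝ) ^ (-δ) := Real.rpow_pos_of_pos (by linarith) _
  have hb1 : (m : ℝ) ^ (-δ) ≤ 1 := Real.rpow_le_one_of_one_le_of_nonpos hm1 (by linarith)
  have hD0 : 0 < (d : ℝ) ^ (-δ) := Real.rpow_pos_of_pos (by linarith) _
  have hD1 : (d : ℝ) ^ (-δ) ≤ 1 := Real.rpow_le_one_of_one_le_of_nonpos (by linarith) (by linarith)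
  have hrb : r * (m : ℝ) ^ (-δ) ≤ 1 := mul_le_one₀ hr1 hb0.le hb1
  have h2γ : 0 < 2 * γ := by linarith
  have hν1 : ν ≤ 1 := by
    rw [← Real.rpow_le_rpow_iff hν.le zero_le_one h2γ, hν', Real.one_rpow]
    exact hrb
  have hτν : τ ≤ ν := by
    rw [← Real.rpow_le_rpow_iff hτ.le hν.le h2γ, hν', hτ']
    linarith [mul_pos hr hb0]
  have hτ1 : τ ≤ 1 := hτν.trans hν1
  have hmτ : m * τ ^ 2 ≤ 1 := by
    rw [← Real.rpow_le_rpow_iff (by positivity) zero_le_one hγ, Real.one_rpow,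
      Real.mul_rpow (by positivity) (by positivity), ← Real.rpow_natCast τ 2,
      ← Real.rpow_mul hτ.le, Nat.cast_ofNat, hτ']
    have h1 : (m : ℝ) ^ γ * (m : ℝ) ^ (-δ) ≤ 1 := by
      rw [← Real.rpow_add (by linarith)]
      exact Real.rpow_le_one_of_one_le_of_nonpos hm1 (by linarith)
    have h2 : r * ((m : ℝ) ^ γ * (m : ℝ) ^ (-δ)) ≤ 1 := mul_le_one₀ hr1 (by positivity) h1
    nlinarith
  -- In fact `τ ≤ γ`: otherwise `γ^(2γ) ≤ τ^(2γ) ≤ 1/16`, whereas `2γ log γ ≥ 2γ - 2` gives `γ^(2γ)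
  -- ≥ e^(-2) > 1/16`.
  have hτδ : τ ≤ δ := by
    refine le_trans ?_ hγδ
    by_contra! hcon
    have h1 : γ ^ (2 * γ) ≤ τ ^ (2 * γ) := Real.rpow_le_rpow hγ.le hcon.le h2γ.le
    have h2 : Real.exp (-2) ≤ γ ^ (2 * γ) := by
      rw [Real.rpow_def_of_pos hγ]
      refine Real.exp_le_exp.2 ?_
      have h3 := mul_le_mul_of_nonneg_right (Real.one_sub_inv_le_log_of_pos hγ) h2γ.le
      have h4 : (1 - γ⁻¹) * (2 * γ) = 2 * γ - 2 := by field_simp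
      linarith
    have h3 : (1 / 16 : ℝ) < Real.exp (-2) := by
      rw [Real.exp_neg, ← one_div]
      refine one_div_lt_one_div_of_lt (Real.exp_pos _) ?_
      rw [show (2 : ℝ) = 1 + 1 by norm_num, Real.exp_add]
      nlinarith [Real.exp_one_lt_d9, Real.exp_pos 1]
    rw [hτ'] at h1
    linarith
  have hs1 : 1 ≤ √(d : ℝ) := Real.one_le_sqrt.2 (by linarith)
  set c := √(2 * d * (1 + 2 * δ)) with hc
  have hcsq : c ^ 2 = 2 * d * (1 + 2 * δ) := Real.sq_sqrt (by positivity)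
  have hc0 : 0 < c := Real.sqrt_pos.2 (by positivity)
  have hc2 : 2 ≤ c := by
    refine Real.le_sqrt_of_sq_le ?_
    nlinarith
  have hcσ : 6 * (c * σ) ≤ τ ^ 2 := by
    have : 1 / (6 * c) * τ ^ 2 = τ ^ 2 / (6 * c) := by ring
    rw [this, le_div_iff₀ (by positivity)] at hσ'
    linarith
  have hτ2 : τ ^ 2 ≤ 1 := pow_le_one₀ hτ.le hτ1
  have hκ0 : 0 < κ := by
    rw [hκ]
    exact mul_pos hr (Real.rpow_pos_of_pos hν _)
  have hκ1 : κ ≤ 1 := by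
    rw [hκ]
    exact mul_le_one₀ hr1 (Real.rpow_nonneg hν.le _)
      (Real.rpow_le_one hν.le hν1 (by linarith))
  have hT0 : 0 < τ ^ (2 * δ) := Real.rpow_pos_of_pos hτ _
  have hT1 : τ ^ (2 * δ) ≤ 1 := Real.rpow_le_one hτ.le hτ1 (by linarith)
  rw [Real.rpow_add hτ, show (2 : ℝ) = ((2 : ℕ) : ℝ) by norm_num, Real.rpow_natCast,
    Nat.cast_ofNat] at he'
  exact
    { one_le_d := by omega
      one_le_m := hm
      r_pos := hr
      r_le := hr1
      γ_pos := hγ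
      γ_le := hγδ
      ν_pos := hν
      ν_le := hν1
      ν_pow := hν'
      τ_pos := hτ
      τ_le := hτν
      τ_pow := hτ'
      m_mul_τ := hmτ
      τ_le_δ := hτδ
      κ_eq := hκ
      σ_pos := hσ
      σ_le := by nlinarith
      σ_sq_le := by
        have h1 : (6 * (c * σ)) ^ 2 ≤ 1 := pow_le_one₀ (by positivity) (hcσ.trans hτ2)
        rw [mul_pow, mul_pow, hcsq] at h1
        linarith
      σ_sqrt_le := by
        have h1 : 4 / 3 * √(d : ℝ) ≤ c := by
          refine abs_le_of_sq_le_sq' ?_ hc0.le |>.2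
          rw [mul_pow, Real.sq_sqrt (by linarith), hcsq]
          nlinarith
        have h2 : 6 * (4 / 3 * √(d : ℝ) * σ) ≤ 6 * (c * σ) := by gcongr
        linarith
      e_pos := he
      e_le := error_le hs1 hσ hτ hτ1 hν hν1 hκ1 hb0 hT0 hT1 hD0 hD1 he'
      e_le_gap := error_le_gap hs1 hσ hτ hν hν1 hκ0 hb0 hT0 hT1 hD0 hD1 he'
      e_le_dim := by
        refine error_le_dim hs1 hσ hτ hτ1 hν hν1 hκ1 hb0 hb1 hT0 hT1 ?_
          (Real.rpow_pos_of_pos (by linarith) _) he'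
        rw [← Real.rpow_add (by linarith), neg_add_cancel, Real.rpow_zero] }

variable {α β γ δ : ℝ}

/-- The scale of the smallest coordinate at a fixed point of the iteration. -/
def nu (α β γ δ : ℝ) (m : ℕ) : ℝ := (β * γ / (α * δ) * (m : ℝ) ^ (-δ)) ^ (1 / (2 * γ))

/-- The lower bound on the elasticity of the profiles. -/
def kappa (α β γ δ : ℝ) (m : ℕ) : ℝ := β * γ / (α * δ) * nu α β γ δ m ^ (2 * (δ - γ))

lemma nu_pos (hα : 0 < α) (hβ : 0 < β) (hγ : 0 < γ) (hδ : 0 < δ)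
    (hm : 1 ≤ m) : 0 < nu α β γ δ m := by
  have : (0 : ℝ) < m := by exact_mod_cast hm
  unfold nu
  positivity

lemma tau_pos (hα : 0 < α) (hβ : 0 < β) (hγ : 0 < γ) (hδ : 0 < δ)
    (hm : 1 ≤ m) : 0 < tau α β γ δ m := by
  have : (0 : ℝ) < m := by exact_mod_cast hm
  unfold tau
  positivity

lemma kappa_pos (hα : 0 < α) (hβ : 0 < β) (hγ : 0 < γ) (hδ : 0 < δ)
    (hm : 1 ≤ m) : 0 < kappa α β γ δ m := by
  have := nu_pos hα hβ hγ hδ hm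
  unfold kappa
  positivity

lemma nu_rpow (hα : 0 < α) (hβ : 0 < β) (hγ : 0 < γ) (hδ : 0 < δ)
    (hm : 1 ≤ m) : nu α β γ δ m ^ (2 * γ) = β * γ / (α * δ) * (m : ℝ) ^ (-δ) := by
  have : (0 : ℝ) < m := by exact_mod_cast hm
  rw [nu, ← Real.rpow_mul (by positivity), one_div_mul_cancel (by positivity), Real.rpow_one]

lemma tau_rpow (hα : 0 < α) (hβ : 0 < β) (hγ : 0 < γ) (hδ : 0 < δ)
    (hm : 1 ≤ m) : tau α β γ δ m ^ (2 * γ) = β * γ / (α * δ) * (m : ℝ) ^ (-δ) / 16 := by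
  have : (0 : ℝ) < m := by exact_mod_cast hm
  rw [tau, ← Real.rpow_mul (by positivity), one_div_mul_cancel (by positivity), Real.rpow_one]
  field_simp

lemma log_nu (hα : 0 < α) (hβ : 0 < β) (hγ : 0 < γ) (hδ : 0 < δ)
    (hm : 1 ≤ m) :
    Real.log (nu α β γ δ m) = 1 / (2 * γ) * (Real.log (β * γ / (α * δ)) - δ * Real.log m) := by
  have : (0 : ℝ) < m := by exact_mod_cast hm
  rw [nu, Real.log_rpow (by positivity), Real.log_mul (by positivity) (by positivity),
    Real.log_rpow this]
  ring

lemma log_kappa (hα : 0 < α) (hβ : 0 < β) (hγ : 0 < γ) (hδ : 0 < δ)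
    (hm : 1 ≤ m) : Real.log (kappa α β γ δ m) = Real.log (β * γ / (α * δ)) +
    2 * (δ - γ) * (1 / (2 * γ) * (Real.log (β * γ / (α * δ)) - δ * Real.log m)) := by
  have hν := nu_pos hα hβ hγ hδ hm
  rw [kappa, Real.log_mul (by positivity) (by positivity), Real.log_rpow hν,
    log_nu hα hβ hγ hδ hm]

/-- The powers of `r` and `m` in `E(η)` are exactly `κ ν m^(-δ)`; comparing logarithms makes this a
rational identity. -/
lemma epsDiverge_eq (hα : 0 < α) (hβ : 0 < β) (hγ : 0 < γ) (hδ : 0 < δ)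
    (hm : 1 ≤ m) (η : ℝ) : epsDiverge α β γ δ m η =
    9 / 256 * (β / δ) * (kappa α β γ δ m * nu α β γ δ m) * (m : ℝ) ^ (-δ) *
      tau α β γ δ m ^ (2 + 2 * δ) * η := by
  have hm0 : (0 : ℝ) < m := by exact_mod_cast hm
  have hν := nu_pos hα hβ hγ hδ hm
  have hκ := kappa_pos hα hβ hγ hδ hm
  have h1 : (β * γ / (α * δ)) ^ ((2 * δ + 1) / (2 * γ)) *
      (m : ℝ) ^ (-(δ / γ) * (1 / 2 + δ - γ) - δ) =
      kappa α β γ δ m * nu α β γ δ m * (m : ℝ) ^ (-δ) := by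
    refine Real.log_injOn_pos (mem_Ioi.2 (by positivity)) (mem_Ioi.2 (by positivity)) ?_
    rw [Real.log_mul (by positivity) (by positivity), Real.log_mul (by positivity) (by positivity),
      Real.log_mul (by positivity) (by positivity), Real.log_rpow (by positivity),
      Real.log_rpow hm0, Real.log_rpow hm0, log_kappa hα hβ hγ hδ hm, log_nu hα hβ hγ hδ hm]
    field_simp
    ring
  rw [epsDiverge, mul_assoc (9 / 256 * (β / δ)), h1]
  ring

lemma eta_eq (hα : 0 < α) (hβ : 0 < β) (hγ : 0 < γ) (hδ : 0 < δ)
    (hm : 1 ≤ m) (σ : ℝ) : eta α β γ δ d m σ =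
    σ / √d * nu α β γ δ m ^ 2 * tau α β γ δ m ^ 2 := by
  have hm0 : (0 : ℝ) < m := by exact_mod_cast hm
  have hν := nu_pos hα hβ hγ hδ hm
  have h1 : (β * γ / (α * δ * (m : ℝ) ^ δ)) ^ (1 / γ) = nu α β γ δ m ^ 2 := by
    refine Real.log_injOn_pos (mem_Ioi.2 (by positivity)) (mem_Ioi.2 (by positivity)) ?_
    rw [Real.log_rpow (by positivity), Real.log_pow, log_nu hα hβ hγ hδ hm, ← div_div,
      Real.log_div (by positivity) (by positivity), Real.log_rpow hm0]
    push_cast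
    field_simp
  rw [eta, h1]

/-- The argument of the ceiling in `Nspread` at `η₀`: the powers of `1/r` and `m` combine to `1/κ`,
and `η₀ = (σ/√d) ν² τ²`. -/
lemma spreadTime_eq (hα : 0 < α) (hβ : 0 < β) (hγ : 0 < γ) (hδ : 0 < δ)
    (hm : 1 ≤ m) {σ : ℝ} (hσ : 0 < σ) (hd : 1 ≤ d) :
    3 / (2 * eta α β γ δ d m σ) * (α * δ / (β * γ)) ^ (δ / γ) * (m : ℝ) ^ (δ / γ * (δ - γ)) *
      (1 / γ * Real.log (4 * α * δ / (β * γ)) + δ / γ * Real.log m) =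
    spreadTime d m (β * γ / (α * δ)) γ δ (nu α β γ δ m) (tau α β γ δ m) (kappa α β γ δ m) σ := by
  have hm0 : (0 : ℝ) < m := by exact_mod_cast hm
  have hd0 : 0 < √(d : ℝ) := Real.sqrt_pos.2 (by exact_mod_cast hd)
  have hν := nu_pos hα hβ hγ hδ hm
  have hκ := kappa_pos hα hβ hγ hδ hm
  have hτ := tau_pos hα hβ hγ hδ hm
  have h1 : (α * δ / (β * γ)) ^ (δ / γ) * (m : ℝ) ^ (δ / γ * (δ - γ)) =
      1 / kappa α β γ δ m := by
    refine Real.log_injOn_pos (mem_Ioi.2 (by positivity)) (mem_Ioi.2 (by positivity)) ?_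
    rw [one_div, Real.log_inv, Real.log_mul (by positivity) (by positivity),
      Real.log_rpow (by positivity), Real.log_rpow hm0, log_kappa hα hβ hγ hδ hm,
      ← inv_div (β * γ), Real.log_inv]
    field_simp
    ring
  have h2 : 4 * α * δ / (β * γ) = 4 / (β * γ / (α * δ)) := by field_simp
  rw [mul_assoc (3 / (2 * eta α β γ δ d m σ)), h1, eta_eq hα hβ hγ hδ hm, h2, spreadTime]
  field_simp

end Parameters

/-! ### Reading off the numbers of iterations -/

/-- The number of superlinear convergence steps. -/
lemma exists_Nsc {α β γ δ ε : ℝ} (hα : 0 < α) (hβ : 0 < β) (hγ : 0 < γ) (hδ : 0 < δ) (hε : 0 < ε)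
    (h : (4 * (δ * ε / β)) ^ (2 * γ) ≤ β * γ / (α * δ) / 16) :
    ∃ n : ℕ, Nsc α β γ δ ε = n ∧
      2 ^ (-(1 + 2 * γ) ^ n) ≤ 8 / (β * γ / (α * δ)) * (4 * (δ * ε / β)) ^ (2 * γ) := by
  set r := β * γ / (α * δ) with hr
  set e := δ * ε / β with he
  have hr0 : 0 < r := by positivity
  have he0 : 0 < e := by positivity
  have hL : Real.logb 2 (β * γ / (8 * α * δ)) + 2 * γ * Real.logb 2 (β / (4 * δ * ε)) =
      Real.logb 2 (r / 8 / (4 * e) ^ (2 * γ)) := by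
    rw [show β * γ / (8 * α * δ) = r / 8 by rw [hr]; field_simp,
      Real.logb_div (x := r / 8) (by positivity) (by positivity), Real.logb_rpow_eq_mul_logb_of_pos
      (by positivity),
      show β / (4 * δ * ε) = (4 * e)⁻¹ by rw [he]; field_simp, Real.logb_inv]
    ring
  -- The smallness of `e` puts the inner logarithm at `1` or more, so the outer one is nonnegative
  -- and the integer ceiling is a natural number.
  have hq : 2 ≤ r / 8 / (4 * e) ^ (2 * γ) := by
    rw [le_div_iff₀ (by positivity)]
    linarith
  have hL1 : 1 ≤ Real.logb 2 (r / 8 / (4 * e) ^ (2 * γ)) := by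
    rw [Real.le_logb_iff_rpow_le one_lt_two (by positivity), Real.rpow_one]
    exact hq
  have hn0 : 0 ≤ Nsc α β γ δ ε := by
    rw [Nsc, hL]
    exact Int.ceil_nonneg (Real.logb_nonneg (by linarith) hL1)
  obtain ⟨n, hn⟩ := Int.eq_ofNat_of_zero_le hn0
  refine ⟨n, hn, ?_⟩
  have h1 : Real.logb 2 (r / 8 / (4 * e) ^ (2 * γ)) ≤ (1 + 2 * γ) ^ n := by
    have h2 : Real.logb (1 + 2 * γ) (Real.logb 2 (r / 8 / (4 * e) ^ (2 * γ))) ≤ n := by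
      have h3 := Int.le_ceil (Real.logb (1 + 2 * γ) (Real.logb 2 (r / 8 / (4 * e) ^ (2 * γ))))
      rw [← hL] at h3 ⊢
      change _ ≤ ((Nsc α β γ δ ε : ℤ) : ℝ) at h3
      rw [hn] at h3
      exact_mod_cast h3
    rwa [Real.logb_le_iff_le_rpow (by linarith) (by linarith), Real.rpow_natCast] at h2
  calc (2 : ℝ) ^ (-(1 + 2 * γ) ^ n) ≤ 2 ^ (-Real.logb 2 (r / 8 / (4 * e) ^ (2 * γ))) :=
        Real.rpow_le_rpow_of_exponent_le one_le_two (by linarith)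
    _ = 8 / r * (4 * e) ^ (2 * γ) := by
        rw [Real.rpow_neg two_pos.le, Real.rpow_logb two_pos (by norm_num) (by positivity)]
        field_simp

/-- With `47/48 ≤ exp(-1/48)` and `2 ≤ e`, the choice `I ≥ 100 m c` makes `(I-1)/48 - m` at least `m
c`, where `c ≥ log(m/p)`. -/
lemma pow_mul_two_pow_le {p : ℝ} {I : ℕ} (hm : 1 ≤ m) (hp : 0 < p) (hp1 : p < 1)
    (hI : 100 * m * (⌈Real.log (m / p)⌉ : ℝ) ≤ I) :
    1 ≤ I ∧ (47 / 48 : ℝ) ^ (I - 1) * 2 ^ m ≤ p / m := by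
  have hm1 : (1 : ℝ) ≤ m := by exact_mod_cast hm
  have hmp : 1 < m / p := (one_lt_div hp).2 (by linarith)
  have hlog : 0 < Real.log (m / p) := Real.log_pos hmp
  have hc1 : (1 : ℝ) ≤ ⌈Real.log (m / p)⌉ := by exact_mod_cast Int.ceil_pos.2 hlog
  have hc2 : Real.log (m / p) ≤ ⌈Real.log (m / p)⌉ := Int.le_ceil _
  generalize (⌈Real.log (m / p)⌉ : ℝ) = c at *
  have hmc : 1 ≤ m * c := one_le_mul_of_one_le_of_one_le hm1 hc1
  have hI1 : 1 ≤ I := by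
    have : (1 : ℝ) ≤ I := by linarith
    exact_mod_cast this
  refine ⟨hI1, ?_⟩
  have h1 : (47 / 48 : ℝ) ≤ Real.exp (-(1 / 48)) := by
    have := Real.add_one_le_exp (-(1 / 48) : ℝ)
    linarith
  have h2 : (2 : ℝ) ≤ Real.exp 1 := by
    have := Real.add_one_le_exp (1 : ℝ)
    linarith
  have hcm : c ≤ m * c := le_mul_of_one_le_left (by linarith) hm1
  have hmm : (m : ℝ) ≤ m * c := le_mul_of_one_le_right (by linarith) hc1
  calc (47 / 48 : ℝ) ^ (I - 1) * 2 ^ m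
      ≤ Real.exp (-(1 / 48)) ^ (I - 1) * Real.exp 1 ^ m := by gcongr
    _ = Real.exp (-(((I : ℝ) - 1) / 48) + m) := by
        rw [← Real.exp_nat_mul, ← Real.exp_nat_mul, ← Real.exp_add, Nat.cast_sub hI1]
        congr 1
        push_cast
        ring
    _ ≤ Real.exp (-Real.log (m / p)) := Real.exp_le_exp.2 (by linarith)
    _ = p / m := by
        rw [Real.exp_neg, Real.exp_log (by positivity), inv_div]

/-! ### From robust functions to gradient models -/

namespace BEF

variable {B : BEF d m} {α β γ δ : ℝ}

/-- The two integrated bounds on one profile must be compatible: `β/δ b^δ ≤ α/γ b^γ` on `(0, 1]`. At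
`b = 1` this gives `r ≤ 1`; for small `b` it excludes `δ < γ`. -/
lemma Robust.ratio_le (hR : B.Robust α β γ δ) (hm : 1 ≤ m) :
    β * γ / (α * δ) ≤ 1 ∧ γ ≤ δ := by
  obtain ⟨hα, hβ, hγ, hδ, -⟩ := id hR
  obtain ⟨f, -, hf, -⟩ := B.exists_profile hR ⟨0, hm⟩
  have h1 (b : ℝ) (hb : 0 < b) (hb1 : b ≤ 1) : β / δ * b ^ δ ≤ α / γ * b ^ γ := by
    have := (hf 0 b le_rfl hb.le hb1).1.trans (hf 0 b le_rfl hb.le hb1).2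
    simpa [Real.zero_rpow hδ.ne', Real.zero_rpow hγ.ne'] using this
  have h2 := h1 1 one_pos le_rfl
  rw [Real.one_rpow, Real.one_rpow, mul_one, mul_one, div_le_div_iff₀ hδ hγ] at h2
  refine ⟨(div_le_one (by positivity)).2 h2, ?_⟩
  by_contra! hcon
  -- `b` is chosen with `b^(γ-δ) = 1/C`, which makes the upper bound half of the lower one.
  set C := 2 * (α * δ / (β * γ)) with hC
  have hC1 : 1 ≤ C := by
    have : 1 ≤ α * δ / (β * γ) := (one_le_div (by positivity)).2 h2
    linarith
  set b := C ^ (-(1 / (γ - δ))) with hb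
  have hb0 : 0 < b := Real.rpow_pos_of_pos (by linarith) _
  have hγδ : 0 < γ - δ := by linarith
  have hb1 : b ≤ 1 := Real.rpow_le_one_of_one_le_of_nonpos hC1
    (by linarith [one_div_pos.2 hγδ])
  have h3 := h1 b hb0 hb1
  have h4 : b ^ γ = b ^ δ * C⁻¹ := by
    have h5 : b ^ (γ - δ) = C⁻¹ := by
      rw [hb, ← Real.rpow_mul (by linarith : 0 ≤ C), neg_mul, one_div_mul_cancel hγδ.ne',
        Real.rpow_neg_one]
    rw [← h5, ← Real.rpow_add hb0, add_sub_cancel]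
  have h5 : α / γ * (b ^ δ * C⁻¹) = β / δ * b ^ δ / 2 := by
    rw [hC]
    field_simp
  rw [h4, h5] at h3
  have h6 : 0 < β / δ * b ^ δ := mul_pos (div_pos hβ hδ) (Real.rpow_pos_of_pos hb0 _)
  linarith

/-- An approximate gradient of a robust basis encoding function, suitably normalized. -/
lemma Robust.exists_isGradientModel (hR : B.Robust α β γ δ) {gradHat : E d → E d} {ε : ℝ}
    (hε : B.IsApprox gradHat ε) :
    ∃ φ, IsGradientModel B.Z φ (β * γ / (α * δ)) γ δ (δ * ε / β) ((δ / (2 * β)) • gradHat) := by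
  obtain ⟨hα, hβ, hγ, hδ, -⟩ := id hR
  choose f hf0 hf hfg using B.exists_profile hR
  -- The factor `δ/β` normalizes the lower bound to increments of `t^δ`. The extra `1/2` on the
  -- gradient cancels the `2` in `g'(y) = ±2y f(y²)` and leaves the error `e/2`.
  refine ⟨fun k t => δ / β * f k t, B.orthonormal, fun k => ⟨?_, ?_, ?_⟩, ?_⟩
  · rw [hf0, mul_zero]
  · intro a b ha hab hb
    have h1 := mul_le_mul_of_nonneg_left (hf k a b ha hab hb).1 (div_pos hδ hβ).le
    rwa [← mul_assoc, div_mul_div_cancel₀ hβ.ne', div_self hδ.ne', one_mul, mul_sub] at h1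
  · intro a b ha hab hb
    have h1 := mul_le_mul_of_nonneg_left (hf k a b ha hab hb).2 (div_pos hδ hβ).le
    rw [mul_sub] at h1
    refine h1.trans_eq ?_
    field_simp
  · intro u hu
    have hg := B.gradF_eq hu
    have hin (k : Fin m) : inner ℝ (B.gradF u) (B.Z k) =
        derivWithin (B.g k) (Icc (-1) 1) (inner ℝ u (B.Z k)) := by
      rw [hg]
      exact B.orthonormal.inner_left_fintype _ k
    refine ⟨(δ / (2 * β)) • B.gradF u, ?_, fun k => ?_, ?_⟩
    · refine resid_self B.orthonormal _ fun v hv => ?_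
      rw [real_inner_smul_left, hg, sum_inner, Finset.sum_eq_zero, mul_zero]
      intro k _
      rw [real_inner_smul_left, real_inner_comm v (B.Z k), hv k, mul_zero]
    · rw [real_inner_smul_left, hin, abs_mul, abs_of_pos (by positivity),
        hfg k _ (abs_le.1 (B.abs_inner_le_one hu k))]
      field_simp
    · rw [Pi.smul_apply, ← smul_sub, norm_smul, Real.norm_eq_abs, abs_of_pos (by positivity)]
      have h1 := hε.2 u (by simpa using hu)
      calc δ / (2 * β) * ‖gradHat u - B.gradF u‖ ≤ δ / (2 * β) * ε := by gcongr
        _ = δ * ε / β / 2 := by field_simp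

end BEF

lemma GHat_smul {c : ℝ} (hc : 0 < c) (g : E d → E d) : GHat (c • g) = GHat g := by
  funext u
  by_cases h : g u = 0
  · simp [GHat, h]
  · rw [GHat, GHat, if_neg h, if_neg (by simpa [hc.ne'] using h), Pi.smul_apply, norm_smul,
      Real.norm_eq_abs, abs_of_pos hc, smul_smul, mul_inv, mul_assoc, mul_comm ‖g u‖⁻¹ c,
      inv_mul_cancel_left₀ hc.ne']

/-- The algorithm only depends on the direction of the gradient estimate. -/
def RobustGIRecoveryRun.rescale {Ω : Type*} [MeasurableSpace Ω] {P : Measure Ω} {g : E d → E d}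
    {σ : ℝ} {N₁ N₂ I mhat : ℕ} {c : ℝ} (Y : RobustGIRecoveryRun P g σ N₁ N₂ I mhat)
    (hG : GHat (c • g) = GHat g) : RobustGIRecoveryRun P (c • g) σ N₁ N₂ I mhat where
  ℱ := Y.ℱ
  ℱ_le := Y.ℱ_le
  ℱ_mono := Y.ℱ_mono
  ℱ_next := Y.ℱ_next
  μ := Y.μ
  call k hk := (Y.call k hk).rescale hG

end HiddenBasis

end

/-! ### Assembly -/

open HiddenBasis

theorem mainTheorem4 :
    ∃ C₀ C₁ C₂ : ℝ, 0 < C₀ ∧ 0 < C₁ ∧ 0 < C₂ ∧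
      ∀ (d m : ℕ), 2 ≤ d → 1 ≤ m →
      ∀ (B : HiddenBasis.BEF d m) (α β γ δ : ℝ), B.Robust α β γ δ →
      ∀ (gradHat : HiddenBasis.E d → HiddenBasis.E d) (ε : ℝ),
        Measurable gradHat → B.IsApprox gradHat ε →
      ∀ (σ p : ℝ) (N₁ N₂ I mhat : ℕ),
        0 < σ →
        σ ≤ 1 / (6 * √(2 * d * (1 + 2 * δ))) * HiddenBasis.tau α β γ δ m ^ 2 →
        ε ≤ C₀ * HiddenBasis.epsDiverge α β γ δ m (HiddenBasis.eta α β γ δ d m σ) *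
          (d : ℝ) ^ (-δ) →
        2 * (HiddenBasis.Nsc α β γ δ ε : ℝ) ≤ N₁ →
        2 * (HiddenBasis.Nsc α β γ δ ε : ℝ) +
          C₁ * (HiddenBasis.Nspread α β γ δ m ε (HiddenBasis.eta α β γ δ d m σ) : ℝ) ≤ N₂ →
        0 < p → p < 1 →
        C₂ * m * (⌈Real.log (m / p)⌉ : ℝ) ≤ I →
        ∀ (hm : m ≤ mhat), mhat ≤ d →
      ∀ (Ω : Type*) [MeasurableSpace Ω] (P : MeasureTheory.Measure Ω)
        [MeasureTheory.IsProbabilityMeasure P]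
        (R : HiddenBasis.RobustGIRecoveryRun P gradHat σ N₁ N₂ I mhat),
        ENNReal.ofReal (1 - p) ≤
          P {ω | ∃ (π : Equiv.Perm (Fin m)) (s : Fin m → ℝ), (∀ i, s i = 1 ∨ s i = -1) ∧
            ∀ i : Fin m, ‖s i • R.μ i ω - B.Z (π i)‖ ≤ 4 * √2 * δ * ε / β} := by
  -- `C₀ = 1/10` turns `9/256` into the `9/2560` of `Regime.of_bounds`; `C₁` is the `100` of
  -- `exists_step_counts` and `C₂` that of `pow_mul_two_pow_le`.
  refine ⟨1 / 10, 100, 100, by norm_num, by norm_num, by norm_num, ?_⟩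
  intro d m hd hm B α β γ δ hR gradHat ε hmeas happ σ p N₁ N₂ I mhat hσ hσ' hε _ hN₂ hp hp1 hI
    hmhat _ Ω _ P _ Y
  obtain ⟨hα, hβ, hγ, hδ, -⟩ := id hR
  obtain ⟨hr1, hγδ⟩ := hR.ratio_le hm
  obtain ⟨φ, M⟩ := hR.exists_isGradientModel happ
  have he0 : 0 < δ * ε / β := div_pos (mul_pos hδ happ.1) hβ
  have he : δ * ε / β ≤ 9 / 2560 * (kappa α β γ δ m * nu α β γ δ m) * (m : ℝ) ^ (-δ) *
      tau α β γ δ m ^ (2 + 2 * δ) * (σ / √d * nu α β γ δ m ^ 2 * tau α β γ δ m ^ 2) *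
      (d : ℝ) ^ (-δ) := by
    rw [epsDiverge_eq hα hβ hγ hδ hm, eta_eq hα hβ hγ hδ hm] at hε
    rw [div_le_iff₀ hβ]
    refine (mul_le_mul_of_nonneg_left hε hδ.le).trans_eq ?_
    field_simp
    ring
  have R : Regime d m (β * γ / (α * δ)) γ δ (nu α β γ δ m) (tau α β γ δ m) (kappa α β γ δ m) σ
      (δ * ε / β) :=
    Regime.of_bounds hd hm (by positivity) hr1 hγ hγδ (nu_pos hα hβ hγ hδ hm)
      (nu_rpow hα hβ hγ hδ hm) (tau_pos hα hβ hγ hδ hm) (tau_rpow hα hβ hγ hδ hm) rfl hσ hσ' he0 he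
  have hb1 := R.base_le_one
  have h4e : (4 * (δ * ε / β)) ^ (2 * γ) ≤ β * γ / (α * δ) / 16 := by
    have h1 : 4 * (δ * ε / β) ≤ tau α β γ δ m := by
      have h2 : σ * tau α β γ δ m * (m : ℝ) ^ (-δ) ≤ 1 * tau α β γ δ m * 1 := by
        have := R.σ_le_twelfth
        have := R.τ_pos
        have := R.base_pos
        gcongr
        linarith
      have := R.e_le
      linarith [R.τ_pos]
    refine (Real.rpow_le_rpow (by positivity) h1 (by positivity)).trans ?_
    rw [R.τ_pow]
    have := mul_le_of_le_one_right R.r_pos.le hb1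
    linarith
  obtain ⟨n, hn, hn'⟩ := exists_Nsc hα hβ hγ hδ happ.1 h4e
  set X := spreadTime d m (β * γ / (α * δ)) γ δ (nu α β γ δ m) (tau α β γ δ m)
    (kappa α β γ δ m) σ with hX
  have h10 := R.ten_div_le
  have hX0 : 0 < X := by
    have h1 : 0 < γ * (5 * X) := (div_pos (by norm_num) hσ).trans_le h10
    have := pos_of_mul_pos_right h1 hγ.le
    linarith
  rw [Nspread, spreadTime_eq hα hβ hγ hδ hm hσ (by omega), hn] at hN₂
  push_cast at hN₂
  have hY1 : (1 : ℝ) ≤ (⌈X⌉ : ℝ) := by exact_mod_cast Int.ceil_pos.2 hX0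
  have hXY : X ≤ (⌈X⌉ : ℝ) := Int.le_ceil X
  have hn0 : (0 : ℝ) ≤ n := Nat.cast_nonneg n
  -- The lower bound on `N₂` is `2n + 100(⌈X⌉ + 2n)` with `n` the value of `Nsc`, so it covers both
  -- the spreading phase and the final convergence.
  have hN100 : 100 * (⌈X⌉ : ℝ) ≤ N₂ := by linarith
  have hN2 : 2 ≤ N₂ := by
    have : (2 : ℝ) ≤ N₂ := by linarith
    exact_mod_cast this
  have hnN : n ≤ N₂ := by
    have : (n : ℝ) ≤ N₂ := by linarith
    exact_mod_cast this
  have hγN : 10 / σ ≤ γ * N₂ := h10.trans (by gcongr; linarith)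
  obtain ⟨hI1, hIp⟩ := pow_mul_two_pow_le hm hp hp1 hI
  have hc : 0 < δ / (2 * β) := by positivity
  refine ((Y.rescale (GHat_smul hc gradHat)).measure_recovers_ge (hmeas.const_smul _) hd M R hN2
    hγN (M.losesBig R hY1 hXY hN100) hnN hn' hI1 hmhat hp.le hIp).trans_eq ?_
  rw [show 4 * √2 * δ * ε / β = √2 * (4 * (δ * ε / β)) by ring]
  rfl
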